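/- Let $\mathfrak g$ be a finite-dimensional simple complex Lie algebra of rank $r$ with Cartan matrix $(A_{ij})_{1\le i,j\le r}$. Extend it to a matrix $(A_{IJ})_{0\le I,J\le r}$ with $A_{00}=0$, with $A_{0i}=A_{i0}$ non-positive integers, and with $\det(A_{IJ})=-\frac{D-1}{D-2}\det(A_{ij})$ for some integer $D\ge 3$. All superalgebras below are over $\mathbb C$ and $\mathbb Z$-graded, the parity of an element being its degree modulo 2; $[\![\cdot,\cdot]\!]$ is the supercommutator. **The BKM superalgebra.** $\mathcal B$ is the Lie superalgebra generated by $e_I,f_I$ ($0\le I\le r$), where $e_0$ has degree $1$, $f_0$ has degree $-1$, and all other generators have degree $0$, modulo the relations (with $h_I=[\![e_I,f_I]\!]$) $[\![h_I,e_J]\!]=A_{IJ}e_J$, $[\![h_I,f_J]\!]=-A_{IJ}f_J$, $[\![e_I,f_J]\!]=0$ for $I\ne J$, $[\![e_0,e_0]\!]=[\![f_0,f_0]\!]=0$, and $(\mathrm{ad}\,e_i)^{1-A_{iJ}}(e_J)=(\mathrm{ad}\,f_i)^{1-A_{iJ}}(f_J)=0$ for $1\le i\le r$, $J\neq i$. Here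 $\mathfrak g\subseteq\mathcal B_0$ is the subalgebra generated by $e_i,f_i$ with $i\ge1$. For $p\ge 1$ let $\mathbf s_p$ be the adjoint representation of $\mathfrak g$ on the degree-$p$ subspace $\mathcal B_p$. **The universal graded Lie superalgebra.** Let $U$ be the graded Lie superalgebra with $U_1=\mathcal B_1$, with $U_{-k}=\mathrm{Hom}(U_1,U_{-k+1})$ for $k\ge 0$, and with $U_+=\bigoplus_{p\geq 1}U_p$ the free Lie superalgebra on $U_1$. Its supercommutator satisfies $[\![x,y]\!]=y(x)$ for $x\in U_1$, $y\in U_{-k}$, and $[\![x,y]\!](u)=[\![x(u),y]\!]-(-1)^{kl}[\![y(u),x]\!]$ for $x\in U_{-k}$, $y\in U_{-l}$, $u\in U_1$ ($k,l\ge0$). Embed $\mathfrak g$ in $U_0=\mathrm{End}\,\mathcal B_1$ by $z\mapsto(u\mapsto[\![u,z]\!])$. For a subspace $M\subseteq U_{-1}$ let $V(M)$ be the subalgebra of $U$ generated by $U_1$ and $M$, let $\mathcal D_+(M)$ be the largest graded ideal of $V(M)$ contained in $\bigoplus_{p\ge2}V(M)_p$, and put $V'(M)=V(M)/\mathcal D_+(M)$.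 Note that $V(M)_+=U_+$, and let $\mathcal C_+$ be the kernel of the homomorphism $U_+\to\mathcal B$ that is the identity on $\mathcal B_1$. **The tensor hierarchy algebra.** Call $M\subseteq U_{-1}$ admissible if 1. the elements $[\![u,\Phi]\!]=\Phi(u)$, for $u\in\mathcal B_1$ and $\Phi\in M$, span $\mathfrak g\subseteq U_0$; 2. $V'(M)_2\subseteq\mathcal B_2$ as quotients of $U_2$, that is, $(\mathcal C_+)_2\subseteq\mathcal D_+(M)$; 3. there is $\Theta\in M$ with $[\![\Theta,\Theta]\!]=0$ such that $[\![\Theta,\mathcal B_1]\!]$ is a non-abelian subalgebra of $\mathfrak g$. Assume that there is an admissible subspace, let $\mathcal T_{-1}$ be the sum of all admissible subspaces, and let $\mathcal T=V'(\mathcal T_{-1})$ be the tensor hierarchy algebra. Then $\mathfrak g\cong\mathcal T_0$, and for $p\ge 1$ let $\mathbf r_p$ be the adjoint representation of $\mathfrak g$ on $\mathcal T_p$. **Statement.** For all $p\ge1$, $$(\mathcal C_+)_p\subseteq\mathcal D_+(\mathcal T_{-1}),\qquad\text{and}\qquad \mathbf r_p\subseteq\mathbf s_p,$$ the latter meaning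 that there is an injective $\mathfrak g$-equivariant linear map $\mathcal T_p\to\mathcal B_p$. -/

import Mathlib

noncomputable section

namespace TensorHierarchy

/-! ### Graded Lie superalgebras given by generators and relations -/

/-- The sign `(-1) ^ (p * q)`. -/
def sgn (p q : ℤ) : ℂ := (((p * q).negOnePow : ℤ) : ℂ)

/-- The free non-associative complex algebra on `X`, whose product is a formal supercommutator. -/
abbrev Words (X : Type) : Type := FreeNonUnitalNonAssocAlgebra ℂ X

/-- The generator `x`, as a word. -/
abbrev gen {X : Type} (x : X) : Words X := FreeNonUnitalNonAssocAlgebra.of ℂ x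

/-- A bracketed monomial in the generators. -/
def mono {X : Type} (m : FreeMagma X) : Words X := MonoidAlgebra.ofMagma ℂ (FreeMagma X) m

/-- The degree of a monomial, the generators having prescribed degrees. -/
def monoDeg {X : Type} (deg : X → ℤ) : FreeMagma X → ℤ
  | .of x => deg x
  | .mul a b => monoDeg deg a + monoDeg deg b

/-- The words of degree `p`. -/
def wordsOfDeg {X : Type} (deg : X → ℤ) (p : ℤ) : Submodule ℂ (Words X) :=
  Submodule.span ℂ {w | ∃ m : FreeMagma X, monoDeg deg m = p ∧ w = mono m}

/-- The (anti)symmetry and Jacobi relations of a Lie superalgebra, on monomials. The parity of an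
element of degree `p` is `p` modulo 2. -/
inductive LieRel {X : Type} (deg : X → ℤ) : Words X → Prop
  | skew (a b : FreeMagma X) :
      LieRel deg (mono a * mono b + sgn (monoDeg deg a) (monoDeg deg b) • (mono b * mono a))
  | jacobi (a b c : FreeMagma X) :
      LieRel deg (mono a * (mono b * mono c) - (mono a * mono b) * mono c
        - sgn (monoDeg deg a) (monoDeg deg b) • (mono b * (mono a * mono c)))

/-- A linear subspace stable under left and right multiplication. -/
def IsIdeal {A : Type} [NonUnitalNonAssocRing A] [Module ℂ A] (I : Submodule ℂ A) : Prop :=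
  ∀ a b : A, b ∈ I → a * b ∈ I ∧ b * a ∈ I

/-- The ideal generated by the axioms of a Lie superalgebra together with the relations `R`. -/
def relIdeal {X : Type} (deg : X → ℤ) (R : Words X → Prop) : Submodule ℂ (Words X) :=
  sInf {I | (∀ w, LieRel deg w → w ∈ I) ∧ (∀ w, R w → w ∈ I) ∧ IsIdeal I}

theorem relIdeal_isIdeal {X : Type} (deg : X → ℤ) (R : Words X → Prop) :
    IsIdeal (relIdeal deg R) := by
  intro a b hb
  simp only [relIdeal, Submodule.mem_sInf, Set.mem_ofPred_eq] at hb ⊢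
  exact ⟨fun I hI => (hI.2.2 a b (hb I hI)).1, fun I hI => (hI.2.2 a b (hb I hI)).2⟩

/-- The product induced on the quotient by an ideal. -/
def quotMul {A : Type} [NonUnitalNonAssocRing A] [Module ℂ A] [IsScalarTower ℂ A A]
    [SMulCommClass ℂ A A] (I : Submodule ℂ A) (hI : IsIdeal I) :
    (A ⧸ I) →ₗ[ℂ] (A ⧸ I) →ₗ[ℂ] (A ⧸ I) :=
  I.liftQ
    { toFun := fun a => I.mapQ I (LinearMap.mulLeft ℂ a) fun b hb => (hI a b hb).1
      map_add' := fun a b => by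
        refine Submodule.linearMap_qext _ (LinearMap.ext fun x => ?_)
        exact congrArg I.mkQ (add_mul a b x)
      map_smul' := fun c a => by
        refine Submodule.linearMap_qext _ (LinearMap.ext fun x => ?_)
        exact congrArg I.mkQ (smul_mul_assoc c a x) }
    (fun a ha => by
      rw [LinearMap.mem_ker]
      refine Submodule.linearMap_qext _ (LinearMap.ext fun x => ?_)
      exact (Submodule.Quotient.mk_eq_zero I).2 (hI x a ha).2)

/-- The quotient of an algebra by an ideal. -/
abbrev quotRing {A : Type} [NonUnitalNonAssocRing A] [Module ℂ A] [IsScalarTower ℂ A A]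
    [SMulCommClass ℂ A A] (I : Submodule ℂ A) (hI : IsIdeal I) : NonUnitalNonAssocRing (A ⧸ I) where
  mul := fun x y => quotMul I hI x y
  left_distrib := fun x y z => by change quotMul I hI x (y + z) = _; rw [map_add]; rfl
  right_distrib := fun x y z => by
    change quotMul I hI (x + y) z = _; rw [map_add, LinearMap.add_apply]; rfl
  zero_mul := fun x => by change quotMul I hI 0 x = 0; rw [map_zero, LinearMap.zero_apply]
  mul_zero := fun x => by change quotMul I hI x 0 = 0; rw [map_zero]

/-- The graded Lie superalgebra with generators `X`, of the degrees `deg`, and relations `R`.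
Its supercommutator is written as a product `x * y`. -/
def Presented {X : Type} (deg : X → ℤ) (R : Words X → Prop) : Type :=
  Words X ⧸ relIdeal deg R

section Presented

variable {X : Type} {deg : X → ℤ} {R : Words X → Prop}

instance : NonUnitalNonAssocRing (Presented deg R) :=
  quotRing (relIdeal deg R) (relIdeal_isIdeal deg R)

instance : Module ℂ (Presented deg R) :=
  inferInstanceAs (Module ℂ (Words X ⧸ relIdeal deg R))

instance : IsScalarTower ℂ (Presented deg R) (Presented deg R) where
  smul_assoc c x y := by
    exact LinearMap.map_smul₂ (quotMul _ (relIdeal_isIdeal deg R)) c x y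

instance : SMulCommClass ℂ (Presented deg R) (Presented deg R) where
  smul_comm c x y := by
    exact ((quotMul _ (relIdeal_isIdeal deg R) x).map_smul c y).symm

/-- The class of a word. -/
def cls (deg : X → ℤ) (R : Words X → Prop) : Words X →ₗ[ℂ] Presented deg R :=
  (relIdeal deg R).mkQ

theorem cls_mul (a b : Words X) : cls deg R (a * b) = cls deg R a * cls deg R b := rfl

theorem cls_rel {w : Words X} (h : R w) : cls deg R w = 0 := by
  refine (Submodule.Quotient.mk_eq_zero _).2 ?_
  simp only [relIdeal, Submodule.mem_sInf, Set.mem_ofPred_eq]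
  exact fun I hI => hI.2.1 w h

theorem cls_lieRel {w : Words X} (h : LieRel deg w) : cls deg R w = 0 := by
  refine (Submodule.Quotient.mk_eq_zero _).2 ?_
  simp only [relIdeal, Submodule.mem_sInf, Set.mem_ofPred_eq]
  exact fun I hI => hI.1 w h

/-- The image of a generator. -/
def gn (deg : X → ℤ) (R : Words X → Prop) (x : X) : Presented deg R := cls deg R (gen x)

/-- The subspace of degree `p`. -/
def homog (deg : X → ℤ) (R : Words X → Prop) (p : ℤ) : Submodule ℂ (Presented deg R) :=
  (wordsOfDeg deg p).map (cls deg R)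

theorem homog_eq (p : ℤ) : homog deg R p =
    Submodule.span ℂ {x | ∃ m : FreeMagma X, monoDeg deg m = p ∧ x = cls deg R (mono m)} := by
  rw [homog, wordsOfDeg, Submodule.map_span]
  congr 1
  ext x
  constructor
  · rintro ⟨_, ⟨m, hm, rfl⟩, rfl⟩
    exact ⟨m, hm, rfl⟩
  · rintro ⟨m, hm, rfl⟩
    exact ⟨_, ⟨m, hm, rfl⟩, rfl⟩

theorem mono_mul (a b : FreeMagma X) : mono (a * b) = mono a * mono b :=
  map_mul (MonoidAlgebra.ofMagma ℂ (FreeMagma X)) a b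

theorem gn_mem (x : X) : gn deg R x ∈ homog deg R (deg x) := by
  rw [homog_eq]
  exact Submodule.subset_span ⟨.of x, rfl, rfl⟩

theorem mul_mem_homog {p q : ℤ} {x y : Presented deg R} (hx : x ∈ homog deg R p)
    (hy : y ∈ homog deg R q) : x * y ∈ homog deg R (p + q) := by
  rw [homog_eq] at hx hy
  induction hx using Submodule.span_induction with
  | zero => rw [zero_mul]; exact zero_mem _
  | add a b _ _ ha hb => rw [add_mul]; exact add_mem ha hb
  | smul c a _ ha => rw [smul_mul_assoc]; exact Submodule.smul_mem _ _ ha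
  | mem a ha =>
    obtain ⟨m, hm, rfl⟩ := ha
    induction hy using Submodule.span_induction with
    | zero => rw [mul_zero]; exact zero_mem _
    | add a b _ _ ha hb => rw [mul_add]; exact add_mem ha hb
    | smul c a _ ha => rw [mul_smul_comm]; exact Submodule.smul_mem _ _ ha
    | mem b hb =>
      obtain ⟨n, hn, rfl⟩ := hb
      rw [homog_eq]
      refine Submodule.subset_span ⟨m * n, ?_, ?_⟩
      · rw [← hm, ← hn]; rfl
      · rw [mono_mul, cls_mul]

/-- The supercommutator of a presented Lie superalgebra is (anti)symmetric. -/
theorem skew {p q : ℤ} {x y : Presented deg R} (hx : x ∈ homog deg R p)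
    (hy : y ∈ homog deg R q) : x * y = -(sgn p q • (y * x)) := by
  rw [homog_eq] at hx hy
  induction hx using Submodule.span_induction with
  | zero => simp
  | add a b _ _ ha hb => rw [add_mul, mul_add, ha, hb, smul_add, neg_add]
  | smul c a _ ha => rw [smul_mul_assoc, mul_smul_comm, ha, smul_neg, smul_comm]
  | mem a ha =>
    obtain ⟨m, rfl, rfl⟩ := ha
    induction hy using Submodule.span_induction with
    | zero => simp
    | add a b _ _ ha hb => rw [add_mul, mul_add, ha, hb, smul_add, neg_add]
    | smul c a _ ha => rw [smul_mul_assoc, mul_smul_comm, ha, smul_neg, smul_comm]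
    | mem b hb =>
      obtain ⟨n, rfl, rfl⟩ := hb
      have h := cls_lieRel (R := R) (LieRel.skew (deg := deg) m n)
      rw [map_add, map_smul, cls_mul, cls_mul] at h
      exact eq_neg_of_add_eq_zero_left h

/-- The supercommutator of a presented Lie superalgebra satisfies the Jacobi identity. -/
theorem jacobi {p q r : ℤ} {x y z : Presented deg R} (hx : x ∈ homog deg R p)
    (hy : y ∈ homog deg R q) (hz : z ∈ homog deg R r) :
    x * (y * z) = (x * y) * z + sgn p q • (y * (x * z)) := by
  rw [homog_eq] at hx hy hz
  induction hx using Submodule.span_induction with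
  | zero => simp
  | add a b _ _ ha hb => simp only [add_mul, mul_add, ha, hb, smul_add]; abel
  | smul c a _ ha =>
    simp only [smul_mul_assoc, mul_smul_comm, ha, smul_add]; rw [smul_comm c (sgn p q)]
  | mem a ha =>
    obtain ⟨m, rfl, rfl⟩ := ha
    induction hy using Submodule.span_induction with
    | zero => simp
    | add a b _ _ ha hb => simp only [add_mul, mul_add, ha, hb, smul_add]; abel
    | smul c a _ ha =>
      simp only [smul_mul_assoc, mul_smul_comm, ha, smul_add]; rw [smul_comm c (sgn _ q)]
    | mem b hb =>
      obtain ⟨n, rfl, rfl⟩ := hb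
      induction hz using Submodule.span_induction with
      | zero => simp
      | add a b _ _ ha hb => simp only [mul_add, ha, hb, smul_add]; abel
      | smul c a _ ha =>
        simp only [mul_smul_comm, ha, smul_add]; rw [smul_comm c (sgn _ _)]
      | mem c hc =>
        obtain ⟨k, rfl, rfl⟩ := hc
        have h := cls_lieRel (R := R) (LieRel.jacobi (deg := deg) m n k)
        simp only [map_sub, map_smul, cls_mul] at h
        rw [sub_sub, sub_eq_zero] at h
        exact h

end Presented

/-! ### The BKM superalgebra -/

/-- The Chevalley generators. -/
inductive ChevGen (r : ℕ) : Type
  | e : Fin (r + 1) → ChevGen r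
  | f : Fin (r + 1) → ChevGen r

/-- `e 0` has degree `1`, `f 0` has degree `-1`, the other generators have degree `0`. -/
def chevDeg (r : ℕ) : ChevGen r → ℤ
  | .e I => if I = 0 then 1 else 0
  | .f I => if I = 0 then -1 else 0

/-- The word `e I`. -/
abbrev eW {r : ℕ} (I : Fin (r + 1)) : Words (ChevGen r) := gen (ChevGen.e I)

/-- The word `f I`. -/
abbrev fW {r : ℕ} (I : Fin (r + 1)) : Words (ChevGen r) := gen (ChevGen.f I)

/-- The word `h I`, the supercommutator of `e I` and `f I`. -/
abbrev hW {r : ℕ} (I : Fin (r + 1)) : Words (ChevGen r) := eW I * fW I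

/-- The Chevalley relations and the Serre relations for the Cartan matrix `A`. -/
inductive BKMRel {r : ℕ} (A : Matrix (Fin (r + 1)) (Fin (r + 1)) ℤ) : Words (ChevGen r) → Prop
  | he (I J : Fin (r + 1)) : BKMRel A (hW I * eW J - (A I J : ℂ) • eW J)
  | hf (I J : Fin (r + 1)) : BKMRel A (hW I * fW J + (A I J : ℂ) • fW J)
  | ef (I J : Fin (r + 1)) (h : I ≠ J) : BKMRel A (eW I * fW J)
  | e0 : BKMRel A (eW 0 * eW 0)
  | f0 : BKMRel A (fW 0 * fW 0)
  | serreE (i : Fin r) (J : Fin (r + 1)) (h : J ≠ i.succ) :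
      BKMRel A ((fun w => eW i.succ * w)^[(1 - A i.succ J).toNat] (eW J))
  | serreF (i : Fin r) (J : Fin (r + 1)) (h : J ≠ i.succ) :
      BKMRel A ((fun w => fW i.succ * w)^[(1 - A i.succ J).toNat] (fW J))

/-- The Cartan matrix of `𝔤`: the row and the column `0` are deleted. -/
def finitePart {r : ℕ} (A : Matrix (Fin (r + 1)) (Fin (r + 1)) ℤ) : Matrix (Fin r) (Fin r) ℤ :=
  A.submatrix Fin.succ Fin.succ

/-- `A` is obtained from the Cartan matrix of a finite-dimensional simple complex Lie algebra by
adding a row and a column `0` as required, with the integer `D`. -/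
structure IsExtendedCartan {r : ℕ} (A : Matrix (Fin (r + 1)) (Fin (r + 1)) ℤ) (D : ℕ) : Prop where
  diag : ∀ i, finitePart A i i = 2
  nonpos : ∀ i j, i ≠ j → finitePart A i j ≤ 0
  zero_comm : ∀ i j, finitePart A i j = 0 → finitePart A j i = 0
  finite : FiniteDimensional ℂ ((finitePart A).ToLieAlgebra ℂ)
  simple : LieAlgebra.IsSimple ℂ ((finitePart A).ToLieAlgebra ℂ)
  zero_zero : A 0 0 = 0
  zero_nonpos : ∀ i : Fin r, A 0 i.succ ≤ 0
  zero_symm : ∀ i : Fin r, A 0 i.succ = A i.succ 0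
  three_le : 3 ≤ D
  det_eq : (A.det : ℚ) = -(((D : ℚ) - 1) / ((D : ℚ) - 2)) * ((finitePart A).det : ℚ)

/-- The BKM superalgebra with Cartan matrix `A`. -/
abbrev BKM {r : ℕ} (A : Matrix (Fin (r + 1)) (Fin (r + 1)) ℤ) : Type :=
  Presented (chevDeg r) (BKMRel A)

/-- The subspace of degree `p` of the BKM superalgebra. -/
abbrev BKM.deg {r : ℕ} (A : Matrix (Fin (r + 1)) (Fin (r + 1)) ℤ) (p : ℤ) : Submodule ℂ (BKM A) :=
  homog (chevDeg r) (BKMRel A) p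

/-- The Lie algebra `𝔤`, the subalgebra generated by `e i` and `f i` with `i ≠ 0`. -/
def gSub {r : ℕ} (A : Matrix (Fin (r + 1)) (Fin (r + 1)) ℤ) : NonUnitalSubalgebra ℂ (BKM A) :=
  NonUnitalAlgebra.adjoin ℂ
    {x | ∃ i : Fin r, x = gn _ (BKMRel A) (.e i.succ) ∨ x = gn _ (BKMRel A) (.f i.succ)}

theorem gSub_le {r : ℕ} (A : Matrix (Fin (r + 1)) (Fin (r + 1)) ℤ) {x : BKM A} (hx : x ∈ gSub A) :
    x ∈ BKM.deg A 0 := by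
  induction hx using NonUnitalAlgebra.adjoin_induction with
  | mem x hx =>
    obtain ⟨i, rfl | rfl⟩ := hx
    · simpa [chevDeg] using gn_mem (deg := chevDeg r) (R := BKMRel A) (.e i.succ)
    · simpa [chevDeg] using gn_mem (deg := chevDeg r) (R := BKMRel A) (.f i.succ)
  | zero => exact zero_mem _
  | add x y _ _ hx hy => exact add_mem hx hy
  | mul x y _ _ hx hy => simpa using mul_mem_homog hx hy
  | smul c x _ hx => exact Submodule.smul_mem _ c hx

theorem sgn_zero_left (q : ℤ) : sgn 0 q = 1 := by simp [sgn]

/-- `𝔤` as a Lie algebra. -/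
instance gSub.lieRing {r : ℕ} (A : Matrix (Fin (r + 1)) (Fin (r + 1)) ℤ) : LieRing (gSub A) where
  bracket x y := x * y
  add_lie x y z := add_mul x y z
  lie_add x y z := mul_add x y z
  lie_self x := by
    have h := skew (gSub_le A x.2) (gSub_le A x.2)
    rw [sgn_zero_left, one_smul] at h
    refine Subtype.ext ?_
    have h2 : (2 : ℂ) • ((x : BKM A) * x) = 0 := by
      rw [two_smul]; exact eq_neg_iff_add_eq_zero.1 h
    exact (smul_eq_zero.1 h2).resolve_left two_ne_zero
  leibniz_lie x y z := by
    have h := jacobi (gSub_le A x.2) (gSub_le A y.2) (gSub_le A z.2)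
    rw [sgn_zero_left, one_smul] at h
    exact Subtype.ext h

instance gSub.lieAlgebra {r : ℕ} (A : Matrix (Fin (r + 1)) (Fin (r + 1)) ℤ) :
    LieAlgebra ℂ (gSub A) where
  lie_smul c x y := mul_smul_comm c x y

section Representation

attribute [local instance] LieRing.ofAssociativeRing

/-- The representation `s_p` of `𝔤` on the subspace of degree `p` of the BKM superalgebra. -/
def sRep {r : ℕ} (A : Matrix (Fin (r + 1)) (Fin (r + 1)) ℤ) (p : ℤ) :
    gSub A →ₗ⁅ℂ⁆ Module.End ℂ (BKM.deg A p) where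
  toFun x :=
    { toFun := fun y => ⟨(x : BKM A) * y, by simpa using mul_mem_homog (gSub_le A x.2) y.2⟩
      map_add' := fun y z => Subtype.ext (mul_add _ _ _)
      map_smul' := fun c y => Subtype.ext (mul_smul_comm _ _ _) }
  map_add' x y := by ext z; exact add_mul _ _ _
  map_smul' c x := by ext z; exact smul_mul_assoc _ _ _
  map_lie' := by
    intro x y
    ext z
    have h := jacobi (gSub_le A x.2) (gSub_le A y.2) z.2
    rw [sgn_zero_left, one_smul] at h
    exact (eq_sub_iff_add_eq).2 h.symm

end Representation

/-! ### The universal graded Lie superalgebra of a vector space -/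

/-- The subspace of degree `1 - k` of the universal graded Lie superalgebra of `W`, for `k ≥ 0`:
`W` itself in degree `1`, and, going down, the linear maps from `W` to the preceding subspace. -/
def Low (W : ModuleCat.{0} ℂ) : ℕ → ModuleCat.{0} ℂ
  | 0 => W
  | k + 1 => ModuleCat.of ℂ (W →ₗ[ℂ] Low W k)

/-- Evaluation `y(u)` of an element `y` of degree `-k` at `u` in `W`. -/
def Low.app (W : ModuleCat.{0} ℂ) (k : ℕ) : Low W (k + 1) →ₗ[ℂ] W →ₗ[ℂ] Low W k :=
  LinearMap.id (R := ℂ) (M := W →ₗ[ℂ] Low W k)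

/-- The element given by a linear map. -/
def Low.lam (W : ModuleCat.{0} ℂ) (k : ℕ) : (W →ₗ[ℂ] Low W k) →ₗ[ℂ] Low W (k + 1) :=
  LinearMap.id (R := ℂ) (M := W →ₗ[ℂ] Low W k)

/-- Identification of subspaces of equal degrees. -/
def Low.cast (W : ModuleCat.{0} ℂ) {k l : ℕ} (h : k = l) : Low W k →ₗ[ℂ] Low W l :=
  h ▸ LinearMap.id

/-- The supercommutator of `x` of degree `1 - k` and `y` of degree `-l`. If `x` is in `W`, it is
`y(x)`. If `k = j + 1`, it is the linear map
`u ↦ ⟦x(u), y⟧ - (-1) ^ (j * l) ⟦y(u), x⟧`. -/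
def Low.br (W : ModuleCat.{0} ℂ) (k l : ℕ) :
    Low W k →ₗ[ℂ] Low W (l + 1) →ₗ[ℂ] Low W (l + k) :=
  match k with
  | 0 => (Low.app W l).flip
  | j + 1 => LinearMap.mk₂ ℂ
      (fun x y => Low.lam W (l + j)
        ((Low.br W j l).flip y ∘ₗ Low.app W j x
          - sgn j l • (Low.cast W (Nat.add_comm j l) ∘ₗ (Low.br W l j).flip x ∘ₗ Low.app W l y)))
      (fun x x' y => by
        rw [← map_add]; congr 1; ext u; simp; module)
      (fun c x y => by
        rw [← map_smul]; congr 1; ext u; simp; module)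
      (fun x y y' => by
        rw [← map_add]; congr 1; ext u; simp; module)
      (fun c x y => by
        rw [← map_smul]; congr 1; ext u; simp; module)
termination_by k + l

/-- The relations of the universal graded Lie superalgebra: linearity of the generators, and the
supercommutators of two elements of which at most one is in degree `1`, the other one being in
degree `0` or lower. -/
inductive UnivRel (W : ModuleCat.{0} ℂ) : Words (Σ k : ℕ, Low W k) → Prop
  | lin (k : ℕ) (c : ℂ) (x y : Low W k) :
      UnivRel W (gen ⟨k, c • x + y⟩ - c • gen ⟨k, x⟩ - gen ⟨k, y⟩)
  | br (k l : ℕ) (x : Low W k) (y : Low W (l + 1)) :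
      UnivRel W (gen ⟨k, x⟩ * gen ⟨l + 1, y⟩ - gen ⟨l + k, Low.br W k l x y⟩)

/-- The degrees of the generators. -/
def univDeg (W : ModuleCat.{0} ℂ) (x : Σ k : ℕ, Low W k) : ℤ := 1 - x.1

/-- The universal graded Lie superalgebra of `W`: the part of positive degrees is the free Lie
superalgebra on `W`, the part of degree `1 - k` is `Low W k` for `k ≥ 0`. -/
abbrev Univ (W : ModuleCat.{0} ℂ) : Type := Presented (univDeg W) (UnivRel W)

/-- The subspace of degree `p` of the universal graded Lie superalgebra. -/
abbrev Univ.deg (W : ModuleCat.{0} ℂ) (p : ℤ) : Submodule ℂ (Univ W) :=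
  homog (univDeg W) (UnivRel W) p

/-- The inclusion of the subspace of degree `1 - k`. -/
def Univ.low (W : ModuleCat.{0} ℂ) (k : ℕ) : Low W k →ₗ[ℂ] Univ W where
  toFun x := gn (univDeg W) (UnivRel W) ⟨k, x⟩
  map_add' x y := by
    have h := cls_rel (deg := univDeg W) (UnivRel.lin k 1 x y)
    simp only [map_sub, one_smul] at h
    rw [sub_sub, sub_eq_zero] at h
    exact h
  map_smul' c x := by
    have h0 := cls_rel (deg := univDeg W) (UnivRel.lin k 1 (0 : Low W k) 0)
    have h := cls_rel (deg := univDeg W) (UnivRel.lin k c x 0)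
    simp only [map_sub, map_smul, one_smul, add_zero] at h h0
    rw [sub_self, zero_sub, neg_eq_zero] at h0
    rw [h0, sub_zero, sub_eq_zero] at h
    exact h


/-! ### The algebras generated by the degrees `1` and `-1` -/

/-- For a subspace `M` of the space of degree `-1`, the subalgebra of the universal graded Lie
superalgebra of `W` generated by `W` and `M`. -/
def genSub (W : ModuleCat.{0} ℂ) (M : Submodule ℂ (Low W 2)) : NonUnitalSubalgebra ℂ (Univ W) :=
  NonUnitalAlgebra.adjoin ℂ (Set.range (Univ.low W 0) ∪ Univ.low W 2 '' M)

/-- `H` is a graded ideal of the subalgebra `V`, contained in the sum of the subspaces of `V` of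
degrees `p ≥ 2`. -/
structure IsIdealAboveTwo {W : ModuleCat.{0} ℂ} (V : NonUnitalSubalgebra ℂ (Univ W))
    (H : Submodule ℂ (Univ W)) : Prop where
  le : H ≤ V.toSubmodule
  ideal : ∀ v ∈ V, ∀ h ∈ H, v * h ∈ H ∧ h * v ∈ H
  graded : H ≤ ⨆ p : ℤ, H ⊓ Univ.deg W p
  above : H ≤ ⨆ p : {p : ℤ // 2 ≤ p}, V.toSubmodule ⊓ Univ.deg W p

/-- The ideal `D₊`: the sum of all graded ideals of `V` contained in the part of degrees `p ≥ 2`. -/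
def Dplus {W : ModuleCat.{0} ℂ} (V : NonUnitalSubalgebra ℂ (Univ W)) : Submodule ℂ (Univ W) :=
  sSup {H | IsIdealAboveTwo V H}

/-- `D₊` is the largest graded ideal of `V` contained in the part of degrees `p ≥ 2`. -/
theorem Dplus_isGreatest {W : ModuleCat.{0} ℂ} (V : NonUnitalSubalgebra ℂ (Univ W)) :
    IsGreatest {H | IsIdealAboveTwo V H} (Dplus V) := by
  refine ⟨⟨sSup_le fun H hH => hH.le, fun v hv h hh => ?_, sSup_le fun H hH => ?_,
    sSup_le fun H hH => hH.above⟩, fun H hH => le_sSup hH⟩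
  · constructor
    · have : Dplus V ≤ (Dplus V).comap (LinearMap.mulLeft ℂ v) :=
        sSup_le fun H hH x hx => (le_sSup hH : H ≤ Dplus V) (hH.ideal v hv x hx).1
      exact this hh
    · have : Dplus V ≤ (Dplus V).comap (LinearMap.mulRight ℂ v) :=
        sSup_le fun H hH x hx => (le_sSup hH : H ≤ Dplus V) (hH.ideal v hv x hx).2
      exact this hh
  · exact hH.graded.trans (iSup_mono fun p => inf_le_inf_right _ (le_sSup hH))

/-- `D₊` as a subspace of `V`. -/
def DplusIn {W : ModuleCat.{0} ℂ} (V : NonUnitalSubalgebra ℂ (Univ W)) : Submodule ℂ V :=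
  (Dplus V).comap V.toSubmodule.subtype

theorem DplusIn_isIdeal {W : ModuleCat.{0} ℂ} (V : NonUnitalSubalgebra ℂ (Univ W)) :
    IsIdeal (DplusIn V) :=
  fun a b hb => (Dplus_isGreatest V).1.ideal a a.2 b hb

/-- The quotient of `V` by `D₊`. -/
def Red {W : ModuleCat.{0} ℂ} (V : NonUnitalSubalgebra ℂ (Univ W)) : Type := V ⧸ DplusIn V

section Red

variable {W : ModuleCat.{0} ℂ} (V : NonUnitalSubalgebra ℂ (Univ W))

instance : NonUnitalNonAssocRing (Red V) := quotRing (DplusIn V) (DplusIn_isIdeal V)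

instance : Module ℂ (Red V) := inferInstanceAs (Module ℂ (V ⧸ DplusIn V))

instance : IsScalarTower ℂ (Red V) (Red V) where
  smul_assoc c x y := LinearMap.map_smul₂ (quotMul _ (DplusIn_isIdeal V)) c x y

instance : SMulCommClass ℂ (Red V) (Red V) where
  smul_comm c x y := ((quotMul _ (DplusIn_isIdeal V) x).map_smul c y).symm

/-- The class of an element of `V`. -/
def Red.mk : V →ₗ[ℂ] Red V := (DplusIn V).mkQ

theorem Red.mk_mul (x y : V) : Red.mk V (x * y) = Red.mk V x * Red.mk V y := rfl

/-- The subspace of degree `p`. -/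
def Red.deg (p : ℤ) : Submodule ℂ (Red V) :=
  ((Univ.deg W p).comap V.toSubmodule.subtype).map (Red.mk V)

theorem Red.mul_mem {p q : ℤ} {x y : Red V} (hx : x ∈ Red.deg V p) (hy : y ∈ Red.deg V q) :
    x * y ∈ Red.deg V (p + q) := by
  obtain ⟨a, ha, rfl⟩ := hx
  obtain ⟨b, hb, rfl⟩ := hy
  exact ⟨a * b, mul_mem_homog ha hb, rfl⟩

end Red

/-! ### The tensor hierarchy algebra -/

section Tensor

variable {r : ℕ} (A : Matrix (Fin (r + 1)) (Fin (r + 1)) ℤ)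

/-- The subspace of degree `1` of the BKM superalgebra. -/
abbrev BOne : ModuleCat.{0} ℂ := ModuleCat.of ℂ (BKM.deg A 1)

/-- The adjoint action from the right of `𝔤` on `BOne A`, `z ↦ (u ↦ ⟦u, z⟧)`. It embeds `𝔤` in the
subspace of degree `0` of the universal graded Lie superalgebra. -/
def adStar : gSub A →ₗ[ℂ] Low (BOne A) 1 where
  toFun z := Low.lam (BOne A) 0
    { toFun := fun u => (⟨(u : BKM A) * z, by simpa using mul_mem_homog u.2 (gSub_le A z.2)⟩ :
        BKM.deg A 1)
      map_add' := fun u v => Subtype.ext (add_mul _ _ _)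
      map_smul' := fun c u => Subtype.ext (smul_mul_assoc _ _ _) }
  map_add' z w := LinearMap.ext fun u => Subtype.ext (mul_add _ _ _)
  map_smul' c z := LinearMap.ext fun u => Subtype.ext (mul_smul_comm _ _ _)

/-- Words in elements of degree `1` of the BKM superalgebra, of length `p`. -/
def oneWords (p : ℕ) : Submodule ℂ (Words (BOne A)) := wordsOfDeg (fun _ => 1) p

/-- The value of such a word in the BKM superalgebra. -/
def evalBKM : Words (BOne A) →ₙₐ[ℂ] BKM A :=
  FreeNonUnitalNonAssocAlgebra.lift ℂ fun u : BOne A => ((u : BKM.deg A 1) : BKM A)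

/-- The value of such a word in the universal graded Lie superalgebra. -/
def evalUniv : Words (BOne A) →ₙₐ[ℂ] Univ (BOne A) :=
  FreeNonUnitalNonAssocAlgebra.lift ℂ fun u : BOne A => Univ.low (BOne A) 0 u

/-- The part of degree `p` of the kernel `C₊` of the projection from the free Lie superalgebra on
`BOne A` to the BKM superalgebra. -/
def Cplus (p : ℕ) : Submodule ℂ (Univ (BOne A)) :=
  (oneWords A p ⊓ LinearMap.ker (evalBKM A : Words (BOne A) →ₗ[ℂ] BKM A)).map
    (evalUniv A : Words (BOne A) →ₗ[ℂ] Univ (BOne A))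

/-- The conditions on a subspace `M` of the space of degree `-1`: the elements `⟦u, Φ⟧ = Φ(u)` with
`u` of degree `1` and `Φ` in `M` span `𝔤`; the degree two part of `V/D₊`, with `V` generated by `BOne A` and
`M`, is contained in the degree two part of the BKM superalgebra, as quotients of the degree two
part of the free Lie superalgebra; and there is `Θ` in `M` with `⟦Θ, Θ⟧ = 0` for which the elements
`⟦u, Θ⟧` are a non-abelian subalgebra of `𝔤`. -/
structure IsAdmissible (M : Submodule ℂ (Low (BOne A) 2)) : Prop where
  span_eq : Submodule.span ℂ {z : Low (BOne A) 1 | ∃ Φ ∈ M, ∃ u, z = Low.app (BOne A) 1 Φ u} =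
    LinearMap.range (adStar A)
  susy : Cplus A 2 ≤ Dplus (genSub (BOne A) M)
  embedding : ∃ Θ ∈ M, Univ.low (BOne A) 2 Θ * Univ.low (BOne A) 2 Θ = 0 ∧
    (∀ u v, ∃ w, Low.br (BOne A) 1 0 (Low.app (BOne A) 1 Θ u) (Low.app (BOne A) 1 Θ v) =
      Low.app (BOne A) 1 Θ w) ∧
    ∃ u v, Low.br (BOne A) 1 0 (Low.app (BOne A) 1 Θ u) (Low.app (BOne A) 1 Θ v) ≠ 0

/-- The subspace of degree `-1` of the tensor hierarchy algebra: the sum of all admissible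
subspaces. -/
def TMinusOne : Submodule ℂ (Low (BOne A) 2) := sSup {M | IsAdmissible A M}

/-- The subalgebra `V` of the universal graded Lie superalgebra generated by `BOne A` and
`TMinusOne A`. -/
abbrev THAcover : NonUnitalSubalgebra ℂ (Univ (BOne A)) := genSub (BOne A) (TMinusOne A)

/-- The tensor hierarchy algebra. -/
abbrev THA : Type := Red (THAcover A)

/-- The subspace of degree `p` of the tensor hierarchy algebra. -/
abbrev THA.deg (p : ℤ) : Submodule ℂ (THA A) := Red.deg (THAcover A) p

variable {A}

theorem adStar_mem (hT : ∃ M, IsAdmissible A M) (z : gSub A) :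
    Univ.low (BOne A) 1 (adStar A z) ∈ THAcover A := by
  obtain ⟨M, hM⟩ := hT
  have hz : adStar A z ∈ LinearMap.range (adStar A) := ⟨z, rfl⟩
  rw [← hM.span_eq] at hz
  generalize adStar A z = x at hz
  induction hz using Submodule.span_induction with
  | zero => rw [map_zero]; exact zero_mem _
  | add x y _ _ hx hy => rw [map_add]; exact add_mem hx hy
  | smul c x _ hx => rw [map_smul]; exact (THAcover A).toSubmodule.smul_mem c hx
  | mem x hx =>
    obtain ⟨Φ, hΦ, u, rfl⟩ := hx
    have h : Univ.low (BOne A) 0 u * Univ.low (BOne A) 2 Φ =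
        Univ.low (BOne A) 1 (Low.app (BOne A) 1 Φ u) := by
      have h1 := cls_rel (deg := univDeg (BOne A)) (UnivRel.br 0 1 u Φ)
      rw [map_sub, sub_eq_zero, cls_mul] at h1
      refine h1.trans ?_
      rw [Low.br]
      rfl
    rw [← h]
    refine mul_mem (NonUnitalAlgebra.subset_adjoin ℂ (Or.inl ⟨u, rfl⟩))
      (NonUnitalAlgebra.subset_adjoin ℂ (Or.inr ⟨Φ, ?_, rfl⟩))
    exact (le_sSup hM : M ≤ TMinusOne A) hΦ

theorem Univ.low_br (W : ModuleCat.{0} ℂ) (k l : ℕ) (x : Low W k) (y : Low W (l + 1)) :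
    Univ.low W k x * Univ.low W (l + 1) y = Univ.low W (l + k) (Low.br W k l x y) := by
  have h := cls_rel (deg := univDeg W) (UnivRel.br k l x y)
  rw [map_sub, sub_eq_zero, cls_mul] at h
  exact h

theorem Univ.low_mem (W : ModuleCat.{0} ℂ) (k : ℕ) (x : Low W k) :
    Univ.low W k x ∈ Univ.deg W (1 - k) :=
  gn_mem (deg := univDeg W) (R := UnivRel W) ⟨k, x⟩

theorem adStar_lie (z w : gSub A) :
    adStar A ⁅z, w⁆ = Low.br (BOne A) 1 0 (adStar A z) (adStar A w) := by
  rw [Low.br, LinearMap.mk₂_apply]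
  refine LinearMap.ext fun u => Subtype.ext ?_
  have h1 := jacobi u.2 (gSub_le A z.2) (gSub_le A w.2)
  have h2 := skew (gSub_le A z.2) (mul_mem_homog u.2 (gSub_le A w.2))
  have hs : sgn 1 0 = 1 := by simp [sgn]
  rw [sgn_zero_left, one_smul] at h2
  rw [hs, one_smul, h2, ← sub_eq_add_neg] at h1
  rw [Low.br]
  have hs' : sgn ((0 : ℕ) : ℤ) ((0 : ℕ) : ℤ) = 1 := by simp [sgn]
  rw [hs', one_smul]
  exact h1

/-- The element of degree zero of `V` corresponding to an element of `𝔤`. -/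
def gToCover (hT : ∃ M, IsAdmissible A M) (z : gSub A) : THAcover A :=
  ⟨Univ.low (BOne A) 1 (adStar A z), adStar_mem hT z⟩

theorem gToCover_deg (hT : ∃ M, IsAdmissible A M) (z : gSub A) :
    (gToCover hT z : Univ (BOne A)) ∈ Univ.deg (BOne A) 0 := by
  have h := Univ.low_mem (BOne A) 1 (adStar A z)
  rwa [Nat.cast_one, sub_self] at h

theorem gToCover_mem (hT : ∃ M, IsAdmissible A M) (z : gSub A) :
    Red.mk _ (gToCover hT z) ∈ THA.deg A 0 :=
  ⟨_, gToCover_deg hT z, rfl⟩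

theorem gToCover_lie (hT : ∃ M, IsAdmissible A M) (z w : gSub A) :
    gToCover hT ⁅z, w⁆ = gToCover hT z * gToCover hT w := by
  refine Subtype.ext ?_
  change Univ.low (BOne A) 1 _ = Univ.low (BOne A) 1 _ * Univ.low (BOne A) (0 + 1) _
  rw [Univ.low_br, adStar_lie]

section Representation

attribute [local instance] LieRing.ofAssociativeRing

/-- The representation `r_p` of `𝔤`, embedded as the degree zero part, on the subspace of degree
`p` of the tensor hierarchy algebra. -/
def rRep (hT : ∃ M, IsAdmissible A M) (p : ℤ) : gSub A →ₗ⁅ℂ⁆ Module.End ℂ (THA.deg A p) where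
  toFun z :=
    { toFun := fun y => ⟨Red.mk _ (gToCover hT z) * y, by
        simpa using Red.mul_mem _ (gToCover_mem hT z) y.2⟩
      map_add' := fun y y' => Subtype.ext (mul_add _ _ _)
      map_smul' := fun c y => Subtype.ext (mul_smul_comm _ _ _) }
  map_add' z w := by
    ext y
    have h : gToCover hT (z + w) = gToCover hT z + gToCover hT w :=
      Subtype.ext (by simp [gToCover])
    change Red.mk _ (gToCover hT (z + w)) * (y : THA A) = _
    rw [h, map_add]; exact add_mul _ _ _
  map_smul' c z := by
    ext y
    have h : gToCover hT (c • z) = c • gToCover hT z :=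
      Subtype.ext (by simp [gToCover])
    change Red.mk _ (gToCover hT (c • z)) * (y : THA A) = _
    rw [h, map_smul]; exact smul_mul_assoc _ _ _
  map_lie' := by
    intro z w
    ext y
    obtain ⟨_, a, ha, rfl⟩ := y
    have h := jacobi (gToCover_deg hT z) (gToCover_deg hT w) ha
    rw [sgn_zero_left, one_smul] at h
    change Red.mk _ (gToCover hT ⁅z, w⁆) * Red.mk _ a =
      Red.mk _ (gToCover hT z) * (Red.mk _ (gToCover hT w) * Red.mk _ a) -
        Red.mk _ (gToCover hT w) * (Red.mk _ (gToCover hT z) * Red.mk _ a)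
    rw [gToCover_lie]
    simp only [← Red.mk_mul, ← map_sub]
    exact congrArg _ (Subtype.ext (eq_sub_iff_add_eq.2 h.symm))

end Representation

end Tensor

end TensorHierarchy

end

/-!
The subspace `C₊` is contained in `D₊` because the positive part of the BKM superalgebra `B` is
quadratic, that is, `C₊` is generated by its part of degree two. All relations of `B` have degree at
most one, except `⟦e₀, e₀⟧ = 0`, which has degree two. To make use of this without a presentation of
the positive part of `B`, a word in the Chevalley generators is given two values at once: its value
in `B`, and its value in the universal graded Lie superalgebra `U`, where the generators act on
`B₁` (`chevPair`). The set of pairs of values in degrees at most one is the graph of `b ↦ ad b`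
(`graphPart`), as the subspaces of degrees at most one of `U` consist of multilinear maps on `B₁`.
Hence the relations of degree at most one are sent to zero in `U`, and the relation of degree two is
sent to an element of `(C₊)₂`. The ideal of `U₊` generated by `(C₊)₂` (`quadIdeal`) is stable under
`B₁`, under `B₀`, which preserves `(C₊)₂`, and under `B₋₁`, which annihilates `(C₊)₂` since
`(C₊)₁ = 0`. Hence the second value of a word that vanishes in `B` lies in this ideal
(`chevUniv_mem_quadIdeal`), so that the ideal contains `C₊` (`Cplus_le_quadIdeal`). An admissible
subspace `M` annihilates `(C₊)₂` as well, because `D₊` has no part of degree one, and `⟦B₁, M⟧` is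
contained in `𝔤`. Hence the same ideal is an ideal of `V(T₋₁)` (`quadIdeal_isIdealAboveTwo`), and is
contained in `D₊`.

It follows that `T_p` is the quotient of the space of words of length `p` in elements of `B₁`, and
that the quotient map factors through the `𝔤`-submodule of `B_p` of the values of these words. An
equivariant section of a quotient of a submodule exists as `B` is completely reducible under `𝔤`
(`complementedLattice_bkm`). The Lie algebra `𝔤` is a quotient of the simple Lie algebra of its Cartan
matrix. The generators `eᵢ` and `fᵢ` act locally nilpotently, by the Serre relations. The
elements that act locally nilpotently on the module and on the Lie algebra span a Lie subalgebra: for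
two such elements `a` and `b`, the elements `exp (t ad a) b` are locally nilpotent too, and their
linear term in `t` is `⁅a, b⁆` (`lie_mem_span_locNilSet`). So `𝔤` has a finite basis of locally
nilpotent elements, whence every vector generates a finite-dimensional module: a long word in the
basis, reordered, contains a high power of one element next to the vector
(`exists_finite_lieSubmodule`). Weyl's theorem (`IsSimpleOrZero.exists_isCompl`) applies, and is
proved by means of Casimir elements.
-/

noncomputable section

namespace TensorHierarchy

/-! ### Complete reducibility -/

section Weyl

attribute [local instance] LieRing.ofAssociativeRing

open Module

variable {K L M : Type*} [Field K] [LieRing L] [LieAlgebra K L]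
  [AddCommGroup M] [Module K M] [LieRingModule L M] [LieModule K L M]

/-- A Lie algebra that is perfect and has no ideals except zero and itself: it is simple or zero.
In contrast to simplicity, this passes to quotients. -/
structure IsSimpleOrZero (K L : Type*) [Field K] [LieRing L] [LieAlgebra K L] : Prop where
  eq_bot_or_eq_top : ∀ I : LieIdeal K L, I = ⊥ ∨ I = ⊤
  perfect : LieAlgebra.derivedSeries K L 1 = ⊤

theorem IsSimpleOrZero.of_isSimple [LieAlgebra.IsSimple K L] : IsSimpleOrZero K L where
  eq_bot_or_eq_top := LieAlgebra.IsSimple.eq_bot_or_eq_top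
  perfect := by
    refine (LieAlgebra.IsSimple.eq_bot_or_eq_top (R := K) (L := L) _).resolve_left fun h => ?_
    refine LieAlgebra.IsSimple.non_abelian (R := K) (L := L) ?_
    rw [LieAlgebra.derivedSeries_def, LieAlgebra.derivedSeriesOfIdeal_succ,
      LieAlgebra.derivedSeriesOfIdeal_zero] at h
    refine ⟨fun x y => ?_⟩
    have hxy : ⁅x, y⁆ ∈ ⁅(⊤ : LieIdeal K L), (⊤ : LieIdeal K L)⁆ :=
      LieSubmodule.lie_mem_lie (LieSubmodule.mem_top x) (LieSubmodule.mem_top y)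
    rwa [h, LieSubmodule.mem_bot] at hxy

theorem IsSimpleOrZero.of_surjective {L' : Type*} [LieRing L'] [LieAlgebra K L']
    (h : IsSimpleOrZero K L) (φ : L →ₗ⁅K⁆ L') (hφ : Function.Surjective φ) :
    IsSimpleOrZero K L' where
  eq_bot_or_eq_top I := by
    refine (h.eq_bot_or_eq_top (I.comap φ)).imp (fun h => ?_) (fun h => ?_)
    · rw [LieSubmodule.eq_bot_iff] at h ⊢
      intro y hy
      obtain ⟨x, rfl⟩ := hφ y
      rw [h x (LieIdeal.mem_comap.2 hy), map_zero]
    · refine eq_top_iff.2 fun y _ => ?_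
      obtain ⟨x, rfl⟩ := hφ y
      exact LieIdeal.mem_comap.1 (h ▸ LieSubmodule.mem_top x)
  perfect := by
    rw [← LieIdeal.derivedSeries_map_eq 1 hφ, h.perfect]
    refine eq_top_iff.2 fun y _ => ?_
    obtain ⟨x, rfl⟩ := hφ y
    exact LieIdeal.mem_map (LieSubmodule.mem_top x)

/-- The element `∑ b'ᵢ ⊗ bᵢ` given by dual bases for an invariant bilinear form is invariant. -/
theorem sum_dualBasis_lie {ι V : Type*} [Fintype ι] [DecidableEq ι] [AddCommGroup V] [Module K V]
    [FiniteDimensional K L] (B : LinearMap.BilinForm K L) (hB : B.Nondegenerate)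
    (hinv : ∀ x y z, B ⁅x, y⁆ z = B x ⁅y, z⁆) (b : Basis ι K L) (F : L →ₗ[K] L →ₗ[K] V) (y : L) :
    ∑ i, (F ⁅y, B.dualBasis hB b i⁆ (b i) + F (B.dualBasis hB b i) ⁅y, b i⁆) = 0 := by
  have h1 (x : L) : x = ∑ j, B (B.dualBasis hB b j) x • b j := by
    refine (b.sum_repr x).symm.trans (Finset.sum_congr rfl fun j _ => ?_)
    congr 1
    conv_rhs => rw [← b.sum_repr x, map_sum]
    simp only [map_smul, LinearMap.BilinForm.apply_dualBasis_left, smul_eq_mul, mul_ite, mul_one,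
      mul_zero, Finset.sum_ite_eq', Finset.mem_univ, if_true]
  have h2 (x : L) : x = ∑ j, B x (b j) • B.dualBasis hB b j := by
    refine ((B.dualBasis hB b).sum_repr x).symm.trans (Finset.sum_congr rfl fun j _ => ?_)
    rw [LinearMap.BilinForm.dualBasis_repr_apply]
  have h3 (i) : F ⁅y, B.dualBasis hB b i⁆ (b i) =
      -∑ j, B (B.dualBasis hB b i) ⁅y, b j⁆ • F (B.dualBasis hB b j) (b i) := by
    conv_lhs => rw [h2 ⁅y, B.dualBasis hB b i⁆]
    rw [map_sum, LinearMap.sum_apply, ← Finset.sum_neg_distrib]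
    refine Finset.sum_congr rfl fun j _ => ?_
    rw [← lie_skew, map_neg, LinearMap.neg_apply, hinv, map_smul, LinearMap.smul_apply, neg_smul]
  have h4 (i) : F (B.dualBasis hB b i) ⁅y, b i⁆ =
      ∑ j, B (B.dualBasis hB b j) ⁅y, b i⁆ • F (B.dualBasis hB b i) (b j) := by
    conv_lhs => rw [h1 ⁅y, b i⁆]
    rw [map_sum]
    exact Finset.sum_congr rfl fun j _ => map_smul _ _ _
  rw [Finset.sum_add_distrib, Finset.sum_congr rfl fun i _ => h3 i,
    Finset.sum_congr rfl fun i _ => h4 i, Finset.sum_neg_distrib, Finset.sum_comm,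
    neg_add_cancel]

variable [CharZero K]

/-- On an irreducible module, either the action is zero or the trace form is nondegenerate. -/
theorem IsSimpleOrZero.isTrivial_or_nondegenerate [FiniteDimensional K M]
    (hL : IsSimpleOrZero K L) (hM : ∀ N : LieSubmodule K L M, N = ⊥ ∨ N = ⊤) :
    LieModule.IsTrivial L M ∨ (LieModule.traceForm K L M).Nondegenerate := by
  rw [or_iff_not_imp_left]
  intro hnt
  have hker : ∀ x, (∀ y, LieModule.traceForm K L M x y = 0) → x = 0 := by
    let I : LieIdeal K L :=
      { LinearMap.ker (LieModule.traceForm K L M) with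
        lie_mem := by
          intro x m hm
          change LieModule.traceForm K L M ⁅x, m⁆ = 0
          have hm' : LieModule.traceForm K L M m = 0 := hm
          ext z
          rw [← lie_skew, map_neg, LinearMap.neg_apply, LieModule.traceForm_apply_lie_apply, hm']
          simp }
    have hI : I = ⊥ := by
      refine (hL.eq_bot_or_eq_top I).resolve_right fun hI => hnt ?_
      have h0 : LieModule.traceForm K L M = 0 := by
        ext x y
        have hx : x ∈ I := hI ▸ LieSubmodule.mem_top x
        have hx' : LieModule.traceForm K L M x = 0 := hx
        rw [hx']; rfl
      have hn := LieModule.isNilpotent_derivedSeries_of_traceForm_eq_zero h0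
      rw [hL.perfect, LieModule.isNilpotent_iff_forall' (R := K)] at hn
      have hn' : LieModule.IsNilpotent L M := by
        rw [LieModule.isNilpotent_iff_forall' (R := K)]
        exact fun x => hn ⟨x, LieSubmodule.mem_top x⟩
      rcases subsingleton_or_nontrivial M with hM' | hM'
      · exact ⟨fun x m => Subsingleton.elim _ _⟩
      · have h1 := LieModule.nontrivial_max_triv_of_isNilpotent K L M
        have h2 : LieModule.maxTrivSubmodule K L M = ⊤ :=
          (hM _).resolve_left ((LieSubmodule.nontrivial_iff_ne_bot K L M).1 h1)
        refine ⟨fun x m => ?_⟩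
        have hm : m ∈ LieModule.maxTrivSubmodule K L M := h2 ▸ LieSubmodule.mem_top m
        exact (LieModule.mem_maxTrivSubmodule K L M m).1 hm x
    intro x hx
    have hxI : x ∈ I := LinearMap.ext hx
    rwa [hI, LieSubmodule.mem_bot] at hxI
  exact ⟨hker, fun y h => hker y fun x => by rw [LieModule.traceForm_comm]; exact h x⟩

variable [FiniteDimensional K L]

/-- A `1`-cocycle with values in an irreducible module is a coboundary. The Casimir element of the
trace form has trace `dim L`, so it acts invertibly unless the module is trivial. -/
theorem IsSimpleOrZero.exists_eq_lie_of_irreducible [FiniteDimensional K M]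
    (hL : IsSimpleOrZero K L) (hM : ∀ N : LieSubmodule K L M, N = ⊥ ∨ N = ⊤)
    (f : L →ₗ[K] M) (hf : ∀ x y, f ⁅x, y⁆ = ⁅x, f y⁆ - ⁅y, f x⁆) : ∃ m, ∀ x, f x = ⁅x, m⁆ := by
  by_cases ht : LieModule.IsTrivial L M
  · refine ⟨0, fun x => ?_⟩
    have hx : x ∈ LieAlgebra.derivedSeries K L 1 := hL.perfect ▸ LieSubmodule.mem_top x
    rw [LieAlgebra.derivedSeries_def, LieAlgebra.derivedSeriesOfIdeal_succ,
      LieAlgebra.derivedSeriesOfIdeal_zero, ← LieSubmodule.mem_toSubmodule,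
      LieSubmodule.lieIdeal_oper_eq_linear_span'] at hx
    rw [lie_zero]
    induction hx using Submodule.span_induction with
    | mem x hx =>
      obtain ⟨y, _, z, _, rfl⟩ := hx
      rw [hf, trivial_lie_zero, trivial_lie_zero, sub_zero]
    | zero => exact map_zero f
    | add x y _ _ hx hy => rw [map_add, hx, hy, add_zero]
    | smul c x _ hx => rw [map_smul, hx, smul_zero]
  · have hB := (hL.isTrivial_or_nondegenerate hM).resolve_left ht
    set B := LieModule.traceForm K L M
    have hinv : ∀ x y z, B ⁅x, y⁆ z = B x ⁅y, z⁆ := LieModule.traceForm_apply_lie_apply K L M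
    let b := finBasis K L
    let b' := LinearMap.BilinForm.dualBasis B hB b
    let ρ := LieModule.toEnd K L M
    let C : End K M := ∑ i, ρ (b' i) * ρ (b i)
    have hC : ∀ y, ρ y * C = C * ρ y := by
      intro y
      have h := sum_dualBasis_lie B hB hinv b
        ((LinearMap.mul K (End K M)).compl₁₂ (ρ : L →ₗ[K] End K M) (ρ : L →ₗ[K] End K M)) y
      simp only [LinearMap.compl₁₂_apply, LinearMap.mul_apply', LieHom.coe_toLinearMap,
        LieHom.map_lie, LieRing.of_associative_ring_bracket] at h
      rw [← sub_eq_zero, Finset.mul_sum, Finset.sum_mul, ← Finset.sum_sub_distrib, ← h]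
      exact Finset.sum_congr rfl fun i _ => by noncomm_ring
    have htr : LinearMap.trace K M C = finrank K L := by
      rw [map_sum]
      have : ∀ i, LinearMap.trace K M (ρ (b' i) * ρ (b i)) = 1 := fun i =>
        (LinearMap.BilinForm.apply_dualBasis_left hB b i i).trans (if_pos rfl)
      simp [this]
    have hinj : LinearMap.ker C = ⊥ := by
      let N : LieSubmodule K L M :=
        { LinearMap.ker C with
          lie_mem := by
            intro x m hm
            have hm' : C m = 0 := hm
            change C (ρ x m) = 0
            rw [← Module.End.mul_apply, ← hC, Module.End.mul_apply, hm', map_zero] }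
      rcases hM N with h | h
      · exact (LieSubmodule.toSubmodule_eq_bot N).2 h
      · exfalso
        have hC0 : C = 0 := by
          ext m
          have hm : m ∈ N := h ▸ LieSubmodule.mem_top m
          exact hm
        rw [hC0, map_zero, eq_comm, Nat.cast_eq_zero, finrank_zero_iff] at htr
        refine ht ⟨fun x m => ?_⟩
        rw [Subsingleton.elim x 0, zero_lie]
    have hsurj : Function.Surjective C :=
      LinearMap.injective_iff_surjective.1 (LinearMap.ker_eq_bot.1 hinj)
    obtain ⟨m, hm⟩ := hsurj (∑ i, ⁅b' i, f (b i)⁆)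
    refine ⟨m, fun y => LinearMap.ker_eq_bot.1 hinj ?_⟩
    have h := sum_dualBasis_lie B hB hinv b
      ((LieModule.toEnd K L M : L →ₗ[K] End K M).compl₂ f) y
    simp only [LinearMap.compl₂_apply, LieHom.coe_toLinearMap, LieModule.toEnd_apply_apply,
      hf, lie_sub] at h
    have h1 : C ⁅y, m⁆ = ⁅y, C m⁆ := (LinearMap.congr_fun (hC y) m).symm
    rw [h1, hm, lie_sum, LinearMap.sum_apply, ← sub_eq_zero, ← Finset.sum_sub_distrib, ← neg_eq_zero,
      ← Finset.sum_neg_distrib, ← h]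
    refine Finset.sum_congr rfl fun i _ => ?_
    change -(⁅b' i, ⁅b i, f y⁆⁆ - ⁅y, ⁅b' i, f (b i)⁆⁆) = ⁅⁅y, b' i⁆, f (b i)⁆ +
      (⁅b' i, ⁅y, f (b i)⁆⁆ - ⁅b' i, ⁅b i, f y⁆⁆)
    rw [leibniz_lie y (b' i)]
    abel

/-- **Whitehead's first lemma**: `1`-cocycles are coboundaries, by induction on the dimension of the
module. -/
theorem IsSimpleOrZero.exists_eq_lie (hL : IsSimpleOrZero K L) (n : ℕ) :
    ∀ {M : Type*} [AddCommGroup M] [Module K M] [LieRingModule L M] [LieModule K L M]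
      [FiniteDimensional K M] (_ : finrank K M = n)
      (f : L →ₗ[K] M) (_ : ∀ x y, f ⁅x, y⁆ = ⁅x, f y⁆ - ⁅y, f x⁆), ∃ m, ∀ x, f x = ⁅x, m⁆ := by
  induction n using Nat.strong_induction_on with
  | _ n ih =>
    intro M _ _ _ _ _ hn f hf
    by_cases hM : ∀ N : LieSubmodule K L M, N = ⊥ ∨ N = ⊤
    · exact hL.exists_eq_lie_of_irreducible hM f hf
    push Not at hM
    obtain ⟨N, hN, hN'⟩ := hM
    have h0 : 0 < finrank K N :=
      Nat.pos_of_ne_zero fun h => hN ((LieSubmodule.toSubmodule_eq_bot N).1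
        (Submodule.finrank_eq_zero.1 h))
    have h1 : finrank K N < finrank K M :=
      Submodule.finrank_lt (fun h => hN' ((LieSubmodule.toSubmodule_eq_top N).1 h))
    have h2 : finrank K (M ⧸ N) + finrank K N = finrank K M :=
      Submodule.finrank_quotient_add_finrank (N : Submodule K M)
    obtain ⟨q, hq⟩ := ih (finrank K (M ⧸ N)) (by omega) (M := M ⧸ N) rfl
      ((N : Submodule K M).mkQ ∘ₗ f) (fun x y => by
        change LieSubmodule.Quotient.mk' N (f ⁅x, y⁆) =
          ⁅x, LieSubmodule.Quotient.mk' N (f y)⁆ - ⁅y, LieSubmodule.Quotient.mk' N (f x)⁆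
        rw [hf, map_sub, LieModuleHom.map_lie, LieModuleHom.map_lie])
    obtain ⟨m, rfl⟩ := LieSubmodule.Quotient.surjective_mk' N q
    have hmem : ∀ x, f x - ⁅x, m⁆ ∈ N := by
      intro x
      rw [← LieSubmodule.Quotient.mk_eq_zero, map_sub, LieModuleHom.map_lie, sub_eq_zero]
      exact hq x
    obtain ⟨m', hm'⟩ := ih (finrank K N) (by omega) (M := N) rfl
      ((f - ((LieModule.toEnd K L M : L →ₗ[K] End K M).flip m)).codRestrict N hmem)
      (fun x y => by
        refine Subtype.ext ?_
        change f ⁅x, y⁆ - ⁅⁅x, y⁆, m⁆ = ⁅x, f y - ⁅y, m⁆⁆ - ⁅y, f x - ⁅x, m⁆⁆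
        rw [hf, lie_lie, lie_sub, lie_sub]; abel)
    refine ⟨m + m', fun x => ?_⟩
    have h : f x - ⁅x, m⁆ = ⁅x, (m' : M)⁆ := congrArg Subtype.val (hm' x)
    rw [lie_add, ← h, add_sub_cancel]

/-- **Weyl's theorem** on complete reducibility: the Lie submodules of a finite-dimensional module
have complements. -/
theorem IsSimpleOrZero.exists_isCompl [FiniteDimensional K M] (hL : IsSimpleOrZero K L)
    (N : LieSubmodule K L M) : ∃ N' : LieSubmodule K L M, IsCompl N N' := by
  obtain ⟨π, hπ⟩ : ∃ π : M →ₗ[K] N, ∀ n : N, π n = n := by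
    obtain ⟨π, hπ⟩ := (N : Submodule K M).subtype.exists_leftInverse_of_injective
      (Submodule.ker_subtype _)
    exact ⟨π, LinearMap.congr_fun hπ⟩
  -- The cocycle `x ↦ ⁅x, π⁆` has values in the module of maps `M → N` that vanish on `N`.
  let H : LieSubmodule K L (M →ₗ[K] N) :=
    { carrier := {g | ∀ n : N, g n = 0}
      add_mem' := fun {g g'} hg hg' n => by rw [LinearMap.add_apply, hg, hg', add_zero]
      zero_mem' := fun n => rfl
      smul_mem' := fun c g hg n => by rw [LinearMap.smul_apply, hg, smul_zero]
      lie_mem := fun {x g} hg n => by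
        rw [LieHom.lie_apply, hg n, lie_zero, zero_sub, neg_eq_zero]
        exact hg ⁅x, n⁆ }
  have hmem : ∀ x : L, ⁅x, π⁆ ∈ H := fun x n => by
    rw [LieHom.lie_apply, hπ, sub_eq_zero]
    exact (hπ ⁅x, n⁆).symm
  obtain ⟨g, hg⟩ := hL.exists_eq_lie _ (M := H) rfl
    ((((LieModule.toEnd K L (M →ₗ[K] N) : L →ₗ[K] End K (M →ₗ[K] N)).flip π)).codRestrict H hmem)
    (fun x y => Subtype.ext (lie_lie x y π))
  have hp : ∀ (x : L) (m : M), (π - (g : M →ₗ[K] N)) ⁅x, m⁆ = ⁅x, (π - (g : M →ₗ[K] N)) m⁆ := by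
    intro x m
    have h : ⁅x, π⁆ = ⁅x, (g : M →ₗ[K] N)⁆ := congrArg Subtype.val (hg x)
    have h' : ⁅x, π - (g : M →ₗ[K] N)⁆ m = 0 := by rw [lie_sub, h, sub_self]; rfl
    rw [LieHom.lie_apply, sub_eq_zero] at h'
    exact h'.symm
  have hpN : ∀ n : N, (π - (g : M →ₗ[K] N)) n = n := fun n => by
    rw [LinearMap.sub_apply, hπ, g.2 n, sub_zero]
  refine ⟨{ LinearMap.ker (π - (g : M →ₗ[K] N)) with
    lie_mem := fun {x m} hm => ?_ }, ?_, ?_⟩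
  · have hm' : (π - (g : M →ₗ[K] N)) m = 0 := hm
    change (π - (g : M →ₗ[K] N)) ⁅x, m⁆ = 0
    rw [hp, hm', lie_zero]
  · rw [disjoint_iff, LieSubmodule.eq_bot_iff]
    rintro m ⟨hm, hm'⟩
    have h : (π - (g : M →ₗ[K] N)) m = 0 := hm'
    have h2 := hpN ⟨m, hm⟩
    exact congrArg Subtype.val (h2.symm.trans h)
  · rw [codisjoint_iff, eq_top_iff]
    intro m _
    rw [LieSubmodule.mem_sup]
    refine ⟨(π - (g : M →ₗ[K] N)) m, Subtype.property _, m - (π - (g : M →ₗ[K] N)) m, ?_,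
      add_sub_cancel _ _⟩
    change (π - (g : M →ₗ[K] N)) (m - ((π - (g : M →ₗ[K] N)) m : N)) = 0
    rw [map_sub, hpN, sub_self]

/-- A finite-dimensional Lie submodule is a sum of irreducible ones. -/
theorem IsSimpleOrZero.le_sSup_atoms (hL : IsSimpleOrZero K L) (n : ℕ) :
    ∀ (N : LieSubmodule K L M) [FiniteDimensional K N] (_ : finrank K N = n),
      N ≤ sSup {a : LieSubmodule K L M | IsAtom a} := by
  induction n using Nat.strong_induction_on with
  | _ n ih =>
    intro N _ hn
    by_cases hat : IsAtom N
    · exact le_sSup hat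
    by_cases hbot : N = ⊥
    · rw [hbot]; exact bot_le
    have : ∃ N₁, N₁ < N ∧ N₁ ≠ ⊥ := by
      by_contra! h
      exact hat ⟨hbot, h⟩
    obtain ⟨N₁, hlt, hne⟩ := this
    obtain ⟨N₂, hd, hc⟩ := hL.exists_isCompl (N₁.comap N.incl)
    have hsmall : ∀ P : LieSubmodule K L N, P ≠ ⊤ → P.map N.incl ≤
        sSup {a : LieSubmodule K L M | IsAtom a} := by
      intro P hP
      have hle : P.map N.incl ≤ N := by
        rintro _ ⟨m, _, rfl⟩
        exact m.2
      have hlt : P.map N.incl < N := by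
        refine lt_of_le_of_ne hle fun h => hP (eq_top_iff.2 fun m _ => ?_)
        have hm : (m : M) ∈ P.map N.incl := by rw [h]; exact m.2
        obtain ⟨m', hm', h'⟩ := hm
        rwa [← Subtype.ext (a1 := m') (a2 := m) h']
      have hlt' : (P.map N.incl : Submodule K M) < N := hlt
      have := Submodule.finiteDimensional_of_le hlt'.le
      exact ih _ (hn ▸ Submodule.finrank_lt_finrank_of_lt hlt') (P.map N.incl) rfl
    have h₁ : N₁.comap N.incl ≠ ⊤ := fun h =>
      hlt.not_ge (LieSubmodule.comap_incl_eq_top.1 h)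
    have h₂ : N₂ ≠ ⊤ := by
      rintro rfl
      rw [disjoint_top, LieSubmodule.comap_incl_eq_bot, inf_eq_right.2 hlt.le] at hd
      exact hne hd
    intro m hm
    have hm' : (⟨m, hm⟩ : N) ∈ N₁.comap N.incl ⊔ N₂ := by
      rw [codisjoint_iff.1 hc]; exact LieSubmodule.mem_top _
    obtain ⟨a, ha, b, hb, hab⟩ := (LieSubmodule.mem_sup _ _ _).1 hm'
    rw [← show (a : M) + b = m from congrArg Subtype.val hab]
    exact add_mem (hsmall _ h₁ ⟨a, ha, rfl⟩) (hsmall _ h₂ ⟨b, hb, rfl⟩)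

/-- Complete reducibility of locally finite modules. -/
theorem IsSimpleOrZero.complementedLattice (hL : IsSimpleOrZero K L)
    (hM : ∀ m : M, ∃ N : LieSubmodule K L M, FiniteDimensional K N ∧ m ∈ N) :
    ComplementedLattice (LieSubmodule K L M) := by
  refine complementedLattice_of_sSup_atoms_eq_top (eq_top_iff.2 fun m _ => ?_)
  obtain ⟨N, hN, hm⟩ := hM m
  exact hL.le_sSup_atoms _ N rfl hm

end Weyl

/-! ### Local finiteness of integrable modules -/

section LocallyNilpotent

attribute [local instance] LieRing.ofAssociativeRing

open Module Finset

variable {K M : Type*} [Field K] [AddCommGroup M] [Module K M]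

/-- An endomorphism is locally nilpotent if every vector is killed by a power of it. -/
def IsLocNil (a : End K M) : Prop := ∀ m, ∃ n, (a ^ n) m = 0

theorem pow_apply_eq_zero_of_le {a : End K M} {m : M} {n n' : ℕ} (h : (a ^ n) m = 0)
    (hn : n ≤ n') : (a ^ n') m = 0 := by
  rw [← Nat.sub_add_cancel hn, pow_add, Module.End.mul_apply, h, map_zero]

theorem IsLocNil.smul {a : End K M} (ha : IsLocNil a) (t : K) : IsLocNil (t • a) := fun m => by
  obtain ⟨n, hn⟩ := ha m
  exact ⟨n, by rw [smul_pow, LinearMap.smul_apply, hn, smul_zero]⟩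

/-- The exponential series of a locally nilpotent endomorphism, evaluated at a vector. -/
def expSum (a : End K M) (m : M) : M := ∑ᶠ k : ℕ, ((k.factorial : K)⁻¹) • (a ^ k) m

theorem expSum_eq {a : End K M} {m : M} {n : ℕ} (h : (a ^ n) m = 0) :
    expSum a m = ∑ k ∈ range n, ((k.factorial : K)⁻¹) • (a ^ k) m := by
  refine finsum_eq_sum_of_support_subset _ fun k hk => ?_
  rw [Finset.mem_coe, Finset.mem_range]
  by_contra! hkn
  exact hk (by dsimp only; rw [pow_apply_eq_zero_of_le h hkn, smul_zero])

theorem expSum_sub {a : End K M} (ha : IsLocNil a) (m m' : M) :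
    expSum a (m - m') = expSum a m - expSum a m' := by
  obtain ⟨n, hn⟩ := ha m
  obtain ⟨n', hn'⟩ := ha m'
  have h := pow_apply_eq_zero_of_le hn (le_max_left n n')
  have h' := pow_apply_eq_zero_of_le hn' (le_max_right n n')
  rw [expSum_eq h, expSum_eq h', expSum_eq (n := max n n') (by rw [map_sub, h, h', sub_zero]),
    ← Finset.sum_sub_distrib]
  exact Finset.sum_congr rfl fun k _ => by rw [map_sub, smul_sub]

theorem expSum_zero (a : End K M) : expSum a 0 = 0 := by
  rw [expSum_eq (n := 0) (map_zero _), Finset.range_zero, Finset.sum_empty]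

/-- As `exp a - 1` lowers the order of nilpotency of a vector, preimages are found by induction on
the order. -/
theorem expSum_surjective {a : End K M} (ha : IsLocNil a) : Function.Surjective (expSum a) := by
  have key : ∀ n m, (a ^ n) m = 0 → ∃ w, expSum a w = m := by
    intro n
    induction n with
    | zero => intro m hm; exact ⟨0, by rw [expSum_zero]; exact hm.symm⟩
    | succ n ih =>
      intro m hm
      obtain ⟨w, hw⟩ := ih (expSum a m - m) (by
        rw [expSum_eq hm, Finset.sum_range_succ', map_sub, map_add, map_sum]
        simp only [pow_zero, Nat.factorial_zero, Nat.cast_one, inv_one, one_smul,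
          Module.End.one_apply, add_sub_cancel_right]
        refine Finset.sum_eq_zero fun k _ => ?_
        rw [map_smul, ← Module.End.mul_apply, ← pow_add,
          pow_apply_eq_zero_of_le hm (by omega), smul_zero])
      exact ⟨m - w, by rw [expSum_sub ha, hw, sub_sub_cancel]⟩
  intro m
  obtain ⟨n, hn⟩ := ha m
  exact key n m hn

/-- The exponential of `ad a = L_a - R_a` is conjugation by the exponential of `a`, in the form of an
identity between the homogeneous components in `a`. -/
theorem pow_mul_eq_sum_ad [CharZero K] (a b : End K M) (n : ℕ) :
    ((n.factorial : K)⁻¹) • (a ^ n * b) = ∑ p ∈ antidiagonal n,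
      (((p.1.factorial : K)⁻¹) • ((LieAlgebra.ad K (End K M) a) ^ p.1) b) *
        (((p.2.factorial : K)⁻¹) • a ^ p.2) := by
  have hc : Commute (LieAlgebra.ad K (End K M) a) (LinearMap.mulRight K a) := by
    refine LinearMap.ext fun x => ?_
    simp only [Module.End.mul_apply, LieAlgebra.ad_apply, LieRing.of_associative_ring_bracket,
      LinearMap.mulRight_apply]
    noncomm_ring
  have hs : LinearMap.mulLeft K a = LieAlgebra.ad K (End K M) a + LinearMap.mulRight K a := by
    refine LinearMap.ext fun x => ?_
    simp [LieRing.of_associative_ring_bracket]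
  have h := congrArg (fun T : End K (End K M) => T b) (hc.add_pow' n)
  simp only [← hs] at h
  rw [LinearMap.pow_mulLeft] at h
  rw [show a ^ n * b = LinearMap.mulLeft K (a ^ n) b from rfl, h, LinearMap.sum_apply,
    Finset.smul_sum]
  refine Finset.sum_congr rfl fun p hp => ?_
  rw [HasAntidiagonal.mem_antidiagonal] at hp
  have hcomm : ((LieAlgebra.ad K (End K M) a) ^ p.1 * LinearMap.mulRight K a ^ p.2) =
    (LinearMap.mulRight K a ^ p.2 * (LieAlgebra.ad K (End K M) a) ^ p.1) := (hc.pow_pow _ _).eq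
  rw [hcomm, LinearMap.smul_apply, Module.End.mul_apply, LinearMap.pow_mulRight,
    LinearMap.mulRight_apply, ← Nat.cast_smul_eq_nsmul K, smul_smul, smul_mul_smul_comm]
  congr 1
  have h1 : (p.1.factorial : K) ≠ 0 := Nat.cast_ne_zero.2 p.1.factorial_ne_zero
  have h2 : (p.2.factorial : K) ≠ 0 := Nat.cast_ne_zero.2 p.2.factorial_ne_zero
  have h3 : (n.factorial : K) ≠ 0 := Nat.cast_ne_zero.2 n.factorial_ne_zero
  have h4 : (n.choose p.1 : K) * p.1.factorial * p.2.factorial = n.factorial := by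
    rw [← hp, Nat.choose_symm_add]
    exact_mod_cast Nat.add_choose_mul_factorial_mul_factorial p.1 p.2
  field_simp
  rw [← h4]

/-- If `a` and `b` are locally nilpotent, so is `exp (ad a) b = exp a ∘ b ∘ (exp a)⁻¹`. -/
theorem IsLocNil.exp_ad [CharZero K] {a b : End K M} (ha : IsLocNil a) (hb : IsLocNil b) {N : ℕ}
    (hN : ((LieAlgebra.ad K (End K M) a) ^ N) b = 0) :
    IsLocNil (∑ k ∈ range N, ((k.factorial : K)⁻¹) • ((LieAlgebra.ad K (End K M) a) ^ k) b) := by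
  set c := ∑ k ∈ range N, ((k.factorial : K)⁻¹) • ((LieAlgebra.ad K (End K M) a) ^ k) b with hc
  -- Both sides are sums of the terms `F p`, over a rectangle and over antidiagonals.
  have hconj : ∀ v, c (expSum a v) = expSum a (b v) := by
    intro v
    obtain ⟨n, hn⟩ := ha v
    let F : ℕ × ℕ → M := fun p =>
      (((p.1.factorial : K)⁻¹) • ((LieAlgebra.ad K (End K M) a) ^ p.1) b)
        (((p.2.factorial : K)⁻¹) • (a ^ p.2) v)
    have hF : ∀ p, ¬ p ∈ range N ×ˢ range n → F p = 0 := by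
      intro p hp
      rw [Finset.mem_product, Finset.mem_range, Finset.mem_range, not_and_or, not_lt, not_lt] at hp
      rcases hp with hp | hp
      · change (((p.1.factorial : K)⁻¹) • ((LieAlgebra.ad K (End K M) a) ^ p.1) b) _ = 0
        rw [pow_apply_eq_zero_of_le hN hp, smul_zero, LinearMap.zero_apply]
      · change (((p.1.factorial : K)⁻¹) • ((LieAlgebra.ad K (End K M) a) ^ p.1) b) _ = 0
        rw [pow_apply_eq_zero_of_le hn hp, smul_zero, map_zero]
    have hk : ∀ k, ((k.factorial : K)⁻¹) • (a ^ k) (b v) = ∑ p ∈ antidiagonal k, F p := by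
      intro k
      have h := LinearMap.congr_fun (pow_mul_eq_sum_ad a b k) v
      rw [LinearMap.sum_apply] at h
      exact h
    have h0 : (a ^ (N + n)) (b v) = 0 := by
      have h : (((N + n).factorial : K)⁻¹) • (a ^ (N + n)) (b v) = 0 := by
        rw [hk]
        refine Finset.sum_eq_zero fun p hp => hF p fun hp' => ?_
        rw [HasAntidiagonal.mem_antidiagonal] at hp
        rw [Finset.mem_product, Finset.mem_range, Finset.mem_range] at hp'
        omega
      exact (smul_eq_zero.1 h).resolve_left
        (inv_ne_zero (Nat.cast_ne_zero.2 (Nat.factorial_ne_zero _)))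
    rw [expSum_eq h0, expSum_eq hn, hc, LinearMap.sum_apply, Finset.sum_congr rfl fun k _ => hk k]
    calc _ = ∑ p ∈ range N ×ˢ range n, F p := by
          rw [Finset.sum_product]
          exact Finset.sum_congr rfl fun k _ => map_sum _ _ _
      _ = ∑ k ∈ range (N + n), ∑ p ∈ (range N ×ˢ range n) with p.1 + p.2 = k, F p := by
          refine (Finset.sum_fiberwise_of_maps_to (fun p hp => ?_) F).symm
          rw [Finset.mem_product, Finset.mem_range, Finset.mem_range] at hp
          rw [Finset.mem_range]
          omega
      _ = _ := by
          refine Finset.sum_congr rfl fun k _ => Finset.sum_subset (fun p hp => ?_)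
            fun p hp hp' => hF p fun h => hp' ?_
          · rw [HasAntidiagonal.mem_antidiagonal]
            exact (Finset.mem_filter.1 hp).2
          · exact Finset.mem_filter.2 ⟨h, HasAntidiagonal.mem_antidiagonal.1 hp⟩
  intro m
  obtain ⟨v, rfl⟩ := expSum_surjective ha m
  obtain ⟨n, hn⟩ := hb v
  refine ⟨n, ?_⟩
  have : ∀ k, (c ^ k) (expSum a v) = expSum a ((b ^ k) v) := by
    intro k
    induction k with
    | zero => rfl
    | succ k ih => rw [pow_succ', pow_succ', Module.End.mul_apply, Module.End.mul_apply, ih, hconj]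
  rw [this, hn, expSum_zero]

variable {L : Type*} [LieRing L] [LieAlgebra K L]

theorem map_ad_pow {L' : Type*} [LieRing L'] [LieAlgebra K L'] (φ : L →ₗ⁅K⁆ L') (a b : L) (k : ℕ) :
    φ (((LieAlgebra.ad K L a) ^ k) b) = ((LieAlgebra.ad K L' (φ a)) ^ k) (φ b) := by
  induction k with
  | zero => rfl
  | succ k ih =>
    rw [pow_succ', pow_succ', Module.End.mul_apply, Module.End.mul_apply, ← ih,
      LieAlgebra.ad_apply, LieAlgebra.ad_apply, LieHom.map_lie]

theorem IsLocNil.map_exp_ad [CharZero K] {φ : L →ₗ⁅K⁆ End K M} {a b : L} (ha : IsLocNil (φ a))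
    (hb : IsLocNil (φ b)) {N : ℕ} (hN : ((LieAlgebra.ad K L a) ^ N) b = 0) :
    IsLocNil (φ (∑ k ∈ range N, ((k.factorial : K)⁻¹) • ((LieAlgebra.ad K L a) ^ k) b)) := by
  rw [map_sum]
  simp only [map_smul, map_ad_pow]
  exact ha.exp_ad hb (by rw [← map_ad_pow, hN, map_zero])

variable [LieRingModule L M] [LieModule K L M]

/-- The elements of a Lie algebra that act locally nilpotently on the module `M` and on the Lie
algebra itself. -/
def locNilSet (K L M : Type*) [Field K] [LieRing L] [LieAlgebra K L] [AddCommGroup M] [Module K M]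
    [LieRingModule L M] [LieModule K L M] : Set L :=
  {x | IsLocNil (LieModule.toEnd K L M x) ∧ IsLocNil (LieAlgebra.ad K L x)}

theorem smul_mem_locNilSet {a : L} (ha : a ∈ locNilSet K L M) (t : K) :
    t • a ∈ locNilSet K L M :=
  ⟨by rw [map_smul]; exact ha.1.smul t, by rw [map_smul]; exact ha.2.smul t⟩

/-- For locally nilpotent `a` and `b`, the elements `exp (t ad a) b` are locally nilpotent, and their
linear term in `t` is the bracket. -/
theorem lie_mem_span_locNilSet [CharZero K] {a b : L} (ha : a ∈ locNilSet K L M)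
    (hb : b ∈ locNilSet K L M) : ⁅a, b⁆ ∈ Submodule.span K (locNilSet K L M) := by
  by_contra hnot
  obtain ⟨φ, hφ, hle⟩ := Submodule.exists_le_ker_of_notMem hnot
  obtain ⟨N, hN⟩ := ha.2 b
  replace hN : ((LieAlgebra.ad K L a) ^ (N + 2)) b = 0 := pow_apply_eq_zero_of_le hN (by omega)
  -- `φ` vanishes on `exp (t ad a) b` for all `t`, so the coefficient of `t` vanishes.
  let P : Polynomial K := ∑ k ∈ range (N + 2),
    Polynomial.monomial k (((k.factorial : K)⁻¹) * φ (((LieAlgebra.ad K L a) ^ k) b))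
  have hP : P = 0 := by
    refine Polynomial.funext fun t => ?_
    have hN' : ((LieAlgebra.ad K L (t • a)) ^ (N + 2)) b = 0 := by
      rw [map_smul, smul_pow, LinearMap.smul_apply, hN, smul_zero]
    have hmem : _ ∈ locNilSet K L M :=
      ⟨(smul_mem_locNilSet ha t).1.map_exp_ad hb.1 hN',
        (smul_mem_locNilSet ha t).2.map_exp_ad hb.2 hN'⟩
    have h0 := LinearMap.mem_ker.1 (hle (Submodule.subset_span hmem))
    rw [map_sum] at h0
    rw [Polynomial.eval_finsetSum, Polynomial.eval_zero, ← h0]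
    refine Finset.sum_congr rfl fun k _ => ?_
    rw [Polynomial.eval_monomial, map_smul (LieAlgebra.ad K L), smul_pow, LinearMap.smul_apply,
      map_smul, map_smul, smul_eq_mul, smul_eq_mul]
    ring
  have h1 : P.coeff 1 = φ ⁅a, b⁆ := by
    rw [Polynomial.finsetSum_coeff, Finset.sum_eq_single 1]
    · rw [Polynomial.coeff_monomial_same]; simp
    · intro k _ hk
      exact Polynomial.coeff_monomial_of_ne _ hk.symm
    · intro h
      exact absurd (Finset.mem_range.2 (by omega)) h
  exact hφ (by rw [← h1, hP, Polynomial.coeff_zero])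

/-- The span of the locally nilpotent elements, which is a Lie subalgebra. -/
def locNilSpan (K L M : Type*) [Field K] [CharZero K] [LieRing L] [LieAlgebra K L] [AddCommGroup M]
    [Module K M] [LieRingModule L M] [LieModule K L M] : LieSubalgebra K L where
  toSubmodule := Submodule.span K (locNilSet K L M)
  lie_mem' := by
    intro x y hx hy
    change x ∈ Submodule.span K (locNilSet K L M) at hx
    change y ∈ Submodule.span K (locNilSet K L M) at hy
    change ⁅x, y⁆ ∈ Submodule.span K (locNilSet K L M)
    induction hx, hy using Submodule.span_induction₂ with
    | mem_mem x y hx hy => exact lie_mem_span_locNilSet hx hy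
    | zero_left y hy => rw [zero_lie]; exact zero_mem _
    | zero_right x hx => rw [lie_zero]; exact zero_mem _
    | add_left x y z _ _ _ hx hy => rw [add_lie]; exact add_mem hx hy
    | add_right x y z _ _ _ hx hy => rw [lie_add]; exact add_mem hx hy
    | smul_left c x y _ _ h => rw [smul_lie]; exact Submodule.smul_mem _ c h
    | smul_right c x y _ _ h => rw [lie_smul]; exact Submodule.smul_mem _ c h

end LocallyNilpotent

section PBW

open Module

variable {K L M ι : Type*} [Field K] [LieRing L] [AddCommGroup M] [Module K M] [LieRingModule L M]

/-- The iterated action of the elements `x i`, for `i` in a list, on `v`. -/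
def lieWord (x : ι → L) (v : M) (l : List ι) : M := l.foldr (fun i m => ⁅x i, m⁆) v

variable (K) in
/-- The span of the words of length less than `k` applied to `v`. -/
def wordSpan (x : ι → L) (v : M) (k : ℕ) : Submodule K M :=
  Submodule.span K (lieWord x v '' {l | l.length < k})

variable {x : ι → L} {v : M}

theorem lieWord_mem {l : List ι} {k : ℕ} (h : l.length < k) : lieWord x v l ∈ wordSpan K x v k :=
  Submodule.subset_span ⟨l, h, rfl⟩

variable [LieAlgebra K L] [LieModule K L M]

theorem lie_mem_wordSpan (hx : Submodule.span K (Set.range x) = ⊤) {k : ℕ} {m : M}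
    (hm : m ∈ wordSpan K x v k) (z : L) : ⁅z, m⁆ ∈ wordSpan K x v (k + 1) := by
  have hz : z ∈ Submodule.span K (Set.range x) := hx ▸ Submodule.mem_top
  induction hz using Submodule.span_induction with
  | zero => rw [zero_lie]; exact zero_mem _
  | add y z _ _ hy hz => rw [add_lie]; exact add_mem hy hz
  | smul c y _ hy => rw [smul_lie]; exact Submodule.smul_mem _ c hy
  | mem z hz =>
    obtain ⟨i, rfl⟩ := hz
    induction hm using Submodule.span_induction with
    | zero => rw [lie_zero]; exact zero_mem _
    | add y z _ _ hy hz => rw [lie_add]; exact add_mem hy hz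
    | smul c y _ hy => rw [lie_smul]; exact Submodule.smul_mem _ c hy
    | mem m hm =>
      obtain ⟨l, hl, rfl⟩ := hm
      exact lieWord_mem (l := i :: l) (Nat.succ_lt_succ hl)

/-- Reordering a word changes it by shorter words. -/
theorem lieWord_perm (hx : Submodule.span K (Set.range x) = ⊤) {l l' : List ι} (h : l.Perm l') :
    lieWord x v l - lieWord x v l' ∈ wordSpan K x v l.length := by
  induction h with
  | nil => rw [sub_self]; exact zero_mem _
  | cons i _ ih =>
    change ⁅x i, _⁆ - ⁅x i, _⁆ ∈ _
    rw [← lie_sub]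
    exact lie_mem_wordSpan hx ih _
  | swap i j l =>
    change ⁅x j, ⁅x i, _⁆⁆ - ⁅x i, ⁅x j, _⁆⁆ ∈ _
    rw [← lie_lie]
    exact lie_mem_wordSpan hx (lieWord_mem (Nat.lt_succ_self _)) _
  | trans h _ ih ih' =>
    rw [← h.length_eq] at ih'
    rw [← sub_add_sub_cancel]
    exact add_mem ih ih'

theorem lieWord_append_replicate [DecidableEq ι] {i : ι} {n c : ℕ}
    (h : ((LieModule.toEnd K L M (x i)) ^ n) v = 0) (hn : n ≤ c) (l : List ι) :
    lieWord x v (l ++ List.replicate c i) = 0 := by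
  induction l with
  | nil =>
    have : ∀ c, lieWord x v (List.replicate c i) = ((LieModule.toEnd K L M (x i)) ^ c) v := by
      intro c
      induction c with
      | zero => rfl
      | succ c ih =>
        rw [pow_succ', Module.End.mul_apply, ← ih, List.replicate_succ]; rfl
    rw [List.nil_append, this, pow_apply_eq_zero_of_le h hn]
  | cons j l ih =>
    change ⁅x j, lieWord x v (l ++ List.replicate c i)⁆ = 0
    rw [ih, lie_zero]

/-- A vector on which a finite spanning family of a Lie algebra acts nilpotently generates a
finite-dimensional module: a long word contains some element of the family many times, hence it is,
up to shorter words, zero. -/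
theorem exists_finite_lieSubmodule [Finite ι] (hx : Submodule.span K (Set.range x) = ⊤)
    (hv : ∀ i, ∃ n, ((LieModule.toEnd K L M (x i)) ^ n) v = 0) :
    ∃ N : LieSubmodule K L M, FiniteDimensional K N ∧ v ∈ N := by
  classical
  have := Fintype.ofFinite ι
  choose n hn using hv
  let k := (∑ i, n i) + 1
  have hstep : wordSpan K x v (k + 1) ≤ wordSpan K x v k := by
    refine Submodule.span_le.2 ?_
    rintro _ ⟨l, hl, rfl⟩
    rcases Nat.lt_succ_iff_lt_or_eq.1 hl with hl | hl
    · exact lieWord_mem hl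
    -- As the length of `l` exceeds `∑ n i`, some letter occurs at least `n i` times.
    obtain ⟨i, hi⟩ : ∃ i, n i ≤ l.count i := by
      by_contra! h
      have h1 := Multiset.sum_count_eq_card (s := Finset.univ) (m := (l : Multiset ι))
        fun a _ => Finset.mem_univ a
      have h2 : ∑ i, l.count i ≤ ∑ i, n i := Finset.sum_le_sum fun i _ => (h i).le
      simp only [Multiset.coe_count, Multiset.coe_card] at h1
      omega
    have hp : l.Perm (l.filter (fun j => ! decide (j = i)) ++ List.replicate (l.count i) i) := by
      refine ((List.filter_append_perm (fun j => decide (j = i)) l).symm.trans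
        List.perm_append_comm).trans ?_
      rw [show l.filter (fun j => decide (j = i)) = List.replicate (l.count i) i from
        List.filter_eq i]
    have h := lieWord_perm (K := K) (v := v) hx hp
    rw [lieWord_append_replicate (K := K) (hn i) hi, sub_zero, hl] at h
    exact h
  refine ⟨{ wordSpan K x v k with lie_mem := fun hm => hstep (lie_mem_wordSpan hx hm _) }, ?_, ?_⟩
  · exact FiniteDimensional.span_of_finite K ((List.finite_length_lt ι k).image _)
  · exact lieWord_mem (l := []) (Nat.succ_pos _)

/-- A module over a finite-dimensional Lie algebra spanned by locally nilpotent elements is locally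
finite. -/
theorem exists_finite_lieSubmodule_of_locNilSpan [CharZero K] [FiniteDimensional K L]
    (h : locNilSpan K L M = ⊤) (v : M) :
    ∃ N : LieSubmodule K L M, FiniteDimensional K N ∧ v ∈ N := by
  have hs : ⊤ ≤ Submodule.span K (locNilSet K L M) := fun x _ => by
    have hx : x ∈ locNilSpan K L M := h ▸ LieSubalgebra.mem_top x
    exact hx
  let b := Basis.ofSpan hs
  have := Module.Finite.finite_basis b
  exact exists_finite_lieSubmodule (x := b) b.span_eq
    fun i => (Basis.ofSpan_subset hs ⟨i, rfl⟩).1 v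

end PBW

/-! ### The grading of a presented Lie superalgebra -/

section Grading

variable {X : Type} {deg : X → ℤ} {R : Words X → Prop}

theorem mono_mem_wordsOfDeg (m : FreeMagma X) : mono m ∈ wordsOfDeg deg (monoDeg deg m) :=
  Submodule.subset_span ⟨m, rfl, rfl⟩

theorem span_mono : Submodule.span ℂ (Set.range (mono : FreeMagma X → Words X)) = ⊤ := by
  refine eq_top_iff.2 fun w _ => ?_
  induction w using MonoidAlgebra.induction_linear with
  | zero => exact zero_mem _
  | add a b ha hb => exact add_mem (ha trivial) (hb trivial)
  | single m c =>
    have h : (MonoidAlgebra.single m c : Words X) = c • mono m := by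
      rw [mono, MonoidAlgebra.ofMagma_apply, MonoidAlgebra.smul_single, smul_eq_mul, mul_one]
    rw [h]
    exact Submodule.smul_mem _ _ (Submodule.subset_span ⟨m, rfl⟩)

/-- Linear maps on words that agree on monomials are equal. -/
theorem words_ext {V : Type*} [AddCommGroup V] [Module ℂ V] {f g : Words X →ₗ[ℂ] V}
    (h : ∀ m, f (mono m) = g (mono m)) : f = g :=
  LinearMap.ext_on_range span_mono h

/-- The projection of words to those of degree `p`. -/
def wordProj (deg : X → ℤ) (p : ℤ) : Words X →ₗ[ℂ] Words X :=
  Finsupp.lift (Words X) ℂ (FreeMagma X) (fun m => if monoDeg deg m = p then mono m else 0) ∘ₗ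
    (MonoidAlgebra.coeffLinearEquiv ℂ).toLinearMap

theorem wordProj_mono (p : ℤ) (m : FreeMagma X) :
    wordProj deg p (mono m) = if monoDeg deg m = p then mono m else 0 := by
  simp [wordProj, mono]

theorem wordProj_of_mem {p : ℤ} {w : Words X} (hw : w ∈ wordsOfDeg deg p) (q : ℤ) :
    wordProj deg q w = if p = q then w else 0 := by
  induction hw using Submodule.span_induction with
  | mem w hw => obtain ⟨m, rfl, rfl⟩ := hw; exact wordProj_mono q m
  | zero => simp
  | add a b _ _ ha hb => rw [map_add, ha, hb]; split_ifs <;> simp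
  | smul c a _ ha => rw [map_smul, ha]; split_ifs <;> simp

theorem wordProj_mono_mul (p : ℤ) (m : FreeMagma X) (b : Words X) :
    wordProj deg p (mono m * b) = mono m * wordProj deg (p - monoDeg deg m) b := by
  have h : wordProj deg p ∘ₗ LinearMap.mulLeft ℂ (mono m) =
      LinearMap.mulLeft ℂ (mono m) ∘ₗ wordProj deg (p - monoDeg deg m) := by
    refine words_ext fun n => ?_
    simp only [LinearMap.comp_apply, LinearMap.mulLeft_apply, ← mono_mul, wordProj_mono]
    have hd : monoDeg deg (m * n) = monoDeg deg m + monoDeg deg n := rfl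
    rw [hd]
    by_cases hn : monoDeg deg n = p - monoDeg deg m
    · rw [if_pos hn, if_pos (by omega), mono_mul]
    · rw [if_neg hn, if_neg (by omega), mul_zero]
  exact LinearMap.congr_fun h b

theorem wordProj_mul_mono (p : ℤ) (m : FreeMagma X) (b : Words X) :
    wordProj deg p (b * mono m) = wordProj deg (p - monoDeg deg m) b * mono m := by
  have h : wordProj deg p ∘ₗ LinearMap.mulRight ℂ (mono m) =
      LinearMap.mulRight ℂ (mono m) ∘ₗ wordProj deg (p - monoDeg deg m) := by
    refine words_ext fun n => ?_
    simp only [LinearMap.comp_apply, LinearMap.mulRight_apply, ← mono_mul, wordProj_mono]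
    have hd : monoDeg deg (n * m) = monoDeg deg n + monoDeg deg m := rfl
    rw [hd]
    by_cases hn : monoDeg deg n = p - monoDeg deg m
    · rw [if_pos hn, if_pos (by omega), mono_mul]
    · rw [if_neg hn, if_neg (by omega), zero_mul]
  exact LinearMap.congr_fun h b

theorem mem_relIdeal_iff {w : Words X} : w ∈ relIdeal deg R ↔ cls deg R w = 0 :=
  (Submodule.Quotient.mk_eq_zero _).symm

theorem relIdeal_le {I : Submodule ℂ (Words X)} (h1 : ∀ w, LieRel deg w → w ∈ I)
    (h2 : ∀ w, R w → w ∈ I) (h3 : IsIdeal I) : relIdeal deg R ≤ I :=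
  sInf_le ⟨h1, h2, h3⟩

theorem LieRel.homogeneous {w : Words X} (h : LieRel deg w) : ∃ d, w ∈ wordsOfDeg deg d := by
  cases h with
  | skew a b =>
    refine ⟨monoDeg deg a + monoDeg deg b, add_mem ?_ (Submodule.smul_mem _ _ ?_)⟩
    · rw [← mono_mul]; exact mono_mem_wordsOfDeg (a * b)
    · rw [← mono_mul, add_comm]; exact mono_mem_wordsOfDeg (b * a)
  | jacobi a b c =>
    refine ⟨monoDeg deg a + monoDeg deg b + monoDeg deg c,
      sub_mem (sub_mem ?_ ?_) (Submodule.smul_mem _ _ ?_)⟩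
    · rw [← mono_mul, ← mono_mul, add_assoc]; exact mono_mem_wordsOfDeg (a * (b * c))
    · rw [← mono_mul, ← mono_mul]; exact mono_mem_wordsOfDeg (a * b * c)
    · rw [← mono_mul, ← mono_mul, add_comm (monoDeg deg a), add_assoc]
      exact mono_mem_wordsOfDeg (b * (a * c))

/-- The ideal generated by homogeneous relations is graded. -/
theorem wordProj_mem_relIdeal (hR : ∀ w, R w → ∃ d, w ∈ wordsOfDeg deg d) (p : ℤ) {w : Words X}
    (hw : w ∈ relIdeal deg R) : wordProj deg p w ∈ relIdeal deg R := by
  let I : Submodule ℂ (Words X) := ⨅ p, (relIdeal deg R).comap (wordProj deg p)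
  have hI : ∀ w, w ∈ I ↔ ∀ p, wordProj deg p w ∈ relIdeal deg R := fun w => by
    simp [I, Submodule.mem_iInf]
  have hhom : ∀ w d, w ∈ wordsOfDeg deg d → cls deg R w = 0 → w ∈ I := by
    intro w d hd hw
    refine (hI w).2 fun p => ?_
    rw [wordProj_of_mem hd]
    split_ifs
    · exact mem_relIdeal_iff.2 hw
    · exact zero_mem _
  refine (hI w).1 (relIdeal_le (fun w hw => ?_) (fun w hw => ?_) ?_ hw) p
  · obtain ⟨d, hd⟩ := hw.homogeneous
    exact hhom w d hd (cls_lieRel hw)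
  · obtain ⟨d, hd⟩ := hR w hw
    exact hhom w d hd (cls_rel hw)
  · intro a b hb
    rw [hI] at hb
    have ha : a ∈ Submodule.span ℂ (Set.range (mono : FreeMagma X → Words X)) :=
      span_mono ▸ Submodule.mem_top
    induction ha using Submodule.span_induction with
    | mem a ha =>
      obtain ⟨m, rfl⟩ := ha
      constructor
      · refine (hI _).2 fun p => ?_
        rw [wordProj_mono_mul]
        exact (relIdeal_isIdeal deg R _ _ (hb _)).1
      · refine (hI _).2 fun p => ?_
        rw [wordProj_mul_mono]
        exact (relIdeal_isIdeal deg R _ _ (hb _)).2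
    | zero => rw [zero_mul, mul_zero]; exact ⟨zero_mem _, zero_mem _⟩
    | add x y _ _ hx hy =>
      rw [add_mul, mul_add]; exact ⟨add_mem hx.1 hy.1, add_mem hx.2 hy.2⟩
    | smul c x _ hx =>
      rw [smul_mul_assoc, mul_smul_comm]
      exact ⟨Submodule.smul_mem _ _ hx.1, Submodule.smul_mem _ _ hx.2⟩

/-- The projection to the subspace of degree `p`, in the presence of homogeneous relations. -/
def homogProj (hR : ∀ w, R w → ∃ d, w ∈ wordsOfDeg deg d) (p : ℤ) :
    Presented deg R →ₗ[ℂ] Presented deg R :=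
  (relIdeal deg R).mapQ _ (wordProj deg p) fun _ hw => wordProj_mem_relIdeal hR p hw

theorem homogProj_of_mem (hR : ∀ w, R w → ∃ d, w ∈ wordsOfDeg deg d) {p : ℤ} {x : Presented deg R}
    (hx : x ∈ homog deg R p) (q : ℤ) : homogProj hR q x = if p = q then x else 0 := by
  obtain ⟨w, hw, rfl⟩ := hx
  change cls deg R (wordProj deg q w) = _
  rw [wordProj_of_mem hw]
  split_ifs
  · rfl
  · exact map_zero _

theorem homogProj_mem (hR : ∀ w, R w → ∃ d, w ∈ wordsOfDeg deg d) (p : ℤ) (x : Presented deg R) :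
    homogProj hR p x ∈ homog deg R p := by
  obtain ⟨w, rfl⟩ := (relIdeal deg R).mkQ_surjective x
  refine ⟨wordProj deg p w, ?_, rfl⟩
  have hw : w ∈ Submodule.span ℂ (Set.range (mono : FreeMagma X → Words X)) :=
    span_mono ▸ Submodule.mem_top
  induction hw using Submodule.span_induction with
  | mem a ha =>
    obtain ⟨m, rfl⟩ := ha
    rw [wordProj_mono]
    split_ifs with h
    · exact h ▸ mono_mem_wordsOfDeg m
    · exact zero_mem _
  | zero => rw [map_zero]; exact zero_mem _
  | add x y _ _ hx hy => rw [map_add]; exact add_mem hx hy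
  | smul c x _ hx => rw [map_smul]; exact Submodule.smul_mem _ _ hx

/-- A subspace of one degree meets the sum of the subspaces of other degrees in zero. -/
theorem eq_zero_of_mem_iSup_homog (hR : ∀ w, R w → ∃ d, w ∈ wordsOfDeg deg d) {p : ℤ}
    {x : Presented deg R} (hx : x ∈ homog deg R p) {s : ℤ → Prop} (hs : ¬ s p)
    (hx' : x ∈ ⨆ q : {q : ℤ // s q}, homog deg R q) : x = 0 := by
  have h : (⨆ q : {q : ℤ // s q}, homog deg R q) ≤ LinearMap.ker (homogProj hR p) := by
    refine iSup_le fun q y hy => ?_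
    rw [LinearMap.mem_ker, homogProj_of_mem hR hy, if_neg]
    rintro rfl
    exact hs q.2
  have h' := LinearMap.mem_ker.1 (h hx')
  rwa [homogProj_of_mem hR hx, if_pos rfl] at h'

theorem iSup_homog : ⨆ p, homog deg R p = ⊤ := by
  refine eq_top_iff.2 fun x _ => ?_
  obtain ⟨w, rfl⟩ := (relIdeal deg R).mkQ_surjective x
  have hw : w ∈ Submodule.span ℂ (Set.range (mono : FreeMagma X → Words X)) :=
    span_mono ▸ Submodule.mem_top
  induction hw using Submodule.span_induction with
  | mem a ha =>
    obtain ⟨m, rfl⟩ := ha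
    exact Submodule.mem_iSup_of_mem (monoDeg deg m) ⟨_, mono_mem_wordsOfDeg m, rfl⟩
  | zero => rw [map_zero]; exact zero_mem _
  | add x y _ _ hx hy => rw [map_add]; exact add_mem (hx trivial) (hy trivial)
  | smul c x _ hx => rw [map_smul]; exact Submodule.smul_mem _ _ (hx trivial)

theorem gen_mem_wordsOfDeg (x : X) : gen x ∈ wordsOfDeg deg (deg x) :=
  mono_mem_wordsOfDeg (.of x)

theorem mul_mem_wordsOfDeg {p q : ℤ} {a b : Words X} (ha : a ∈ wordsOfDeg deg p)
    (hb : b ∈ wordsOfDeg deg q) : a * b ∈ wordsOfDeg deg (p + q) := by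
  induction ha, hb using Submodule.span_induction₂ with
  | mem_mem a b ha hb =>
    obtain ⟨m, rfl, rfl⟩ := ha
    obtain ⟨n, rfl, rfl⟩ := hb
    rw [← mono_mul]
    exact mono_mem_wordsOfDeg (m * n)
  | zero_left y hy => rw [zero_mul]; exact zero_mem _
  | zero_right x hx => rw [mul_zero]; exact zero_mem _
  | add_left x y z _ _ _ hx hy => rw [add_mul]; exact add_mem hx hy
  | add_right x y z _ _ _ hx hy => rw [mul_add]; exact add_mem hx hy
  | smul_left c x y _ _ h => rw [smul_mul_assoc]; exact Submodule.smul_mem _ c h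
  | smul_right c x y _ _ h => rw [mul_smul_comm]; exact Submodule.smul_mem _ c h

end Grading

theorem UnivRel.homogeneous {W : ModuleCat.{0} ℂ} (w : Words (Σ k : ℕ, Low W k)) (h : UnivRel W w) :
    ∃ d, w ∈ wordsOfDeg (univDeg W) d := by
  cases h with
  | lin k c x y =>
    exact ⟨1 - k, sub_mem (sub_mem (gen_mem_wordsOfDeg (deg := univDeg W) ⟨k, _⟩)
      (Submodule.smul_mem _ _ (gen_mem_wordsOfDeg (deg := univDeg W) ⟨k, _⟩)))
      (gen_mem_wordsOfDeg (deg := univDeg W) ⟨k, _⟩)⟩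
  | br k l x y =>
    refine ⟨(1 - k) + (1 - (l + 1 : ℕ)), sub_mem (mul_mem_wordsOfDeg
      (gen_mem_wordsOfDeg (deg := univDeg W) ⟨k, _⟩)
      (gen_mem_wordsOfDeg (deg := univDeg W) ⟨l + 1, _⟩)) ?_⟩
    have h := gen_mem_wordsOfDeg (deg := univDeg W) ⟨l + k, Low.br W k l x y⟩
    have hd : univDeg W ⟨l + k, Low.br W k l x y⟩ = (1 - k) + (1 - (l + 1 : ℕ)) := by
      simp only [univDeg]; push_cast; ring
    rwa [hd] at h

section BKM

variable {r : ℕ} {A : Matrix (Fin (r + 1)) (Fin (r + 1)) ℤ}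

theorem eW_mem (I : Fin (r + 1)) : eW I ∈ wordsOfDeg (chevDeg r) (if I = 0 then 1 else 0) :=
  gen_mem_wordsOfDeg (deg := chevDeg r) (.e I)

theorem fW_mem (I : Fin (r + 1)) : fW I ∈ wordsOfDeg (chevDeg r) (if I = 0 then -1 else 0) :=
  gen_mem_wordsOfDeg (deg := chevDeg r) (.f I)

theorem iterate_mul_mem_wordsOfDeg {X : Type} {deg : X → ℤ} {a b : Words X} {p : ℤ}
    (ha : a ∈ wordsOfDeg deg 0) (hb : b ∈ wordsOfDeg deg p) (n : ℕ) :
    (fun w => a * w)^[n] b ∈ wordsOfDeg deg p := by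
  induction n with
  | zero => exact hb
  | succ n ih =>
    rw [Function.iterate_succ_apply']
    simpa using mul_mem_wordsOfDeg ha ih

/-- The relations of the BKM superalgebra are homogeneous of degree at most one, except for
`⟦e₀, e₀⟧ = 0`. -/
theorem BKMRel.homogeneous_or {w : Words (ChevGen r)} (h : BKMRel A w) :
    (∃ d ≤ 1, w ∈ wordsOfDeg (chevDeg r) d) ∨ w = eW 0 * eW 0 := by
  have hh : ∀ I : Fin (r + 1), hW I ∈ wordsOfDeg (chevDeg r) 0 := by
    intro I
    have := mul_mem_wordsOfDeg (eW_mem I) (fW_mem I)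
    split_ifs at this <;> simpa using this
  cases h with
  | he I J =>
    refine .inl ⟨_, ?_, sub_mem ?_ (Submodule.smul_mem _ _ (eW_mem J))⟩
    · split_ifs <;> omega
    · simpa using mul_mem_wordsOfDeg (hh I) (eW_mem J)
  | hf I J =>
    refine .inl ⟨_, ?_, add_mem ?_ (Submodule.smul_mem _ _ (fW_mem J))⟩
    · split_ifs <;> omega
    · simpa using mul_mem_wordsOfDeg (hh I) (fW_mem J)
  | ef I J h =>
    refine .inl ⟨_, ?_, mul_mem_wordsOfDeg (eW_mem I) (fW_mem J)⟩
    split_ifs <;> omega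
  | e0 => exact .inr rfl
  | f0 => exact .inl ⟨_, by simp, mul_mem_wordsOfDeg (fW_mem 0) (fW_mem 0)⟩
  | serreE i J h =>
    refine .inl ⟨_, ?_, iterate_mul_mem_wordsOfDeg ?_ (eW_mem J) _⟩
    · split_ifs <;> omega
    · simpa [Fin.succ_ne_zero] using eW_mem i.succ
  | serreF i J h =>
    refine .inl ⟨_, ?_, iterate_mul_mem_wordsOfDeg ?_ (fW_mem J) _⟩
    · split_ifs <;> omega
    · simpa [Fin.succ_ne_zero] using fW_mem i.succ

theorem BKMRel.homogeneous (w : Words (ChevGen r)) (h : BKMRel A w) :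
    ∃ d, w ∈ wordsOfDeg (chevDeg r) d := by
  rcases h.homogeneous_or with ⟨d, _, hd⟩ | rfl
  · exact ⟨d, hd⟩
  · exact ⟨_, mul_mem_wordsOfDeg (eW_mem 0) (eW_mem 0)⟩

end BKM

/-! ### Superalgebras with a prescribed local part -/

section Local

variable {C : Type} [NonUnitalNonAssocRing C] [Module ℂ C]

/-- The homogeneous elements of an algebra satisfy the identities of a Lie superalgebra. -/
structure IsLieSuper (H : ℤ → Submodule ℂ C) : Prop where
  mul_mem : ∀ {p q : ℤ} {x y : C}, x ∈ H p → y ∈ H q → x * y ∈ H (p + q)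
  skew : ∀ {p q : ℤ} {x y : C}, x ∈ H p → y ∈ H q → x * y = -(sgn p q • (y * x))
  jacobi : ∀ {p q s : ℤ} {x y z : C}, x ∈ H p → y ∈ H q → z ∈ H s →
    x * (y * z) = (x * y) * z + sgn p q • (y * (x * z))

theorem Presented.isLieSuper {X : Type} (deg : X → ℤ) (R : Words X → Prop) :
    IsLieSuper (homog deg R) :=
  ⟨mul_mem_homog, skew, jacobi⟩

theorem IsLieSuper.prod {C' : Type} [NonUnitalNonAssocRing C'] [Module ℂ C']
    {H : ℤ → Submodule ℂ C} {H' : ℤ → Submodule ℂ C'} (h : IsLieSuper H) (h' : IsLieSuper H') :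
    IsLieSuper fun p => (H p).prod (H' p) where
  mul_mem hx hy := ⟨h.mul_mem hx.1 hy.1, h'.mul_mem hx.2 hy.2⟩
  skew hx hy := Prod.ext (h.skew hx.1 hy.1) (h'.skew hx.2 hy.2)
  jacobi hx hy hz := Prod.ext (h.jacobi hx.1 hy.1 hz.1) (h'.jacobi hx.2 hy.2 hz.2)

theorem mul_mem_swap {H : ℤ → Submodule ℂ C} (hH : IsLieSuper H) {p q : ℤ} {x y : C} (hx : x ∈ H p)
    (hy : y ∈ H q) {S : Submodule ℂ C} (h : y * x ∈ S) : x * y ∈ S := by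
  rw [hH.skew hx hy]
  exact neg_mem (Submodule.smul_mem _ _ h)

variable [IsScalarTower ℂ C C] [SMulCommClass ℂ C C] {Y : Type}

/-- The span of the products of `n` elements of a family. -/
def wordPart (ι : Y → C) (n : ℤ) : Submodule ℂ C :=
  (wordsOfDeg (fun _ => 1) n).map (FreeNonUnitalNonAssocAlgebra.lift ℂ ι : Words Y →ₗ[ℂ] C)

theorem lift_gen (ι : Y → C) (y : Y) : FreeNonUnitalNonAssocAlgebra.lift ℂ ι (gen y) = ι y :=
  FreeNonUnitalNonAssocAlgebra.lift_of_apply ℂ ι y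

theorem one_le_monoDeg (m : FreeMagma Y) : 1 ≤ monoDeg (fun _ : Y => 1) m := by
  induction m with
  | ih1 x => exact le_rfl
  | ih2 a b ha hb =>
    change 1 ≤ monoDeg _ a + monoDeg _ b
    omega

theorem wordsOfDeg_one : wordsOfDeg (fun _ : Y => 1) 1 = Submodule.span ℂ (Set.range gen) := by
  refine le_antisymm (Submodule.span_le.2 ?_) (Submodule.span_le.2 ?_)
  · rintro _ ⟨m, hm, rfl⟩
    cases m with
    | of x => exact Submodule.subset_span ⟨x, rfl⟩
    | mul a b =>
      have ha := one_le_monoDeg a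
      have hb := one_le_monoDeg b
      change monoDeg _ a + monoDeg _ b = 1 at hm
      omega
  · rintro _ ⟨x, rfl⟩
    exact gen_mem_wordsOfDeg (deg := fun _ : Y => 1) x

/-- A local part: subspaces `P k` of degree `1 - k`, closed under those products that have degree at
most one and involve at most one factor of degree one, and a family spanning the one of degree
one. -/
structure IsLocalPart (H : ℤ → Submodule ℂ C) (P : ℕ → Submodule ℂ C) (ι : Y → C) : Prop where
  le : ∀ k, P k ≤ H (1 - k)
  mul_mem : ∀ k l {x y : C}, x ∈ P k → y ∈ P (l + 1) → x * y ∈ P (l + k)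
  span_eq : Submodule.span ℂ (Set.range ι) = P 0

/-- The subspaces of a local part, extended to positive degrees by the products of elements of
degree one. -/
def extendLocal (P : ℕ → Submodule ℂ C) (ι : Y → C) (d : ℤ) : Submodule ℂ C :=
  if 1 ≤ d then wordPart ι d else P (1 - d).toNat

variable {H : ℤ → Submodule ℂ C} {P : ℕ → Submodule ℂ C} {ι : Y → C}

theorem extendLocal_of_one_le {d : ℤ} (hd : 1 ≤ d) : extendLocal P ι d = wordPart ι d := if_pos hd

theorem wordPart_one (h : IsLocalPart H P ι) : wordPart ι 1 = P 0 := by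
  rw [wordPart, wordsOfDeg_one, Submodule.map_span, ← h.span_eq, ← Set.range_comp]
  congr 2
  exact funext (lift_gen ι)

theorem extendLocal_eq (h : IsLocalPart H P ι) (k : ℕ) : extendLocal P ι (1 - k) = P k := by
  rw [extendLocal]
  split_ifs with hk
  · obtain rfl : k = 0 := by omega
    exact wordPart_one h
  · congr 1; omega

theorem extendLocal_of_le_one (h : IsLocalPart H P ι) {d : ℤ} (hd : d ≤ 1) :
    extendLocal P ι d = P (1 - d).toNat := by
  rw [← extendLocal_eq h]; congr 1; omega

theorem mul_mem_wordPart {p q : ℤ} {x y : C} (hx : x ∈ wordPart ι p) (hy : y ∈ wordPart ι q) :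
    x * y ∈ wordPart ι (p + q) := by
  obtain ⟨a, ha, rfl⟩ := hx
  obtain ⟨b, hb, rfl⟩ := hy
  exact ⟨a * b, mul_mem_wordsOfDeg ha hb, map_mul (FreeNonUnitalNonAssocAlgebra.lift ℂ ι) a b⟩

theorem lift_mono_mem (m : FreeMagma Y) :
    FreeNonUnitalNonAssocAlgebra.lift ℂ ι (mono m) ∈ wordPart ι (monoDeg (fun _ => 1) m) :=
  ⟨_, mono_mem_wordsOfDeg m, rfl⟩

theorem wordPart_le (hH : IsLieSuper H) (h : IsLocalPart H P ι) (d : ℤ) : wordPart ι d ≤ H d := by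
  rintro _ ⟨w, hw, rfl⟩
  have key : ∀ m : FreeMagma Y,
      FreeNonUnitalNonAssocAlgebra.lift ℂ ι (mono m) ∈ H (monoDeg (fun _ => 1) m) := by
    intro m
    induction m with
    | ih1 x =>
      have hx : ι x ∈ P 0 := h.span_eq ▸ Submodule.subset_span ⟨x, rfl⟩
      have h1 := h.le 0 hx
      have h2 : FreeNonUnitalNonAssocAlgebra.lift ℂ ι (mono (.of x)) = ι x := lift_gen ι x
      rw [h2]
      rwa [Nat.cast_zero, sub_zero] at h1
    | ih2 a b ha hb =>
      rw [mono_mul, map_mul]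
      exact hH.mul_mem ha hb
  induction hw using Submodule.span_induction with
  | mem w hw => obtain ⟨m, rfl, rfl⟩ := hw; exact key m
  | zero => rw [map_zero]; exact zero_mem _
  | add x y _ _ hx hy => rw [map_add]; exact add_mem hx hy
  | smul c x _ hx => rw [map_smul]; exact Submodule.smul_mem _ _ hx

theorem extendLocal_le (hH : IsLieSuper H) (h : IsLocalPart H P ι) (d : ℤ) :
    extendLocal P ι d ≤ H d := by
  rcases le_total 1 d with hd | hd
  · rw [extendLocal_of_one_le hd]; exact wordPart_le hH h d
  · rw [extendLocal_of_le_one h hd]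
    convert h.le (1 - d).toNat using 2
    omega

theorem lift_mono_mul_mem (hH : IsLieSuper H) (h : IsLocalPart H P ι) (m : FreeMagma Y) :
    ∀ {e : ℤ} {y : C}, y ∈ extendLocal P ι e →
      FreeNonUnitalNonAssocAlgebra.lift ℂ ι (mono m) * y ∈
        extendLocal P ι (monoDeg (fun _ => 1) m + e) := by
  have hm : ∀ m : FreeMagma Y, FreeNonUnitalNonAssocAlgebra.lift ℂ ι (mono m) ∈
      H (monoDeg (fun _ => 1) m) := fun m => wordPart_le hH h _ (lift_mono_mem m)
  induction m with
  | ih1 x =>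
    intro e y hy
    have hd : monoDeg (fun _ : Y => 1) (.of x) = 1 := rfl
    rcases le_or_gt 1 e with he | he
    · rw [extendLocal_of_one_le he] at hy
      rw [extendLocal_of_one_le (by omega)]
      exact mul_mem_wordPart (lift_mono_mem _) hy
    · have hx : FreeNonUnitalNonAssocAlgebra.lift ℂ ι (mono (.of x)) ∈ P 0 :=
        wordPart_one h ▸ lift_mono_mem (.of x)
      rw [extendLocal_of_le_one h he.le] at hy
      obtain ⟨l, hl⟩ : ∃ l : ℕ, (1 - e).toNat = l + 1 := ⟨(1 - e).toNat - 1, by omega⟩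
      rw [hl] at hy
      rw [extendLocal_of_le_one h (by omega)]
      convert h.mul_mem 0 l hx hy using 2
      omega
  | ih2 a b iha ihb =>
    intro e y hy
    have hd : monoDeg (fun _ : Y => 1) (a * b) = monoDeg (fun _ => 1) a + monoDeg (fun _ => 1) b :=
      rfl
    have hj := hH.jacobi (hm a) (hm b) (extendLocal_le hH h e hy)
    rw [mono_mul, map_mul, eq_sub_of_add_eq hj.symm, hd]
    refine sub_mem ?_ (Submodule.smul_mem _ _ ?_)
    · rw [add_assoc]; exact iha (ihb hy)
    · rw [add_comm (monoDeg (fun _ => 1) a), add_assoc]; exact ihb (iha hy)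

/-- A local part, together with the products of its elements of degree one, is closed under
products. -/
theorem mul_mem_extendLocal (hH : IsLieSuper H) (h : IsLocalPart H P ι) {d e : ℤ} {x y : C}
    (hx : x ∈ extendLocal P ι d) (hy : y ∈ extendLocal P ι e) :
    x * y ∈ extendLocal P ι (d + e) := by
  have key : ∀ {d e : ℤ} {x y : C}, 1 ≤ d → x ∈ extendLocal P ι d → y ∈ extendLocal P ι e →
      x * y ∈ extendLocal P ι (d + e) := by
    intro d e x y hd hx hy
    rw [extendLocal_of_one_le hd] at hx
    obtain ⟨w, hw, rfl⟩ := hx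
    change FreeNonUnitalNonAssocAlgebra.lift ℂ ι w * y ∈ _
    induction hw using Submodule.span_induction with
    | mem w hw => obtain ⟨m, rfl, rfl⟩ := hw; exact lift_mono_mul_mem hH h m hy
    | zero => rw [map_zero, zero_mul]; exact zero_mem _
    | add x y _ _ hx hy => rw [map_add, add_mul]; exact add_mem hx hy
    | smul c x _ hx => rw [map_smul, smul_mul_assoc]; exact Submodule.smul_mem _ _ hx
  rcases le_or_gt 1 d with hd | hd
  · exact key hd hx hy
  rcases le_or_gt 1 e with he | he
  · refine mul_mem_swap hH (extendLocal_le hH h d hx) (extendLocal_le hH h e hy) ?_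
    rw [add_comm]
    exact key he hy hx
  rw [extendLocal_of_le_one h hd.le] at hx
  rw [extendLocal_of_le_one h he.le] at hy
  obtain ⟨l, hl⟩ : ∃ l : ℕ, (1 - e).toNat = l + 1 := ⟨(1 - e).toNat - 1, by omega⟩
  rw [hl] at hy
  rw [extendLocal_of_le_one h (by omega)]
  convert h.mul_mem _ l hx hy using 2
  omega

/-- The value of a word lies in the extension of a local part, if the values of the generators do. -/
theorem map_mem_extendLocal (hH : IsLieSuper H) (h : IsLocalPart H P ι) {Z : Type} {deg : Z → ℤ}
    (F : Words Z →ₙₐ[ℂ] C) (hF : ∀ z, F (gen z) ∈ extendLocal P ι (deg z)) {d : ℤ} {w : Words Z}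
    (hw : w ∈ wordsOfDeg deg d) : F w ∈ extendLocal P ι d := by
  have key : ∀ m : FreeMagma Z, F (mono m) ∈ extendLocal P ι (monoDeg deg m) := by
    intro m
    induction m with
    | ih1 x => exact hF x
    | ih2 a b ha hb =>
      rw [mono_mul, map_mul]
      exact mul_mem_extendLocal hH h ha hb
  induction hw using Submodule.span_induction with
  | mem w hw => obtain ⟨m, rfl, rfl⟩ := hw; exact key m
  | zero => rw [map_zero]; exact zero_mem _
  | add x y _ _ hx hy => rw [map_add]; exact add_mem hx hy
  | smul c x _ hx => rw [map_smul]; exact Submodule.smul_mem _ _ hx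

end Local

/-! ### The local part of the universal graded Lie superalgebra -/

section Univ

variable {W : ModuleCat.{0} ℂ}

theorem Univ.isLieSuper (W : ModuleCat.{0} ℂ) : IsLieSuper (Univ.deg W) :=
  Presented.isLieSuper _ _

theorem Univ.isLocalPart (W : ModuleCat.{0} ℂ) :
    IsLocalPart (Univ.deg W) (fun k => LinearMap.range (Univ.low W k)) (Univ.low W 0) where
  le k := by
    rintro _ ⟨x, rfl⟩
    exact Univ.low_mem W k x
  mul_mem k l := by
    rintro _ _ ⟨x, rfl⟩ ⟨y, rfl⟩
    exact ⟨_, (Univ.low_br W k l x y).symm⟩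
  span_eq := by
    rw [← LinearMap.coe_range, Submodule.span_eq]

/-- In positive degrees, the universal graded Lie superalgebra consists of words in elements of
degree one. -/
theorem Univ.deg_le_wordPart {p : ℤ} (hp : 1 ≤ p) : Univ.deg W p ≤ wordPart (Univ.low W 0) p := by
  rw [← extendLocal_of_one_le (P := fun k => LinearMap.range (Univ.low W k)) hp]
  have hcls : ∃ F : Words (Σ k : ℕ, Low W k) →ₙₐ[ℂ] Univ W, ∀ w, F w = cls _ _ w :=
    ⟨{ cls (univDeg W) (UnivRel W) with
        map_zero' := map_zero (cls (univDeg W) (UnivRel W))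
        map_mul' := cls_mul }, fun w => rfl⟩
  obtain ⟨F, hF⟩ := hcls
  rintro _ ⟨w, hw, rfl⟩
  rw [← hF]
  refine map_mem_extendLocal (Univ.isLieSuper W) (Univ.isLocalPart W) F (fun z => ?_) hw
  obtain ⟨k, x⟩ := z
  have h := extendLocal_eq (Univ.isLocalPart W) k
  change F _ ∈ extendLocal _ _ (1 - (k : ℤ))
  rw [h, hF]
  exact ⟨x, rfl⟩

end Univ

/-! ### The adjoint action of the BKM superalgebra on its subspace of degree one -/

section AdLow

variable {r : ℕ} {A : Matrix (Fin (r + 1)) (Fin (r + 1)) ℤ}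

variable (A) in
/-- The map from the BKM superalgebra to the nonpositive degrees of the universal graded Lie
superalgebra that sends an element `b` of degree `1 - k` to the multilinear map
`(u₁, …, uₖ) ↦ ⟦uₖ, …⟦u₁, b⟧⟧`. Elements of other degrees are sent to zero. -/
def adLow : (k : ℕ) → BKM A →ₗ[ℂ] Low (BOne A) k
  | 0 => ((homogProj BKMRel.homogeneous 1).codRestrict (BKM.deg A 1)
      (homogProj_mem BKMRel.homogeneous 1) : BKM A →ₗ[ℂ] BKM.deg A 1)
  | k + 1 =>
    { toFun := fun b => Low.lam (BOne A) k
        (adLow k ∘ₗ LinearMap.mulRight ℂ b ∘ₗ (BKM.deg A 1).subtype)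
      map_add' := fun b b' => by
        rw [← map_add]
        congr 1
        refine LinearMap.ext fun u => ?_
        exact (congrArg (adLow k) (mul_add _ b b')).trans (map_add (adLow k) _ _)
      map_smul' := fun c b => by
        rw [← map_smul]
        congr 1
        refine LinearMap.ext fun u => ?_
        exact (congrArg (adLow k) (mul_smul_comm c _ b)).trans (map_smul (adLow k) _ _) }

theorem app_adLow (k : ℕ) (b : BKM A) (u : BOne A) :
    Low.app (BOne A) k (adLow A (k + 1) b) u = adLow A k (((u : BKM.deg A 1) : BKM A) * b) := rfl

theorem adLow_zero (u : BKM.deg A 1) : adLow A 0 (u : BKM A) = u := by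
  refine Subtype.ext ?_
  change homogProj BKMRel.homogeneous 1 (u : BKM A) = u
  rw [homogProj_of_mem _ u.2, if_pos rfl]

theorem adLow_one (z : gSub A) : adLow A 1 (z : BKM A) = adStar A z := by
  refine LinearMap.ext fun u => ?_
  change adLow A 0 (((u : BKM.deg A 1) : BKM A) * z) = _
  have hu : ((u : BKM.deg A 1) : BKM A) * z ∈ BKM.deg A 1 := by
    simpa using mul_mem_homog u.2 (gSub_le A z.2)
  exact adLow_zero ⟨_, hu⟩

theorem cast_adLow {k l : ℕ} (h : k = l) (b : BKM A) :
    Low.cast (BOne A) h (adLow A k b) = adLow A l b := by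
  subst h; rfl

/-- `adLow` is compatible with supercommutators. -/
theorem br_adLow (k l : ℕ) {x y : BKM A} (hx : x ∈ BKM.deg A (1 - k)) (hy : y ∈ BKM.deg A (-l)) :
    Low.br (BOne A) k l (adLow A k x) (adLow A (l + 1) y) = adLow A (l + k) (x * y) := by
  match k with
  | 0 =>
    have hx' : x ∈ BKM.deg A 1 := by simpa using hx
    rw [Low.br]
    have h0 : adLow A 0 x = (⟨x, hx'⟩ : BKM.deg A 1) := adLow_zero ⟨x, hx'⟩
    rw [h0]
    rfl
  | j + 1 =>
    rw [Low.br, LinearMap.mk₂_apply]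
    refine LinearMap.ext fun u => ?_
    have hu : ((u : BKM.deg A 1) : BKM A) ∈ BKM.deg A 1 := u.2
    generalize hu' : ((u : BKM.deg A 1) : BKM A) = u' at hu
    have hxj : x ∈ BKM.deg A (-j) := by simpa using hx
    have h1 : u' * x ∈ BKM.deg A (1 - j) := mul_mem_homog hu hxj
    have h2 : u' * y ∈ BKM.deg A (1 - l) := mul_mem_homog hu hy
    have ih1 := br_adLow j l h1 hy
    have ih2 := br_adLow l j h2 hxj
    change Low.br (BOne A) j l (Low.app (BOne A) j (adLow A (j + 1) x) u) (adLow A (l + 1) y) -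
      sgn j l • Low.cast (BOne A) (Nat.add_comm j l) (Low.br (BOne A) l j
        (Low.app (BOne A) l (adLow A (l + 1) y) u) (adLow A (j + 1) x)) =
      Low.app (BOne A) (l + j) (adLow A (l + j + 1) (x * y)) u
    rw [app_adLow, app_adLow, app_adLow, hu', ih1, ih2, cast_adLow, ← map_smul, ← map_sub]
    congr 1
    rw [jacobi hu hxj hy, skew hxj h2, smul_neg, smul_smul, sub_eq_add_neg]
    congr 3
    simp only [sgn]
    rw [← Int.cast_mul, ← Units.val_mul, ← Int.negOnePow_add]
    congr 2
    rw [Int.negOnePow_eq_iff]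
    refine ⟨j, ?_⟩
    ring
termination_by k + l

end AdLow

/-! ### Comparison of the BKM superalgebra with the universal graded Lie superalgebra -/

section Compare

variable {r : ℕ} {A : Matrix (Fin (r + 1)) (Fin (r + 1)) ℤ}

variable (A) in
/-- The map `b ↦ (b, ad b)` to the product of the BKM superalgebra and the universal graded Lie
superalgebra, `b` being of degree `1 - k`. -/
def pairLow (k : ℕ) : BKM A →ₗ[ℂ] BKM A × Univ (BOne A) :=
  LinearMap.id.prod (Univ.low (BOne A) k ∘ₗ adLow A k)

variable (A) in
/-- The elements of degree one, diagonally embedded. -/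
def pairOne (u : BOne A) : BKM A × Univ (BOne A) :=
  (((u : BKM.deg A 1) : BKM A), Univ.low (BOne A) 0 u)

variable (A) in
/-- The graph of the comparison between the BKM superalgebra and the universal graded Lie
superalgebra: pairs `(b, ad b)` in degrees at most one, and the values of the same word in elements
of degree one in positive degrees. -/
def graphPart (d : ℤ) : Submodule ℂ (BKM A × Univ (BOne A)) :=
  extendLocal (fun k => (BKM.deg A (1 - k)).map (pairLow A k)) (pairOne A) d

theorem pair_isLieSuper :
    IsLieSuper fun p => (BKM.deg A p).prod (Univ.deg (BOne A) p) :=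
  (Presented.isLieSuper _ _).prod (Univ.isLieSuper _)

theorem pair_isLocalPart :
    IsLocalPart (fun p => (BKM.deg A p).prod (Univ.deg (BOne A) p))
      (fun k => (BKM.deg A (1 - k)).map (pairLow A k)) (pairOne A) where
  le k := by
    rintro _ ⟨b, hb, rfl⟩
    exact ⟨hb, Univ.low_mem _ _ _⟩
  mul_mem k l := by
    rintro _ _ ⟨x, hx, rfl⟩ ⟨y, hy, rfl⟩
    have hy' : y ∈ BKM.deg A (-l) := by
      have h : (1 - ((l + 1 : ℕ) : ℤ)) = -l := by push_cast; ring
      rwa [h] at hy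
    refine ⟨x * y, ?_, ?_⟩
    · have h : (1 - ((l + k : ℕ) : ℤ)) = (1 - k) + -l := by push_cast; ring
      rw [h]
      exact mul_mem_homog hx hy'
    · refine Prod.ext rfl ?_
      change Univ.low _ (l + k) (adLow A (l + k) (x * y)) =
        Univ.low _ k (adLow A k x) * Univ.low _ (l + 1) (adLow A (l + 1) y)
      rw [Univ.low_br, br_adLow k l hx hy']
  span_eq := by
    have h : Set.range (pairOne A) =
        (((BKM.deg A (1 - (0 : ℕ))).map (pairLow A 0) : Submodule ℂ (BKM A × Univ (BOne A))) :
          Set (BKM A × Univ (BOne A))) := by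
      have h0 : ∀ u : BKM.deg A 1, pairOne A u = pairLow A 0 u := fun u =>
        Prod.ext rfl (congrArg (Univ.low (BOne A) 0) (adLow_zero u).symm)
      ext x
      constructor
      · rintro ⟨u, rfl⟩
        refine ⟨((u : BKM.deg A 1) : BKM A), ?_, (h0 u).symm⟩
        rw [Nat.cast_zero, sub_zero]
        exact (u : BKM.deg A 1).2
      · rintro ⟨b, hb, rfl⟩
        have hb' : b ∈ BKM.deg A 1 := by simpa using hb
        exact ⟨(⟨b, hb'⟩ : BKM.deg A 1), h0 ⟨b, hb'⟩⟩
    rw [h, Submodule.span_eq]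

theorem mul_mem_graphPart {d e : ℤ} {x y : BKM A × Univ (BOne A)} (hx : x ∈ graphPart A d)
    (hy : y ∈ graphPart A e) : x * y ∈ graphPart A (d + e) :=
  mul_mem_extendLocal pair_isLieSuper pair_isLocalPart hx hy

theorem pairLow_mem {k : ℕ} {b : BKM A} (hb : b ∈ BKM.deg A (1 - k)) :
    (b, Univ.low _ k (adLow A k b)) ∈ graphPart A (1 - k) := by
  rw [graphPart, extendLocal_eq pair_isLocalPart]
  exact ⟨b, hb, rfl⟩

/-- In degrees at most one, the graph is the graph of `adLow`. -/
theorem graphPart_of_le_one {d : ℤ} (hd : d ≤ 1) {x : BKM A × Univ (BOne A)}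
    (h : x ∈ graphPart A d) : x.2 = Univ.low _ (1 - d).toNat (adLow A (1 - d).toNat x.1) := by
  rw [graphPart, extendLocal_of_le_one pair_isLocalPart hd] at h
  obtain ⟨b, _, rfl⟩ := h
  rfl

theorem lift_pairOne (w : Words (BOne A)) :
    FreeNonUnitalNonAssocAlgebra.lift ℂ (pairOne A) w = (evalBKM A w, evalUniv A w) := by
  have h1 : (NonUnitalAlgHom.fst ℂ (BKM A) (Univ (BOne A))).comp
      (FreeNonUnitalNonAssocAlgebra.lift ℂ (pairOne A)) = evalBKM A := by
    refine FreeNonUnitalNonAssocAlgebra.hom_ext ℂ fun u => ?_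
    change (FreeNonUnitalNonAssocAlgebra.lift ℂ (pairOne A) (gen u)).1 = evalBKM A (gen u)
    rw [lift_gen, evalBKM, lift_gen]
    rfl
  have h2 : (NonUnitalAlgHom.snd ℂ (BKM A) (Univ (BOne A))).comp
      (FreeNonUnitalNonAssocAlgebra.lift ℂ (pairOne A)) = evalUniv A := by
    refine FreeNonUnitalNonAssocAlgebra.hom_ext ℂ fun u => ?_
    change (FreeNonUnitalNonAssocAlgebra.lift ℂ (pairOne A) (gen u)).2 = evalUniv A (gen u)
    rw [lift_gen, evalUniv, lift_gen]
    rfl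
  exact Prod.ext (DFunLike.congr_fun h1 w) (DFunLike.congr_fun h2 w)

/-- In positive degrees, the graph consists of the pairs of values of words. -/
theorem mem_graphPart_iff {p : ℕ} (hp : 1 ≤ p) {b : BKM A} {x : Univ (BOne A)} :
    (b, x) ∈ graphPart A p ↔ ∃ w ∈ oneWords A p, evalBKM A w = b ∧ evalUniv A w = x := by
  rw [graphPart, extendLocal_of_one_le (by exact_mod_cast hp)]
  constructor
  · rintro ⟨w, hw, h⟩
    have h' := (lift_pairOne w).symm.trans h
    exact ⟨w, hw, congrArg Prod.fst h', congrArg Prod.snd h'⟩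
  · rintro ⟨w, hw, rfl, rfl⟩
    exact ⟨w, hw, lift_pairOne w⟩

theorem mem_Cplus_iff {p : ℕ} (hp : 1 ≤ p) {x : Univ (BOne A)} :
    x ∈ Cplus A p ↔ ((0 : BKM A), x) ∈ graphPart A p := by
  rw [mem_graphPart_iff hp]
  constructor
  · rintro ⟨w, ⟨hw, h0⟩, rfl⟩
    exact ⟨w, hw, h0, rfl⟩
  · rintro ⟨w, hw, h0, rfl⟩
    exact ⟨w, ⟨hw, h0⟩, rfl⟩

theorem Cplus_le_deg {p : ℕ} : Cplus A p ≤ Univ.deg (BOne A) p := by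
  rintro _ ⟨w, ⟨hw, _⟩, rfl⟩
  exact wordPart_le (Univ.isLieSuper _) (Univ.isLocalPart _) p ⟨w, hw, rfl⟩

/-- An element of degree `1 - k`, `k ≥ 1`, acts on the kernel of the projection to the BKM
superalgebra. -/
theorem low_mul_mem_Cplus {k p q : ℕ} (hp : 1 ≤ p) (hq : 1 ≤ q) (h : (q : ℤ) = 1 - k + p)
    {b : BKM A} (hb : b ∈ BKM.deg A (1 - k)) {c : Univ (BOne A)} (hc : c ∈ Cplus A p) :
    Univ.low _ k (adLow A k b) * c ∈ Cplus A q := by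
  rw [mem_Cplus_iff hp] at hc
  rw [mem_Cplus_iff hq, h]
  have h' := mul_mem_graphPart (pairLow_mem hb) hc
  rwa [Prod.mk_mul_mk, mul_zero] at h'

theorem Cplus_one : Cplus A 1 = ⊥ := by
  refine (Submodule.eq_bot_iff _).2 fun c hc => ?_
  rw [mem_Cplus_iff le_rfl] at hc
  have h := graphPart_of_le_one le_rfl hc
  rwa [map_zero, map_zero] at h

end Compare

/-! ### The ideal generated by the kernel in degree two -/

section QuadraticIdeal

variable {r : ℕ} {A : Matrix (Fin (r + 1)) (Fin (r + 1)) ℤ}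

variable (A) in
/-- The part of degree `n + 2` of the ideal of the free Lie superalgebra generated by `Cplus A 2`. -/
def quadPart : ℕ → Submodule ℂ (Univ (BOne A))
  | 0 => Cplus A 2
  | n + 1 => Submodule.span ℂ {x | ∃ u, ∃ j ∈ quadPart n, x = Univ.low (BOne A) 0 u * j}

variable (A) in
/-- The ideal of the free Lie superalgebra generated by `Cplus A 2`. -/
def quadIdeal : Submodule ℂ (Univ (BOne A)) := ⨆ n, quadPart A n

theorem quadPart_le_quadIdeal (n : ℕ) : quadPart A n ≤ quadIdeal A := le_iSup (quadPart A) n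

theorem quadPart_induction {n : ℕ} {S : Submodule ℂ (Univ (BOne A))}
    {f : Univ (BOne A) →ₗ[ℂ] Univ (BOne A)}
    (h : ∀ u, ∀ j ∈ quadPart A n, f (Univ.low (BOne A) 0 u * j) ∈ S) {x : Univ (BOne A)}
    (hx : x ∈ quadPart A (n + 1)) : f x ∈ S := by
  have hle : quadPart A (n + 1) ≤ S.comap f := Submodule.span_le.2 (by
    rintro _ ⟨u, j, hj, rfl⟩
    exact h u j hj)
  exact hle hx

theorem low_zero_mul_mem_quadPart (u : BOne A) {n : ℕ} {j : Univ (BOne A)} (hj : j ∈ quadPart A n) :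
    Univ.low (BOne A) 0 u * j ∈ quadPart A (n + 1) :=
  Submodule.subset_span ⟨u, j, hj, rfl⟩

theorem low_zero_mem (u : BOne A) : Univ.low (BOne A) 0 u ∈ Univ.deg (BOne A) 1 := by
  simpa using Univ.low_mem (BOne A) 0 u

theorem quadPart_le_deg (n : ℕ) : quadPart A n ≤ Univ.deg (BOne A) (n + 2) := by
  induction n with
  | zero => simpa using! Cplus_le_deg (A := A) (p := 2)
  | succ n ih =>
    intro x hx
    refine quadPart_induction (f := LinearMap.id) (fun u j hj => ?_) hx
    have h := mul_mem_homog (low_zero_mem u) (ih hj)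
    have hd : (1 : ℤ) + (n + 2) = (n + 1 : ℕ) + 2 := by push_cast; ring
    rwa [hd] at h

theorem low_zero_mul_low (u : BOne A) (k : ℕ) (φ : Low (BOne A) (k + 1)) :
    Univ.low (BOne A) 0 u * Univ.low (BOne A) (k + 1) φ =
      Univ.low (BOne A) k (Low.app (BOne A) k φ u) := by
  rw [Univ.low_br (BOne A) 0 k u φ, Low.br]
  rfl

/-- The elements of degree zero of the BKM superalgebra preserve `quadPart`. -/
theorem low_one_mul_mem_quadPart {b : BKM A} (hb : b ∈ BKM.deg A 0) (n : ℕ) :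
    ∀ {j : Univ (BOne A)}, j ∈ quadPart A n →
      Univ.low (BOne A) 1 (adLow A 1 b) * j ∈ quadPart A n := by
  have hz : Univ.low (BOne A) 1 (adLow A 1 b) ∈ Univ.deg (BOne A) 0 := by
    simpa using Univ.low_mem (BOne A) 1 (adLow A 1 b)
  induction n with
  | zero =>
    intro j hj
    exact low_mul_mem_Cplus (k := 1) (p := 2) (q := 2) (by norm_num) (by norm_num) (by norm_num)
      (by simpa using hb) hj
  | succ n ih =>
    intro j hj
    refine quadPart_induction (f := LinearMap.mulLeft ℂ (Univ.low (BOne A) 1 (adLow A 1 b)))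
      (fun u j hj => ?_) hj
    rw [LinearMap.mulLeft_apply, jacobi hz (low_zero_mem u) (quadPart_le_deg n hj),
      skew hz (low_zero_mem u), low_zero_mul_low u 0, neg_mul, smul_mul_assoc]
    exact add_mem (neg_mem (Submodule.smul_mem _ _ (low_zero_mul_mem_quadPart _ hj)))
      (Submodule.smul_mem _ _ (low_zero_mul_mem_quadPart u (ih hj)))

/-- An element of degree `-1` that annihilates `Cplus A 2`, and maps the degree one to elements of
the BKM superalgebra, preserves `quadIdeal`. -/
theorem low_two_mul_mem_quadPart {φ : Low (BOne A) 2}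
    (h0 : ∀ c ∈ Cplus A 2, Univ.low (BOne A) 2 φ * c = 0)
    (h1 : ∀ u, ∃ b ∈ BKM.deg A 0, Low.app (BOne A) 1 φ u = adLow A 1 b) (n : ℕ) :
    ∀ {j : Univ (BOne A)}, j ∈ quadPart A (n + 1) → Univ.low (BOne A) 2 φ * j ∈ quadPart A n := by
  have hz : Univ.low (BOne A) 2 φ ∈ Univ.deg (BOne A) (-1) := Univ.low_mem (BOne A) 2 φ
  have step : ∀ n u, ∀ j ∈ quadPart A n, Univ.low (BOne A) 0 u * (Univ.low (BOne A) 2 φ * j) ∈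
      quadPart A n → Univ.low (BOne A) 2 φ * (Univ.low (BOne A) 0 u * j) ∈ quadPart A n := by
    intro n u j hj hj'
    obtain ⟨b, hb, hub⟩ := h1 u
    rw [jacobi hz (low_zero_mem u) (quadPart_le_deg n hj),
      skew hz (low_zero_mem u), low_zero_mul_low u 1, hub, neg_mul, smul_mul_assoc]
    exact add_mem (neg_mem (Submodule.smul_mem _ _ (low_one_mul_mem_quadPart hb n hj)))
      (Submodule.smul_mem _ _ hj')
  induction n with
  | zero =>
    intro j hj
    refine quadPart_induction (f := LinearMap.mulLeft ℂ (Univ.low (BOne A) 2 φ))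
      (fun u j hj => ?_) hj
    refine step 0 u j hj ?_
    rw [h0 j hj, mul_zero]
    exact zero_mem _
  | succ n ih =>
    intro j hj
    refine quadPart_induction (f := LinearMap.mulLeft ℂ (Univ.low (BOne A) 2 φ))
      (fun u j hj => ?_) hj
    exact step (n + 1) u j hj (low_zero_mul_mem_quadPart u (ih hj))

variable (A) in
/-- The elements of degree `p` that preserve `quadIdeal`. -/
def quadStab (p : ℤ) : Submodule ℂ (Univ (BOne A)) :=
  Univ.deg (BOne A) p ⊓
    ⨅ j : quadIdeal A, (quadIdeal A).comap (LinearMap.mulRight ℂ (j : Univ (BOne A)))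

theorem mem_quadStab_iff {p : ℤ} {x : Univ (BOne A)} :
    x ∈ quadStab A p ↔ x ∈ Univ.deg (BOne A) p ∧ ∀ j ∈ quadIdeal A, x * j ∈ quadIdeal A := by
  simp [quadStab, Submodule.mem_iInf]

theorem mem_quadStab_of {p : ℤ} {x : Univ (BOne A)} (hx : x ∈ Univ.deg (BOne A) p)
    (h : ∀ n, ∀ j ∈ quadPart A n, x * j ∈ quadIdeal A) : x ∈ quadStab A p := by
  have hle : quadIdeal A ≤ (quadIdeal A).comap (LinearMap.mulLeft ℂ x) :=
    iSup_le fun n j hj => h n j hj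
  exact mem_quadStab_iff.2 ⟨hx, fun j hj => hle hj⟩

theorem mul_mem_quadStab {p q : ℤ} {x y : Univ (BOne A)} (hx : x ∈ quadStab A p)
    (hy : y ∈ quadStab A q) : x * y ∈ quadStab A (p + q) := by
  rw [mem_quadStab_iff] at hx hy
  refine mem_quadStab_of (mul_mem_homog hx.1 hy.1) fun n j hj => ?_
  have hj' := quadPart_le_quadIdeal n hj
  rw [eq_sub_of_add_eq (jacobi hx.1 hy.1 (quadPart_le_deg n hj)).symm]
  exact sub_mem (hx.2 _ (hy.2 _ hj')) (Submodule.smul_mem _ _ (hy.2 _ (hx.2 _ hj')))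

theorem mul_mem_quadIdeal_right {p : ℤ} {x j : Univ (BOne A)} (hx : x ∈ quadStab A p)
    (hj : j ∈ quadIdeal A) : j * x ∈ quadIdeal A := by
  rw [mem_quadStab_iff] at hx
  have hle : quadIdeal A ≤ (quadIdeal A).comap (LinearMap.mulRight ℂ x) :=
    iSup_le fun n j hj => mul_mem_swap (Univ.isLieSuper _) (quadPart_le_deg n hj) hx.1
      (hx.2 _ (quadPart_le_quadIdeal n hj))
  exact hle hj

theorem low_zero_mem_quadStab (u : BOne A) : Univ.low (BOne A) 0 u ∈ quadStab A 1 :=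
  mem_quadStab_of (low_zero_mem u) fun n _ hj =>
    quadPart_le_quadIdeal (n + 1) (low_zero_mul_mem_quadPart u hj)

theorem low_two_mem_quadStab {φ : Low (BOne A) 2}
    (h0 : ∀ c ∈ Cplus A 2, Univ.low (BOne A) 2 φ * c = 0)
    (h1 : ∀ u, ∃ b ∈ BKM.deg A 0, Low.app (BOne A) 1 φ u = adLow A 1 b) :
    Univ.low (BOne A) 2 φ ∈ quadStab A (-1) := by
  refine mem_quadStab_of (Univ.low_mem (BOne A) 2 φ) fun n j hj => ?_
  cases n with
  | zero => rw [h0 j hj]; exact zero_mem _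
  | succ n => exact quadPart_le_quadIdeal n (low_two_mul_mem_quadPart h0 h1 n hj)

/-- The elements of degree `1`, `0` and `-1` of the BKM superalgebra preserve `quadIdeal`. -/
theorem low_adLow_mem_quadStab {k : ℕ} (hk : k ≤ 2) {b : BKM A} (hb : b ∈ BKM.deg A (1 - k)) :
    Univ.low (BOne A) k (adLow A k b) ∈ quadStab A (1 - k) := by
  match k, hk with
  | 0, _ =>
    rw [Nat.cast_zero, sub_zero]
    exact low_zero_mem_quadStab (adLow A 0 b)
  | 1, _ =>
    have hb' : b ∈ BKM.deg A 0 := by simpa using hb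
    have h := Univ.low_mem (BOne A) 1 (adLow A 1 b)
    exact mem_quadStab_of h fun n j hj =>
      quadPart_le_quadIdeal n (low_one_mul_mem_quadPart hb' n hj)
  | 2, _ =>
    have hb' : b ∈ BKM.deg A (-1) := hb
    have hdeg : (1 - ((2 : ℕ) : ℤ)) = -1 := by norm_num
    rw [hdeg]
    refine low_two_mem_quadStab (fun c hc => ?_) fun u =>
      ⟨((u : BKM.deg A 1) : BKM A) * b, ?_, app_adLow 1 b u⟩
    · have h := low_mul_mem_Cplus (k := 2) (p := 2) (q := 1) (by norm_num) le_rfl (by norm_num) hb hc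
      rwa [Cplus_one, Submodule.mem_bot] at h
    · have h := mul_mem_homog (u : BKM.deg A 1).2 hb'
      rwa [add_neg_cancel] at h

/-! ### The positive part of the BKM superalgebra is quadratic -/

variable (A) in
/-- The diagonal values of words in the Chevalley generators: in the BKM superalgebra, and in the
universal graded Lie superalgebra, where the generators act on the degree one. -/
def chevPair : Words (ChevGen r) →ₙₐ[ℂ] BKM A × Univ (BOne A) :=
  FreeNonUnitalNonAssocAlgebra.lift ℂ fun z =>
    pairLow A (1 - chevDeg r z).toNat (gn (chevDeg r) (BKMRel A) z)

theorem chevDeg_le (z : ChevGen r) : chevDeg r z ≤ 1 ∧ (1 - chevDeg r z).toNat ≤ 2 := by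
  cases z <;> simp only [chevDeg] <;> split_ifs <;> decide

theorem gn_mem_deg (z : ChevGen r) :
    gn (chevDeg r) (BKMRel A) z ∈ BKM.deg A (1 - ((1 - chevDeg r z).toNat : ℤ)) := by
  have h : (1 - ((1 - chevDeg r z).toNat : ℤ)) = chevDeg r z := by
    have := (chevDeg_le z).1
    omega
  rw [h]
  exact gn_mem z

theorem chevPair_mem {d : ℤ} {w : Words (ChevGen r)} (hw : w ∈ wordsOfDeg (chevDeg r) d) :
    chevPair A w ∈ graphPart A d := by
  refine map_mem_extendLocal pair_isLieSuper pair_isLocalPart (chevPair A) (fun z => ?_) hw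
  rw [chevPair, lift_gen, extendLocal_of_le_one pair_isLocalPart (chevDeg_le z).1]
  exact ⟨_, gn_mem_deg z, rfl⟩

theorem chevPair_fst (w : Words (ChevGen r)) : (chevPair A w).1 = cls (chevDeg r) (BKMRel A) w := by
  have h : LinearMap.fst ℂ (BKM A) (Univ (BOne A)) ∘ₗ
      (chevPair A : Words (ChevGen r) →ₗ[ℂ] BKM A × Univ (BOne A)) =
        cls (chevDeg r) (BKMRel A) := by
    refine words_ext fun m => ?_
    change (chevPair A (mono m)).1 = _
    induction m with
    | ih1 z =>
      change (chevPair A (gen z)).1 = cls _ _ (gen z)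
      rw [chevPair, lift_gen]
      rfl
    | ih2 a b ha hb => rw [mono_mul, map_mul, Prod.fst_mul, ha, hb, cls_mul]
  exact LinearMap.congr_fun h w

theorem chevPair_snd_mem_quadStab (m : FreeMagma (ChevGen r)) :
    (chevPair A (mono m)).2 ∈ quadStab A (monoDeg (chevDeg r) m) := by
  induction m with
  | ih1 z =>
    have h : (1 - ((1 - chevDeg r z).toNat : ℤ)) = chevDeg r z := by
      have := (chevDeg_le z).1
      omega
    change (chevPair A (gen z)).2 ∈ quadStab A (chevDeg r z)
    rw [chevPair, lift_gen]
    have h' := low_adLow_mem_quadStab (chevDeg_le z).2 (gn_mem_deg (A := A) z)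
    rwa [h] at h'
  | ih2 a b ha hb =>
    rw [mono_mul, map_mul]
    exact mul_mem_quadStab ha hb

variable (A) in
/-- The second component of `chevPair`. -/
def chevUniv : Words (ChevGen r) →ₗ[ℂ] Univ (BOne A) :=
  LinearMap.snd ℂ (BKM A) (Univ (BOne A)) ∘ₗ
    (chevPair A : Words (ChevGen r) →ₗ[ℂ] BKM A × Univ (BOne A))

theorem chevUniv_mul (a b : Words (ChevGen r)) : chevUniv A (a * b) = chevUniv A a * chevUniv A b :=
  congrArg Prod.snd (map_mul (chevPair A) a b)

theorem chevUniv_mono_mem (m : FreeMagma (ChevGen r)) :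
    chevUniv A (mono m) ∈ quadStab A (monoDeg (chevDeg r) m) :=
  chevPair_snd_mem_quadStab m

theorem chevUniv_lieRel {w : Words (ChevGen r)} (hw : LieRel (chevDeg r) w) : chevUniv A w = 0 := by
  have hd : ∀ m : FreeMagma (ChevGen r),
      chevUniv A (mono m) ∈ Univ.deg (BOne A) (monoDeg (chevDeg r) m) :=
    fun m => (mem_quadStab_iff.1 (chevUniv_mono_mem m)).1
  cases hw with
  | skew a b =>
    rw [map_add, map_smul, chevUniv_mul, chevUniv_mul, skew (hd a) (hd b), neg_add_cancel]
  | jacobi a b c =>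
    simp only [map_sub, map_smul, chevUniv_mul]
    rw [jacobi (hd a) (hd b) (hd c), sub_sub, sub_self]

theorem chevUniv_mem_graphPart {w : Words (ChevGen r)} {d : ℤ} (hd : w ∈ wordsOfDeg (chevDeg r) d)
    (h : cls (chevDeg r) (BKMRel A) w = 0) : ((0 : BKM A), chevUniv A w) ∈ graphPart A d := by
  have e : chevPair A w = (0, chevUniv A w) := Prod.ext ((chevPair_fst w).trans h) rfl
  rw [← e]
  exact chevPair_mem hd

theorem chevUniv_bkmRel {w : Words (ChevGen r)} (hw : BKMRel A w) :
    chevUniv A w ∈ quadIdeal A := by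
  rcases hw.homogeneous_or with ⟨d, hd, hwd⟩ | h
  · have h := graphPart_of_le_one hd (chevUniv_mem_graphPart hwd (cls_rel hw))
    have h' : chevUniv A w = 0 := by rwa [map_zero, map_zero] at h
    rw [h']
    exact zero_mem _
  · have hwd : w ∈ wordsOfDeg (chevDeg r) ((2 : ℕ) : ℤ) := by
      have he := eW_mem (r := r) 0
      rw [if_pos rfl] at he
      have h2 : ((2 : ℕ) : ℤ) = 1 + 1 := by norm_num
      rw [h, h2]
      exact mul_mem_wordsOfDeg he he
    have h2 : chevUniv A w ∈ Cplus A 2 :=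
      (mem_Cplus_iff (by norm_num)).2 (chevUniv_mem_graphPart hwd (cls_rel hw))
    exact quadPart_le_quadIdeal 0 h2

theorem mul_mem_comap_chevUniv (a b : Words (ChevGen r)) (hb : chevUniv A b ∈ quadIdeal A) :
    chevUniv A (a * b) ∈ quadIdeal A ∧ chevUniv A (b * a) ∈ quadIdeal A := by
  have ha : a ∈ Submodule.span ℂ (Set.range (mono : FreeMagma (ChevGen r) → _)) :=
    span_mono ▸ Submodule.mem_top
  rw [chevUniv_mul, chevUniv_mul]
  induction ha using Submodule.span_induction with
  | mem a ha =>
    obtain ⟨m, rfl⟩ := ha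
    exact ⟨(mem_quadStab_iff.1 (chevUniv_mono_mem m)).2 _ hb,
      mul_mem_quadIdeal_right (chevUniv_mono_mem m) hb⟩
  | zero => rw [map_zero, zero_mul, mul_zero]; exact ⟨zero_mem _, zero_mem _⟩
  | add x y _ _ hx hy =>
    rw [map_add, add_mul, mul_add]; exact ⟨add_mem hx.1 hy.1, add_mem hx.2 hy.2⟩
  | smul c x _ hx =>
    rw [map_smul, smul_mul_assoc, mul_smul_comm]
    exact ⟨Submodule.smul_mem _ _ hx.1, Submodule.smul_mem _ _ hx.2⟩

/-- Words that vanish in the BKM superalgebra take values in `quadIdeal`: this holds for the defining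
relations, of which only `⟦e₀, e₀⟧` has degree greater than one. -/
theorem chevUniv_mem_quadIdeal {w : Words (ChevGen r)}
    (hw : w ∈ relIdeal (chevDeg r) (BKMRel A)) : chevUniv A w ∈ quadIdeal A := by
  have hle : relIdeal (chevDeg r) (BKMRel A) ≤ (quadIdeal A).comap (chevUniv A) := by
    refine relIdeal_le (fun w hw => ?_) (fun w hw => chevUniv_bkmRel hw) fun a b hb =>
      mul_mem_comap_chevUniv a b hb
    rw [Submodule.mem_comap, chevUniv_lieRel hw]
    exact zero_mem _
  exact hle hw

/-- The kernel of the projection from the free Lie superalgebra to the BKM superalgebra is generated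
by its part of degree two. -/
theorem Cplus_le_quadIdeal (p : ℕ) : Cplus A p ≤ quadIdeal A := by
  rintro _ ⟨w, ⟨_, h0⟩, rfl⟩
  -- Replace the letters, which are elements of degree one, by words in the Chevalley generators.
  have hlift : ∀ u : BOne A, ∃ t ∈ wordsOfDeg (chevDeg r) 1,
      cls (chevDeg r) (BKMRel A) t = ((u : BKM.deg A 1) : BKM A) := fun u => (u : BKM.deg A 1).2
  choose t ht htu using hlift
  let T : Words (BOne A) →ₙₐ[ℂ] Words (ChevGen r) := FreeNonUnitalNonAssocAlgebra.lift ℂ t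
  have hT : (chevPair A).comp T = FreeNonUnitalNonAssocAlgebra.lift ℂ (pairOne A) := by
    refine FreeNonUnitalNonAssocAlgebra.hom_ext ℂ fun u => ?_
    change chevPair A (FreeNonUnitalNonAssocAlgebra.lift ℂ t (gen u)) =
      FreeNonUnitalNonAssocAlgebra.lift ℂ (pairOne A) (gen u)
    rw [lift_gen, lift_gen]
    have h1 : (chevPair A (t u)).1 = ((u : BKM.deg A 1) : BKM A) := by rw [chevPair_fst, htu]
    refine Prod.ext h1 ?_
    have h2 : (chevPair A (t u)).2 = _ := graphPart_of_le_one le_rfl (chevPair_mem (A := A) (ht u))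
    rw [h2, h1]
    exact congrArg (Univ.low (BOne A) 0) (adLow_zero u)
  have hTw : chevPair A (T w) = (evalBKM A w, evalUniv A w) := by
    rw [← lift_pairOne, ← hT]
    rfl
  have h1 : T w ∈ relIdeal (chevDeg r) (BKMRel A) := by
    rw [mem_relIdeal_iff, ← chevPair_fst, hTw]
    exact h0
  have h2 := chevUniv_mem_quadIdeal h1
  rwa [show chevUniv A (T w) = evalUniv A w from congrArg Prod.snd hTw] at h2

/-! ### The kernel is contained in the maximal ideal -/

theorem low_zero_mem_cover (u : BOne A) : Univ.low (BOne A) 0 u ∈ THAcover A :=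
  NonUnitalAlgebra.subset_adjoin ℂ (Or.inl ⟨u, rfl⟩)

theorem evalUniv_mem_cover (w : Words (BOne A)) : evalUniv A w ∈ THAcover A := by
  have hw : w ∈ Submodule.span ℂ (Set.range (mono : FreeMagma (BOne A) → _)) :=
    span_mono ▸ Submodule.mem_top
  induction hw using Submodule.span_induction with
  | mem w hw =>
    obtain ⟨m, rfl⟩ := hw
    induction m with
    | ih1 u =>
      change evalUniv A (gen u) ∈ _
      rw [evalUniv, lift_gen]
      exact low_zero_mem_cover u
    | ih2 a b ha hb => rw [mono_mul, map_mul]; exact mul_mem ha hb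
  | zero => rw [map_zero]; exact zero_mem _
  | add x y _ _ hx hy => rw [map_add]; exact add_mem hx hy
  | smul c x _ hx => rw [map_smul]; exact (THAcover A).toSubmodule.smul_mem c hx

theorem quadPart_le_cover (n : ℕ) : quadPart A n ≤ (THAcover A).toSubmodule := by
  induction n with
  | zero =>
    rintro _ ⟨w, -, rfl⟩
    exact evalUniv_mem_cover w
  | succ n ih =>
    refine Submodule.span_le.2 ?_
    rintro _ ⟨u, j, hj, rfl⟩
    exact (THAcover A).mul_mem (low_zero_mem_cover u) (ih hj)

/-- An element of an admissible subspace annihilates the kernel in degree two, for degree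
reasons. -/
theorem IsAdmissible.mul_eq_zero {M : Submodule ℂ (Low (BOne A) 2)} (hM : IsAdmissible A M)
    {φ : Low (BOne A) 2} (hφ : φ ∈ M) {c : Univ (BOne A)} (hc : c ∈ Cplus A 2) :
    Univ.low (BOne A) 2 φ * c = 0 := by
  have hD := (Dplus_isGreatest (genSub (BOne A) M)).1
  have hmem : Univ.low (BOne A) 2 φ ∈ genSub (BOne A) M :=
    NonUnitalAlgebra.subset_adjoin ℂ (Or.inr ⟨φ, hφ, rfl⟩)
  have h1 : Univ.low (BOne A) 2 φ * c ∈ Dplus (genSub (BOne A) M) :=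
    (hD.ideal _ hmem c (hM.susy hc)).1
  have h2 := mul_mem_homog (Univ.low_mem (BOne A) 2 φ) (Cplus_le_deg hc)
  refine eq_zero_of_mem_iSup_homog UnivRel.homogeneous h2 (s := fun q => 2 ≤ q) (by norm_num) ?_
  have hle : (⨆ p : {p : ℤ // 2 ≤ p}, (genSub (BOne A) M).toSubmodule ⊓ Univ.deg (BOne A) p) ≤
      ⨆ p : {p : ℤ // 2 ≤ p}, Univ.deg (BOne A) p := iSup_mono fun p => inf_le_right
  exact hle (hD.above h1)

theorem TMinusOne_le_of {S : Submodule ℂ (Low (BOne A) 2)}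
    (h : ∀ M, IsAdmissible A M → ∀ φ ∈ M, φ ∈ S) : TMinusOne A ≤ S :=
  sSup_le fun M hM φ hφ => h M hM φ hφ

theorem low_two_mem_quadStab_of_mem {φ : Low (BOne A) 2} (hφ : φ ∈ TMinusOne A) :
    Univ.low (BOne A) 2 φ ∈ quadStab A (-1) := by
  have hle : TMinusOne A ≤ (quadStab A (-1)).comap (Univ.low (BOne A) 2) := by
    refine TMinusOne_le_of fun M hM φ hφ => ?_
    refine low_two_mem_quadStab (fun c hc => hM.mul_eq_zero hφ hc) fun u => ?_
    have hu : Low.app (BOne A) 1 φ u ∈ LinearMap.range (adStar A) := by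
      rw [← hM.span_eq]
      exact Submodule.subset_span ⟨φ, hφ, u, rfl⟩
    obtain ⟨z, hz⟩ := hu
    exact ⟨z, gSub_le A z.2, by rw [adLow_one, hz]⟩
  exact hle hφ

theorem cover_le_iSup_quadStab {v : Univ (BOne A)} (hv : v ∈ THAcover A) :
    v ∈ ⨆ p, quadStab A p := by
  induction hv using NonUnitalAlgebra.adjoin_induction with
  | mem x hx =>
    rcases hx with ⟨u, rfl⟩ | ⟨φ, hφ, rfl⟩
    · exact Submodule.mem_iSup_of_mem 1 (low_zero_mem_quadStab u)
    · exact Submodule.mem_iSup_of_mem (-1) (low_two_mem_quadStab_of_mem hφ)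
  | zero => exact zero_mem _
  | add x y _ _ hx hy => exact add_mem hx hy
  | smul c x _ hx => exact Submodule.smul_mem _ c hx
  | mul x y hx' hy' hx hy =>
    clear hx' hy'
    induction hx using Submodule.iSup_induction' with
    | mem p x hx =>
      induction hy using Submodule.iSup_induction' with
      | mem q y hy => exact Submodule.mem_iSup_of_mem (p + q) (mul_mem_quadStab hx hy)
      | zero => rw [mul_zero]; exact zero_mem _
      | add y z _ _ hy hz => rw [mul_add]; exact add_mem hy hz
    | zero => rw [zero_mul]; exact zero_mem _
    | add x z _ _ hx hz => rw [add_mul]; exact add_mem hx hz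

theorem quadIdeal_isIdealAboveTwo : IsIdealAboveTwo (THAcover A) (quadIdeal A) where
  le := iSup_le quadPart_le_cover
  ideal v hv j hj := by
    have hv' := cover_le_iSup_quadStab hv
    clear hv
    induction hv' using Submodule.iSup_induction' with
    | mem p x hx => exact ⟨(mem_quadStab_iff.1 hx).2 j hj, mul_mem_quadIdeal_right hx hj⟩
    | zero => rw [zero_mul, mul_zero]; exact ⟨zero_mem _, zero_mem _⟩
    | add x y _ _ hx hy =>
      rw [add_mul, mul_add]; exact ⟨add_mem hx.1 hy.1, add_mem hx.2 hy.2⟩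
  graded := iSup_le fun n j hj =>
    Submodule.mem_iSup_of_mem (n + 2) ⟨quadPart_le_quadIdeal n hj, quadPart_le_deg n hj⟩
  above := iSup_le fun n j hj =>
    Submodule.mem_iSup_of_mem ⟨n + 2, by omega⟩ ⟨quadPart_le_cover n hj, quadPart_le_deg n hj⟩

theorem Cplus_le_Dplus (p : ℕ) : Cplus A p ≤ Dplus (THAcover A) :=
  (Cplus_le_quadIdeal p).trans ((Dplus_isGreatest _).2 quadIdeal_isIdealAboveTwo)

end QuadraticIdeal

/-! ### The adjoint action of `𝔤` on the BKM superalgebra -/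

section Derivation

variable {X : Type} {deg : X → ℤ} {R : Words X → Prop}

/-- Elements of degree zero act by derivations. -/
theorem mul_mul_of_mem_zero {x : Presented deg R} (hx : x ∈ homog deg R 0) (b c : Presented deg R) :
    x * (b * c) = (x * b) * c + b * (x * c) := by
  have hb : b ∈ ⨆ p, homog deg R p := iSup_homog (deg := deg) (R := R) ▸ Submodule.mem_top
  have hc : c ∈ ⨆ p, homog deg R p := iSup_homog (deg := deg) (R := R) ▸ Submodule.mem_top
  induction hb using Submodule.iSup_induction' with
  | mem p b hb =>
    induction hc using Submodule.iSup_induction' with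
    | mem q c hc => rw [jacobi hx hb hc, sgn_zero_left, one_smul]
    | zero => simp
    | add c d _ _ hc hd => simp only [mul_add, hc, hd]; abel
  | zero => simp
  | add b d _ _ hb hd => simp only [mul_add, add_mul, hb, hd]; abel

theorem skew_of_mem_zero {x y : Presented deg R} (hx : x ∈ homog deg R 0) {p : ℤ}
    (hy : y ∈ homog deg R p) : y * x = -(x * y) := by
  rw [skew hx hy, sgn_zero_left, one_smul, neg_neg]

theorem mul_self_of_mem_zero {x : Presented deg R} (hx : x ∈ homog deg R 0) : x * x = 0 := by
  have h := skew_of_mem_zero hx hx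
  have h2 : (2 : ℂ) • (x * x) = 0 := by rw [two_smul]; exact eq_neg_iff_add_eq_zero.1 h
  exact (smul_eq_zero.1 h2).resolve_left two_ne_zero

/-- A derivation that acts nilpotently on two elements acts nilpotently on their product, by the
Leibniz rule. -/
theorem mulLeft_pow_mul {x : Presented deg R} (hx : x ∈ homog deg R 0) (s : ℕ) :
    ∀ {n m : ℕ} {b c : Presented deg R}, n + m = s → (LinearMap.mulLeft ℂ x ^ n) b = 0 →
      (LinearMap.mulLeft ℂ x ^ m) c = 0 → (LinearMap.mulLeft ℂ x ^ s) (b * c) = 0 := by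
  induction s with
  | zero =>
    intro n m b c hs hb hc
    obtain rfl : n = 0 := by omega
    have hb' : b = 0 := hb
    rw [hb', zero_mul, map_zero]
  | succ s ih =>
    intro n m b c hs hb hc
    rcases n with _ | n
    · have hb' : b = 0 := hb
      rw [hb', zero_mul, map_zero]
    rcases m with _ | m
    · have hc' : c = 0 := hc
      rw [hc', mul_zero, map_zero]
    rw [pow_succ, Module.End.mul_apply, LinearMap.mulLeft_apply, mul_mul_of_mem_zero hx, map_add]
    rw [ih (n := n) (m := m + 1) (by omega) (by rwa [pow_succ, Module.End.mul_apply] at hb) hc,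
      ih (n := n + 1) (m := m) (by omega) hb (by rwa [pow_succ, Module.End.mul_apply] at hc),
      add_zero]

/-- A generator `e` of an `sl₂`-triple acts nilpotently on the other generator `f`. -/
theorem mulLeft_pow_three_eq_zero {x y : Presented deg R} (hx : x ∈ homog deg R 0)
    (hh : x * y ∈ homog deg R 0) {c : ℂ} (h : (x * y) * x = c • x) :
    (LinearMap.mulLeft ℂ x ^ 3) y = 0 := by
  rw [pow_succ, pow_succ, pow_one, Module.End.mul_apply, Module.End.mul_apply,
    LinearMap.mulLeft_apply, LinearMap.mulLeft_apply, LinearMap.mulLeft_apply,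
    skew_of_mem_zero hh hx, h, mul_neg, mul_smul_comm, mul_self_of_mem_zero hx, smul_zero, neg_zero]

/-- A derivation that acts nilpotently on generators acts locally nilpotently. -/
theorem isLocNil_mulLeft {x : Presented deg R} (hx : x ∈ homog deg R 0)
    (h : ∀ z, ∃ n, (LinearMap.mulLeft ℂ x ^ n) (gn deg R z) = 0) :
    IsLocNil (LinearMap.mulLeft ℂ x) := by
  intro b
  obtain ⟨w, rfl⟩ : ∃ w, cls deg R w = b := (relIdeal deg R).mkQ_surjective b
  have hw : w ∈ Submodule.span ℂ (Set.range (mono : FreeMagma X → Words X)) :=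
    span_mono ▸ Submodule.mem_top
  induction hw using Submodule.span_induction with
  | mem a ha =>
    obtain ⟨m, rfl⟩ := ha
    induction m with
    | ih1 z => exact h z
    | ih2 a b ha hb =>
      obtain ⟨n, hn⟩ := ha
      obtain ⟨m, hm⟩ := hb
      refine ⟨n + m, ?_⟩
      change (LinearMap.mulLeft ℂ x ^ (n + m)) (cls deg R (mono (a * b))) = 0
      rw [mono_mul, cls_mul]
      exact mulLeft_pow_mul hx _ rfl hn hm
  | zero => exact ⟨0, by rw [map_zero, map_zero]⟩
  | add a b _ _ ha hb =>
    obtain ⟨n, hn⟩ := ha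
    obtain ⟨m, hm⟩ := hb
    refine ⟨max n m, ?_⟩
    rw [map_add, map_add, pow_apply_eq_zero_of_le hn (le_max_left _ _),
      pow_apply_eq_zero_of_le hm (le_max_right _ _), add_zero]
  | smul c a _ ha =>
    obtain ⟨n, hn⟩ := ha
    exact ⟨n, by rw [map_smul, map_smul, hn, smul_zero]⟩

end Derivation

section Adjoint

variable {r : ℕ} {A : Matrix (Fin (r + 1)) (Fin (r + 1)) ℤ}

variable (A) in
/-- The generator `e I` of the BKM superalgebra. -/
abbrev eB (I : Fin (r + 1)) : BKM A := gn (chevDeg r) (BKMRel A) (.e I)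

variable (A) in
/-- The generator `f I` of the BKM superalgebra. -/
abbrev fB (I : Fin (r + 1)) : BKM A := gn (chevDeg r) (BKMRel A) (.f I)

theorem hB_mul_eB (I J : Fin (r + 1)) : (eB A I * fB A I) * eB A J = (A I J : ℂ) • eB A J := by
  have h := cls_rel (deg := chevDeg r) (BKMRel.he (A := A) I J)
  rw [map_sub, map_smul, sub_eq_zero] at h
  exact h

theorem hB_mul_fB (I J : Fin (r + 1)) : (eB A I * fB A I) * fB A J = -((A I J : ℂ) • fB A J) := by
  have h := cls_rel (deg := chevDeg r) (BKMRel.hf (A := A) I J)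
  rw [map_add, map_smul] at h
  exact eq_neg_of_add_eq_zero_left h

theorem eB_mul_fB {I J : Fin (r + 1)} (hIJ : I ≠ J) : eB A I * fB A J = 0 :=
  cls_rel (deg := chevDeg r) (BKMRel.ef (A := A) I J hIJ)

theorem cls_iterate {X : Type} {deg : X → ℤ} {R : Words X → Prop} (a b : Words X) (n : ℕ) :
    cls deg R ((fun w => a * w)^[n] b) = (LinearMap.mulLeft ℂ (cls deg R a) ^ n) (cls deg R b) := by
  induction n with
  | zero => rfl
  | succ n ih =>
    rw [Function.iterate_succ_apply', pow_succ', Module.End.mul_apply, ← ih, cls_mul]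
    rfl

theorem serre_eB {i : Fin r} {J : Fin (r + 1)} (h : J ≠ i.succ) :
    (LinearMap.mulLeft ℂ (eB A i.succ) ^ (1 - A i.succ J).toNat) (eB A J) = 0 := by
  have h := cls_rel (deg := chevDeg r) (BKMRel.serreE (A := A) i J h)
  rw [cls_iterate] at h
  exact h

theorem serre_fB {i : Fin r} {J : Fin (r + 1)} (h : J ≠ i.succ) :
    (LinearMap.mulLeft ℂ (fB A i.succ) ^ (1 - A i.succ J).toNat) (fB A J) = 0 := by
  have h := cls_rel (deg := chevDeg r) (BKMRel.serreF (A := A) i J h)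
  rw [cls_iterate] at h
  exact h

theorem eB_mem_gSub (i : Fin r) : eB A i.succ ∈ gSub A :=
  NonUnitalAlgebra.subset_adjoin ℂ ⟨i, .inl rfl⟩

theorem fB_mem_gSub (i : Fin r) : fB A i.succ ∈ gSub A :=
  NonUnitalAlgebra.subset_adjoin ℂ ⟨i, .inr rfl⟩

theorem isLocNil_eB (i : Fin r) : IsLocNil (LinearMap.mulLeft ℂ (eB A i.succ)) := by
  have he : eB A i.succ ∈ BKM.deg A 0 := gSub_le A (eB_mem_gSub i)
  have hh : eB A i.succ * fB A i.succ ∈ BKM.deg A 0 :=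
    gSub_le A (mul_mem (eB_mem_gSub i) (fB_mem_gSub i))
  refine isLocNil_mulLeft he fun z => ?_
  cases z with
  | e J =>
    by_cases hJ : J = i.succ
    · refine ⟨1, ?_⟩
      rw [hJ, pow_one, LinearMap.mulLeft_apply, mul_self_of_mem_zero he]
    · exact ⟨_, serre_eB hJ⟩
  | f J =>
    by_cases hJ : J = i.succ
    · refine ⟨3, ?_⟩
      rw [hJ]
      exact mulLeft_pow_three_eq_zero he hh (hB_mul_eB _ _)
    · refine ⟨1, ?_⟩
      rw [pow_one, LinearMap.mulLeft_apply]
      exact eB_mul_fB (Ne.symm hJ)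

theorem isLocNil_fB (i : Fin r) : IsLocNil (LinearMap.mulLeft ℂ (fB A i.succ)) := by
  have he : eB A i.succ ∈ BKM.deg A 0 := gSub_le A (eB_mem_gSub i)
  have hf : fB A i.succ ∈ BKM.deg A 0 := gSub_le A (fB_mem_gSub i)
  have hh : fB A i.succ * eB A i.succ ∈ BKM.deg A 0 :=
    gSub_le A (mul_mem (fB_mem_gSub i) (eB_mem_gSub i))
  refine isLocNil_mulLeft hf fun z => ?_
  cases z with
  | e J =>
    by_cases hJ : J = i.succ
    · refine ⟨3, ?_⟩
      rw [hJ]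
      refine mulLeft_pow_three_eq_zero hf hh (c := (A i.succ i.succ : ℂ)) ?_
      rw [skew_of_mem_zero he hf, neg_mul, hB_mul_fB, neg_neg]
    · refine ⟨1, ?_⟩
      have h := skew_of_mem_zero hf (gn_mem (R := BKMRel A) (.e J))
      rw [pow_one, LinearMap.mulLeft_apply, ← neg_eq_zero, ← h]
      exact eB_mul_fB hJ
  | f J =>
    by_cases hJ : J = i.succ
    · refine ⟨1, ?_⟩
      rw [hJ, pow_one, LinearMap.mulLeft_apply, mul_self_of_mem_zero hf]
    · exact ⟨_, serre_fB hJ⟩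

/-- The action of `𝔤` on the BKM superalgebra by supercommutators. -/
instance gSub.lieRingModule : LieRingModule (gSub A) (BKM A) where
  bracket z b := (z : BKM A) * b
  add_lie z w b := add_mul (z : BKM A) w b
  lie_add z b c := mul_add (z : BKM A) b c
  leibniz_lie z w b := mul_mul_of_mem_zero (gSub_le A z.2) w b

instance gSub.lieModule : LieModule ℂ (gSub A) (BKM A) where
  smul_lie c z b := smul_mul_assoc c (z : BKM A) b
  lie_smul c z b := mul_smul_comm c (z : BKM A) b

theorem coe_ad_pow (z w : gSub A) (n : ℕ) :
    (((LieAlgebra.ad ℂ (gSub A) z ^ n) w : gSub A) : BKM A) =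
      (LinearMap.mulLeft ℂ (z : BKM A) ^ n) (w : BKM A) := by
  induction n with
  | zero => rfl
  | succ n ih =>
    rw [pow_succ', pow_succ', Module.End.mul_apply, Module.End.mul_apply, ← ih]
    rfl

theorem mem_locNilSet_of {z : gSub A} (h : IsLocNil (LinearMap.mulLeft ℂ (z : BKM A))) :
    z ∈ locNilSet ℂ (gSub A) (BKM A) := by
  refine ⟨h, fun w => ?_⟩
  obtain ⟨n, hn⟩ := h w
  exact ⟨n, Subtype.ext ((coe_ad_pow z w n).trans hn)⟩

theorem locNilSpan_eq_top : locNilSpan ℂ (gSub A) (BKM A) = ⊤ := by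
  refine eq_top_iff.2 fun z _ => ?_
  obtain ⟨x, hx⟩ := z
  induction hx using NonUnitalAlgebra.adjoin_induction with
  | mem x hx =>
    refine Submodule.subset_span (mem_locNilSet_of ?_)
    obtain ⟨i, rfl | rfl⟩ := hx
    · exact isLocNil_eB i
    · exact isLocNil_fB i
  | zero => exact zero_mem (locNilSpan ℂ (gSub A) (BKM A))
  | add x y _ _ hx hy => exact add_mem (hx trivial) (hy trivial)
  | smul c x _ hx => exact (locNilSpan ℂ (gSub A) (BKM A)).smul_mem c (hx trivial)
  | mul x y _ _ hx hy => exact (locNilSpan ℂ (gSub A) (BKM A)).lie_mem (hx trivial) (hy trivial)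

end Adjoint

/-! ### `𝔤` is a quotient of the Lie algebra of its Cartan matrix -/

section Serre

open CartanMatrix

variable {r : ℕ} {A : Matrix (Fin (r + 1)) (Fin (r + 1)) ℤ}

variable (A) in
/-- The generator `e i` of `𝔤`. -/
def eG (i : Fin r) : gSub A := ⟨eB A i.succ, eB_mem_gSub i⟩

variable (A) in
/-- The generator `f i` of `𝔤`. -/
def fG (i : Fin r) : gSub A := ⟨fB A i.succ, fB_mem_gSub i⟩

theorem lie_hG_eG (i j : Fin r) :
    ⁅⁅eG A i, fG A i⁆, eG A j⁆ = finitePart A i j • eG A j := by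
  rw [← Int.cast_smul_eq_zsmul ℂ]
  exact Subtype.ext (hB_mul_eB i.succ j.succ)

theorem lie_hG_fG (i j : Fin r) :
    ⁅⁅eG A i, fG A i⁆, fG A j⁆ = -(finitePart A i j • fG A j) := by
  rw [← Int.cast_smul_eq_zsmul ℂ]
  exact Subtype.ext (hB_mul_fB i.succ j.succ)

variable (A) in
/-- The values of the Serre generators in `𝔤`. -/
def serreGen : Generators (Fin r) → gSub A
  | .H i => ⁅eG A i, fG A i⁆
  | .E i => eG A i
  | .F i => fG A i

/-- The Serre relations, in the form in which the exponent is `-a` and the first bracket is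
separate. -/
theorem ad_pow_eq_zero {x y : gSub A} {a : ℤ} (hxy : x = y ∨ (a ≤ 0 ∧
    (LinearMap.mulLeft ℂ (x : BKM A) ^ (1 - a).toNat) (y : BKM A) = 0)) :
    (LieAlgebra.ad ℂ (gSub A) x ^ (-a).toNat) ⁅x, y⁆ = 0 := by
  rcases hxy with rfl | ⟨ha, h⟩
  · rw [lie_self, map_zero]
  · refine Subtype.ext ?_
    rw [coe_ad_pow]
    have hn : (1 - a).toNat = (-a).toNat + 1 := by omega
    rw [hn, pow_succ, Module.End.mul_apply] at h
    exact h

theorem toIdeal_le_ker {D : ℕ} (hA : IsExtendedCartan A D) :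
    Relations.toIdeal ℂ (finitePart A) ≤ (FreeLieAlgebra.lift ℂ (serreGen A)).ker := by
  refine LieSubmodule.lieSpan_le.2 ?_
  have hne : ∀ {i j : Fin r}, i ≠ j → j.succ ≠ i.succ := fun h h' => h (Fin.succ_injective _ h').symm
  have hle : ∀ i j : Fin r, i = j ∨ finitePart A i j ≤ 0 := fun i j =>
    or_iff_not_imp_left.2 (hA.nonpos i j)
  rintro _ (((((⟨⟨i, j⟩, rfl⟩ | ⟨⟨i, j⟩, rfl⟩) | ⟨⟨i, j⟩, rfl⟩) | ⟨⟨i, j⟩, rfl⟩) | ⟨⟨i, j⟩, rfl⟩) |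
    ⟨⟨i, j⟩, rfl⟩) <;> rw [SetLike.mem_coe, LieHom.mem_ker]
  · simp only [Relations.HH, Function.uncurry_apply_pair, Function.comp_apply, LieHom.map_lie,
      FreeLieAlgebra.lift_of_apply, serreGen]
    rw [leibniz_lie ⁅eG A i, fG A i⁆, lie_hG_eG, lie_hG_fG, lie_neg, smul_lie, lie_smul,
      add_neg_cancel]
  · simp only [Relations.EF, Function.uncurry_apply_pair, Function.comp_apply]
    split_ifs with hij
    · subst hij
      simp only [map_sub, LieHom.map_lie, FreeLieAlgebra.lift_of_apply, serreGen, sub_self]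
    · simp only [LieHom.map_lie, FreeLieAlgebra.lift_of_apply, serreGen]
      exact Subtype.ext (eB_mul_fB (hne (Ne.symm hij)))
  · simp only [Relations.HE, Function.uncurry_apply_pair, Function.comp_apply, map_sub,
      LieHom.map_lie, map_zsmul, FreeLieAlgebra.lift_of_apply, serreGen]
    rw [lie_hG_eG, sub_self]
  · simp only [Relations.HF, Function.uncurry_apply_pair, Function.comp_apply, map_add,
      LieHom.map_lie, map_zsmul, FreeLieAlgebra.lift_of_apply, serreGen]
    rw [lie_hG_fG, neg_add_cancel]
  · simp only [Relations.adE, Function.uncurry_apply_pair, Function.comp_apply, map_ad_pow,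
      LieHom.map_lie, FreeLieAlgebra.lift_of_apply, serreGen]
    refine ad_pow_eq_zero ((hle i j).imp (congrArg _) fun h => ⟨h, ?_⟩)
    by_cases hij : i = j
    · subst hij
      have := hA.diag i
      omega
    · exact serre_eB (hne hij)
  · simp only [Relations.adF, Function.uncurry_apply_pair, Function.comp_apply, map_ad_pow,
      LieHom.map_lie, FreeLieAlgebra.lift_of_apply, serreGen]
    refine ad_pow_eq_zero ((hle i j).imp (congrArg _) fun h => ⟨h, ?_⟩)
    by_cases hij : i = j
    · subst hij
      have := hA.diag i
      omega
    · exact serre_fB (hne hij)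

/-- The projection to `𝔤` from the Lie algebra of its Cartan matrix. -/
def serreHom {D : ℕ} (hA : IsExtendedCartan A D) : (finitePart A).ToLieAlgebra ℂ →ₗ⁅ℂ⁆ gSub A :=
  { (Relations.toIdeal ℂ (finitePart A)).toSubmodule.liftQ
      ((FreeLieAlgebra.lift ℂ (serreGen A) : FreeLieAlgebra ℂ (Generators (Fin r)) →ₗ⁅ℂ⁆ gSub A) :
        FreeLieAlgebra ℂ (Generators (Fin r)) →ₗ[ℂ] gSub A) fun _ hx => toIdeal_le_ker hA hx with
    map_lie' := by
      intro x y
      obtain ⟨a, rfl⟩ := Submodule.Quotient.mk_surjective _ x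
      obtain ⟨b, rfl⟩ := Submodule.Quotient.mk_surjective _ y
      exact LieHom.map_lie (FreeLieAlgebra.lift ℂ (serreGen A)) a b }

theorem serreHom_surjective {D : ℕ} (hA : IsExtendedCartan A D) :
    Function.Surjective (serreHom hA) := by
  have hgen : ∀ z, ∃ x, serreHom hA x = serreGen A z := fun z =>
    ⟨Submodule.Quotient.mk (FreeLieAlgebra.of ℂ z), FreeLieAlgebra.lift_of_apply _ z⟩
  rintro ⟨x, hx⟩
  induction hx using NonUnitalAlgebra.adjoin_induction with
  | mem x hx =>
    obtain ⟨i, rfl | rfl⟩ := hx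
    · exact hgen (.E i)
    · exact hgen (.F i)
  | zero => exact ⟨0, map_zero _⟩
  | add x y _ _ hx hy =>
    obtain ⟨a, ha⟩ := hx
    obtain ⟨b, hb⟩ := hy
    exact ⟨a + b, by rw [map_add, ha, hb]; rfl⟩
  | smul c x _ hx =>
    obtain ⟨a, ha⟩ := hx
    exact ⟨c • a, by rw [map_smul, ha]; rfl⟩
  | mul x y _ _ hx hy =>
    obtain ⟨a, ha⟩ := hx
    obtain ⟨b, hb⟩ := hy
    exact ⟨⁅a, b⁆, by rw [LieHom.map_lie, ha, hb]; rfl⟩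

/-- The BKM superalgebra is completely reducible under `𝔤`. -/
theorem complementedLattice_bkm {D : ℕ} (hA : IsExtendedCartan A D) :
    ComplementedLattice (LieSubmodule ℂ (gSub A) (BKM A)) := by
  have := hA.finite
  have := hA.simple
  have : FiniteDimensional ℂ (gSub A) :=
    Module.Finite.of_surjective (serreHom hA : (finitePart A).ToLieAlgebra ℂ →ₗ[ℂ] gSub A) (serreHom_surjective hA)
  have hL : IsSimpleOrZero ℂ (gSub A) :=
    (IsSimpleOrZero.of_isSimple (L := (finitePart A).ToLieAlgebra ℂ)).of_surjective (serreHom hA)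
      (serreHom_surjective hA)
  exact hL.complementedLattice (exists_finite_lieSubmodule_of_locNilSpan locNilSpan_eq_top)

end Serre

/-! ### The embedding of the tensor hierarchy algebra in positive degrees -/

section Splitting

variable {K L M : Type*} [CommRing K] [LieRing L] [AddCommGroup M] [Module K M]
  [LieRingModule L M]

/-- The equivariant projection along a Lie submodule that has a complement. -/
theorem exists_equivariant_projection [ComplementedLattice (LieSubmodule K L M)]
    (N : LieSubmodule K L M) :
    ∃ π : M →ₗ[K] M, (∀ m, π m = 0 ↔ m ∈ N) ∧ (∀ m, m - π m ∈ N) ∧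
      ∀ (x : L) m, π ⁅x, m⁆ = ⁅x, π m⁆ := by
  obtain ⟨N', hN'⟩ := exists_isCompl N
  have h := (LieSubmodule.isCompl_toSubmodule.2 hN').symm
  have hsub : ∀ m, m - N'.toSubmodule.projection N.toSubmodule h m ∈ N := fun m => by
    have h1 := Submodule.projection_add_projection_eq_self h m
    have h2 := Submodule.projection_apply_mem h.symm m
    rwa [← eq_sub_iff_add_eq'.2 h1]
  refine ⟨N'.toSubmodule.projection N.toSubmodule h,
    fun m => Submodule.projection_apply_eq_zero_iff h, hsub, fun x m => ?_⟩
  set π := N'.toSubmodule.projection N.toSubmodule h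
  have h1 : π ⁅x, m - π m⁆ = 0 :=
    (Submodule.projection_apply_eq_zero_iff h).2 (N.lie_mem (hsub m))
  have h2 : π ⁅x, π m⁆ = ⁅x, π m⁆ :=
    Submodule.projection_apply_left h ⟨_, N'.lie_mem (Submodule.projection_apply_mem h m)⟩
  rw [lie_sub, map_sub, h2, sub_eq_zero] at h1
  exact h1

end Splitting

section Embedding

variable {r : ℕ} {A : Matrix (Fin (r + 1)) (Fin (r + 1)) ℤ}

/-- The action of `𝔤` on words in elements of degree one. -/
theorem exists_word_action {p : ℕ} (hp : 1 ≤ p) (z : gSub A) {w : Words (BOne A)}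
    (hw : w ∈ oneWords A p) : ∃ w' ∈ oneWords A p, evalBKM A w' = (z : BKM A) * evalBKM A w ∧
      evalUniv A w' = Univ.low (BOne A) 1 (adStar A z) * evalUniv A w := by
  have hp' : (1 : ℤ) ≤ p := by exact_mod_cast hp
  have hz : ((z : BKM A), Univ.low (BOne A) 1 (adLow A 1 (z : BKM A))) ∈ graphPart A (1 - (1 : ℕ)) :=
    pairLow_mem (by rw [Nat.cast_one, sub_self]; exact gSub_le A z.2)
  have h := mul_mem_graphPart hz ((mem_graphPart_iff hp).2 ⟨w, hw, rfl, rfl⟩)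
  rw [Nat.cast_one, sub_self, zero_add, adLow_one] at h
  exact (mem_graphPart_iff hp).1 h

theorem eval_mem {p : ℕ} {w : Words (BOne A)} (hw : w ∈ oneWords A p) :
    evalBKM A w ∈ BKM.deg A p ∧ evalUniv A w ∈ Univ.deg (BOne A) p :=
  wordPart_le pair_isLieSuper pair_isLocalPart p ⟨w, hw, lift_pairOne w⟩

/-- The image in the BKM superalgebra of the part of degree `p` of `D₊`, a `𝔤`-submodule. -/
def dplusImage (hT : ∃ M, IsAdmissible A M) {p : ℕ} (hp : 1 ≤ p) :
    LieSubmodule ℂ (gSub A) (BKM A) :=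
  { (oneWords A p ⊓ (Dplus (THAcover A)).comap
      (evalUniv A : Words (BOne A) →ₗ[ℂ] Univ (BOne A))).map
        (evalBKM A : Words (BOne A) →ₗ[ℂ] BKM A) with
    lie_mem := by
      rintro z _ ⟨w, ⟨hw, hD⟩, rfl⟩
      obtain ⟨w', hw', h1, h2⟩ := exists_word_action hp z hw
      refine ⟨w', ⟨hw', ?_⟩, h1⟩
      change evalUniv A w' ∈ Dplus (THAcover A)
      rw [h2]
      exact ((Dplus_isGreatest (THAcover A)).1.ideal _ (adStar_mem hT z) _ hD).1 }

theorem mem_dplusImage_iff (hT : ∃ M, IsAdmissible A M) {p : ℕ} (hp : 1 ≤ p) {b : BKM A} :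
    b ∈ dplusImage hT hp ↔
      ∃ w ∈ oneWords A p, evalUniv A w ∈ Dplus (THAcover A) ∧ evalBKM A w = b := by
  constructor
  · rintro ⟨w, ⟨hw, hD⟩, rfl⟩
    exact ⟨w, hw, hD, rfl⟩
  · rintro ⟨w, hw, hD, rfl⟩
    exact ⟨w, ⟨hw, hD⟩, rfl⟩

/-- As `C₊` is contained in `D₊`, the class of a word modulo `D₊` is determined by its value in the
BKM superalgebra. -/
theorem evalBKM_mem_dplusImage_iff (hT : ∃ M, IsAdmissible A M) {p : ℕ} (hp : 1 ≤ p)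
    {w : Words (BOne A)} (hw : w ∈ oneWords A p) :
    evalBKM A w ∈ dplusImage hT hp ↔ evalUniv A w ∈ Dplus (THAcover A) := by
  rw [mem_dplusImage_iff]
  refine ⟨?_, fun h => ⟨w, hw, h, rfl⟩⟩
  rintro ⟨w', hw', hD, h⟩
  have hC : evalUniv A (w - w') ∈ Cplus A p := by
    refine ⟨w - w', ⟨sub_mem hw hw', ?_⟩, rfl⟩
    change evalBKM A (w - w') = 0
    rw [map_sub, h, sub_self]
  have h1 := add_mem (Cplus_le_Dplus p hC) hD
  rwa [map_sub, sub_add_cancel] at h1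

variable (A) in
/-- The value of a word in elements of degree one in the tensor hierarchy algebra. -/
def evalTHA (p : ℕ) : oneWords A p →ₗ[ℂ] THA.deg A p where
  toFun w := ⟨Red.mk _ ⟨evalUniv A w, evalUniv_mem_cover _⟩, _, (eval_mem w.2).2, rfl⟩
  map_add' v w := by
    have h : (⟨evalUniv A (v + w : Words (BOne A)), evalUniv_mem_cover _⟩ : THAcover A) =
        ⟨evalUniv A v, evalUniv_mem_cover _⟩ + ⟨evalUniv A w, evalUniv_mem_cover _⟩ :=
      Subtype.ext (map_add (evalUniv A) _ _)
    exact Subtype.ext ((congrArg (Red.mk (THAcover A)) h).trans (map_add _ _ _))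
  map_smul' c w := by
    have h : (⟨evalUniv A (c • w : Words (BOne A)), evalUniv_mem_cover _⟩ : THAcover A) =
        c • ⟨evalUniv A w, evalUniv_mem_cover _⟩ := Subtype.ext (map_smul (evalUniv A) _ _)
    exact Subtype.ext ((congrArg (Red.mk (THAcover A)) h).trans (map_smul _ _ _))

theorem evalTHA_surjective {p : ℕ} (hp : 1 ≤ p) : Function.Surjective (evalTHA A p) := by
  rintro ⟨_, ⟨a, ha⟩, hd, rfl⟩
  obtain ⟨w, hw, rfl⟩ := Univ.deg_le_wordPart (by exact_mod_cast hp) hd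
  exact ⟨⟨w, hw⟩, rfl⟩

theorem evalTHA_eq_zero_iff {p : ℕ} (w : oneWords A p) :
    evalTHA A p w = 0 ↔ evalUniv A w ∈ Dplus (THAcover A) :=
  Subtype.ext_iff.trans (Submodule.Quotient.mk_eq_zero (DplusIn (THAcover A)))

/-- Choosing a word for every element of the tensor hierarchy algebra, and projecting its value in the
BKM superalgebra along `dplusImage`, gives an embedding which does not depend on the choice. -/
theorem exists_equivariant_embedding [ComplementedLattice (LieSubmodule ℂ (gSub A) (BKM A))]
    (hT : ∃ M, IsAdmissible A M) {p : ℕ} (hp : 1 ≤ p) :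
    ∃ f : THA.deg A p →ₗ[ℂ] BKM.deg A p, Function.Injective f ∧
      ∀ (z : gSub A) (y : THA.deg A p), f (rRep hT p z y) = sRep A p z (f y) := by
  obtain ⟨π, hker, hsub, hlie⟩ := exists_equivariant_projection (dplusImage hT hp)
  obtain ⟨σ, hσ⟩ := LinearMap.exists_rightInverse_of_surjective (evalTHA A p)
    (LinearMap.range_eq_top.2 (evalTHA_surjective hp))
  have hdeg : ∀ w ∈ oneWords A p, π (evalBKM A w) ∈ BKM.deg A p := fun w hw => by
    obtain ⟨w', hw', -, h⟩ := (mem_dplusImage_iff hT hp).1 (hsub (evalBKM A w))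
    rw [← sub_sub_cancel (evalBKM A w) (π (evalBKM A w)), ← h]
    exact sub_mem (eval_mem hw).1 (eval_mem hw').1
  let f : THA.deg A p →ₗ[ℂ] BKM.deg A p := LinearMap.codRestrict _
    (π ∘ₗ (evalBKM A : Words (BOne A) →ₗ[ℂ] BKM A) ∘ₗ (oneWords A p).subtype ∘ₗ σ)
    fun y => hdeg _ (σ y).2
  have hzero : ∀ w : oneWords A p, π (evalBKM A w) = 0 ↔ evalTHA A p w = 0 := fun w => by
    rw [hker, evalBKM_mem_dplusImage_iff hT hp w.2, evalTHA_eq_zero_iff]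
  -- The value of `f` on the class of a word does not depend on the word.
  have hf : ∀ w : oneWords A p, (f (evalTHA A p w) : BKM A) = π (evalBKM A w) := fun w => by
    have h : evalTHA A p (σ (evalTHA A p w) - w) = 0 := by
      rw [map_sub, sub_eq_zero]
      exact LinearMap.congr_fun hσ _
    have h1 := (hzero _).2 h
    rw [Submodule.coe_sub, map_sub, map_sub, sub_eq_zero] at h1
    exact h1
  refine ⟨f, ?_, fun z y => ?_⟩
  · rw [← LinearMap.ker_eq_bot, LinearMap.ker_eq_bot']
    intro y hy
    obtain ⟨w, rfl⟩ := evalTHA_surjective hp y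
    rw [← hzero, ← hf, hy]
    rfl
  · obtain ⟨w, rfl⟩ := evalTHA_surjective hp y
    obtain ⟨w', hw', h1, h2⟩ := exists_word_action hp z w.2
    have h3 : rRep hT p z (evalTHA A p w) = evalTHA A p ⟨w', hw'⟩ :=
      Subtype.ext (congrArg (Red.mk (THAcover A)) (Subtype.ext h2.symm))
    refine Subtype.ext ?_
    rw [h3, hf]
    change π (evalBKM A w') = (z : BKM A) * (f (evalTHA A p w) : BKM A)
    rw [hf, h1]
    exact hlie z _

end Embedding

end TensorHierarchy

end

theorem mainTheorem4 {r : ℕ} (A : Matrix (Fin (r + 1)) (Fin (r + 1)) ℤ) (D : ℕ)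
    (hA : TensorHierarchy.IsExtendedCartan A D)
    (hT : ∃ M, TensorHierarchy.IsAdmissible A M) (p : ℕ) (hp : 1 ≤ p) :
    TensorHierarchy.Cplus A p ≤ TensorHierarchy.Dplus (TensorHierarchy.THAcover A) ∧
    ∃ f : TensorHierarchy.THA.deg A p →ₗ[ℂ] TensorHierarchy.BKM.deg A p,
      Function.Injective f ∧
      ∀ (z : TensorHierarchy.gSub A) (y : TensorHierarchy.THA.deg A p),
        f (TensorHierarchy.rRep hT p z y) = TensorHierarchy.sRep A p z (f y) := by
  have := TensorHierarchy.complementedLattice_bkm hA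
  exact ⟨TensorHierarchy.Cplus_le_Dplus p, TensorHierarchy.exists_equivariant_embedding hT hp⟩
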